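/- **Setting.** Let $d\ge 2$. A *profile* is a radial, radially non-increasing function $j\ge 0$ on $\mathbb R^d\setminus\{0\}$ with $\int_{\mathbb R^d}(1\wedge|x|)\,j(x)\,dx<\infty$. For a kernel $\phi$ put $C_\phi=\int_{\mathbb R^d}(1\wedge|x|)\,\phi(x)\,dx$ and $\lambda_\phi(dx)=C_\phi^{-1}(1\wedge|x|)\,\phi(x)\,dx$. Let $\kappa_k=\mathcal H^k(\mathbb S^k)$ and $\widetilde\chi_E=\chi_{E^c}-\chi_E$. Let $\mathfrak C$ be the class of closures of open subsets of $\mathbb R^d$ with compact $C^2$ boundary. Write $E_n\to E$ in $\mathfrak C$ if $E_n=\Phi_n(E)$ for $C^2$ diffeomorphisms $\Phi_n$ of $\mathbb R^d$ with $\|\Phi_n-\mathrm{Id}\|_{C^2}\to 0$. For $E\in\mathfrak C$ and $x\in\partial E$ let $\nu_E(x)$ be the outer unit normal. For a unit vector $e\perp\nu_E(x)$ let $K_e(x,E)=-D^2f(0)e\cdot e$, where, with $x$ moved to the origin, $E$ is near $x$ the subgraph in direction $\nu_E(x)$ of a $C^2$ function $f$ on $\nu_E(x)^\perp$ with $f(0)=0$,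 $\nabla f(0)=0$. The nonlocal curvatures with kernel $\phi$ are $$H_\phi(x,E)=\frac1{\kappa_{d-2}}\lim_{r\downarrow0}\int_{B_r(x)^c}\widetilde\chi_E(y)\,\phi(x-y)\,dy,$$ $$K_{\phi,e}(x,E)=\frac12\lim_{r\downarrow0}\int_{B_r(x)^c\cap\pi(x,e)}\widetilde\chi_E(y)\,|Px-Py|^{d-2}\phi(x-y)\,dy,$$ where $\pi(x,e)$ is the plane through $x$ spanned by $e$ and $\nu_E(x)$, with its two-dimensional Lebesgue measure, and $P$ is the orthogonal projection onto the line through $x$ in direction $e$. **Proposition.** For $\varepsilon>0$ let $\phi_\varepsilon(x)=g_\varepsilon(x/|x|)\,j_\varepsilon(x)$, where $j_\varepsilon$ is a profile that does not vanish identically and $g_\varepsilon:\mathbb S^{d-1}\to[0,\infty)$ is continuous and even. Suppose that $g_\varepsilon\to g$ uniformly on $\mathbb S^{d-1}$ as $\varepsilon\downarrow0$, where $g\not\equiv0$, and that $\lim_{\varepsilon\downarrow0}\lambda_{\phi_\varepsilon}(B_R(0)^c)=0$ for every $R>0$. Let $\overline\phi_\varepsilon$, $\varepsilon>0$, be Borel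 functions with $$\phi_\varepsilon+\overline\phi_\varepsilon\ge0,\qquad \overline\phi_\varepsilon(-x)=\overline\phi_\varepsilon(x),\qquad |\overline\phi_\varepsilon(x)|\le\overline j_\varepsilon(x)\qquad(x\ne 0)$$ for profiles $\overline j_\varepsilon$ such that $$\lim_{\varepsilon\downarrow0}C_{\phi_\varepsilon}^{-1}\int_{\mathbb R^d}(1\wedge|x|)\,\overline j_\varepsilon(x)\,dx=0.$$ Let $\varepsilon_n>0$, $\varepsilon_n\to0$, let $E,E_n\in\mathfrak C$ with $E_n\to E$ in $\mathfrak C$, and let $x\in\partial E\cap\bigcap_n\partial E_n$. Set $C_g=\int_{\mathbb S^{d-1}}g\,d\mathcal H^{d-1}$. Then: 1. Let $e$ be a unit vector with $e\perp\nu_E(x)$, and let $e_n$ be unit vectors with $e_n\perp\nu_{E_n}(x)$ and $e_n\to e$ (for instance $e_n=e$, if $e$ is tangent to all the $\partial E_n$ at $x$). Then $K_{\phi_{\varepsilon_n}+\overline\phi_{\varepsilon_n},e_n}(x,E_n)$ exists and is finite for every $n$, and $$\lim_{n\to\infty}C_{\phi_{\varepsilon_n}}^{-1}K_{\phi_{\varepsilon_n}+\overline\phi_{\varepsilon_n},e_n}(x,E_n)=C_g^{-1}\,g(e)\,K_e(x,E).$$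 2. $H_{\phi_{\varepsilon_n}+\overline\phi_{\varepsilon_n}}(x,E_n)$ exists and is finite for every $n$, and $$\lim_{n\to\infty}C_{\phi_{\varepsilon_n}}^{-1}H_{\phi_{\varepsilon_n}+\overline\phi_{\varepsilon_n}}(x,E_n)=\frac1{C_g\,\kappa_{d-2}}\int_{\mathbb S^{d-1}\cap\nu_E(x)^\perp}g(e)\,K_e(x,E)\,\mathcal H^{d-2}(de).$$ -/

import Mathlib

open Set Filter Topology MeasureTheory Metric
open scoped RealInnerProductSpace

noncomputable section

namespace NonlocalCurvature

/-! ### Smooth sets, normals and classical directional curvature -/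

section Geometry

variable {V : Type*} [NormedAddCommGroup V] [InnerProductSpace ℝ V]

/-- The component of `y` orthogonal to the unit vector `ν`. -/
def tangentialPart (ν y : V) : V := y - ⟪y, ν⟫ • ν

/-- `f` describes the set `E` near its boundary point `p` in normal coordinates at `p`: after
translating `p` to the origin, `E` coincides near the origin with the subgraph
`{y : ⟪y, ν⟫ ≤ f (y')}`, `y'` being the component of `y` orthogonal to the unit vector `ν`, where
`f` is of class `C²` near the origin, `f 0 = 0` and `∇ f 0 = 0`. Hence `ν` is the outer unit normal
of `E` at `p`. Only the values of `f` on the hyperplane orthogonal to `ν` matter. -/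
structure IsNormalGraph (E : Set V) (p ν : V) (f : V → ℝ) : Prop where
  norm_eq_one : ‖ν‖ = 1
  contDiffAt : ContDiffAt ℝ 2 f 0
  map_zero : f 0 = 0
  fderiv_zero : fderiv ℝ f 0 = 0
  mem_iff : ∀ᶠ y in 𝓝 p, y ∈ E ↔ ⟪y - p, ν⟫ ≤ f (tangentialPart ν (y - p))

/-- The class of closures of open sets with compact boundary of class `C²`: the set is the closure
of its interior, its boundary is compact, and near each boundary point the set is, in normal
coordinates, the subgraph of a `C²` function. -/
structure IsC2Set (E : Set V) : Prop where
  closure_interior : closure (interior E) = E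
  isCompact_frontier : IsCompact (frontier E)
  exists_graph : ∀ p ∈ frontier E, ∃ (ν : V) (f : V → ℝ), IsNormalGraph E p ν f

/-- Convergence `E n → E` by diffeomorphisms: there are `C²` diffeomorphisms `Φ n` of the whole
space with `E n = Φ n (E)`, and `Φ n - id` converges to `0` in the `C²` norm, that is, uniformly
together with its derivatives of order one and two. -/
def C2Converges (En : ℕ → Set V) (E : Set V) : Prop :=
  ∃ Φ : ℕ → (V ≃ V),
    (∀ n, ContDiff ℝ 2 (Φ n) ∧ ContDiff ℝ 2 (Φ n).symm) ∧
    (∀ n, En n = Φ n '' E) ∧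
    ∀ k : ℕ, k ≤ 2 →
      TendstoUniformly (fun n y => iteratedFDeriv ℝ k (fun z => Φ n z - z) y) (fun _ => 0) atTop

open Classical in
/-- The outer unit normal `ν(x)` of `E` at the boundary point `x` (and `0` if `E` has no boundary
of class `C²` near `x`). -/
def outerNormal (E : Set V) (x : V) : V :=
  if h : ∃ (ν : V) (f : V → ℝ), IsNormalGraph E x ν f then h.choose else 0

open Classical in
/-- The classical directional curvature `K_e(x, E) = - D²f(0) e ⬝ e` of `E` at the boundary point
`x` in the tangential unit direction `e`, where `E` is near `x` the subgraph of `f` in normal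
coordinates. -/
def directionalCurvature (E : Set V) (x e : V) : ℝ :=
  if h : ∃ f : V → ℝ, IsNormalGraph E x (outerNormal E x) f
    then - fderiv ℝ (fderiv ℝ h.choose) 0 e e else 0

/-- `χ̃_E`, equal to `1` outside `E` and to `-1` on `E`. -/
def signedIndicator (E : Set V) (y : V) : ℝ :=
  Eᶜ.indicator (fun _ => (1 : ℝ)) y - E.indicator (fun _ => (1 : ℝ)) y

end Geometry

/-! ### Surface measures on unit spheres -/

section Spheres

variable {V : Type*} [NormedAddCommGroup V] [InnerProductSpace ℝ V] [FiniteDimensional ℝ V]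
  [MeasurableSpace V] [BorelSpace V]

/-- Lebesgue measure of a finite dimensional Euclidean space: unit cubes have measure one. -/
def lebesgue (W : Type*) [NormedAddCommGroup W] [InnerProductSpace ℝ W] [FiniteDimensional ℝ W]
    [MeasurableSpace W] [BorelSpace W] : Measure W :=
  (stdOrthonormalBasis ℝ W).toBasis.addHaar

/-- The surface measure on the unit sphere `{e : ‖e‖ = 1, e ⟂ ν}` of the hyperplane orthogonal to
the unit vector `ν`, as a measure on the ambient space: for `dim V = d` it is `ℋ^{d-2}` restricted
to that sphere. -/
def tangentSphereMeasure (ν : V) : Measure V :=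
  (lebesgue (ℝ ∙ ν)ᗮ).toSphere.map
    (fun e : sphere (0 : (ℝ ∙ ν)ᗮ) 1 => ((e : (ℝ ∙ ν)ᗮ) : V))

/-- `κ_k = ℋ^k(𝕊^k)`, the area of the unit sphere of `ℝ^{k+1}`. -/
def sphereArea (k : ℕ) : ℝ :=
  (volume : Measure (EuclideanSpace ℝ (Fin (k + 1)))).toSphere.real univ

end Spheres

/-! ### Kernels -/

section Kernels

variable {d : ℕ}

/-- Radial, radially non-increasing, non-negative profiles `j` with `∫ (1 ∧ |x|) j(x) dx < ∞`.
The value at the origin is irrelevant (`j` may be singular there), and comparing points of equal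
norm in `antitone` gives that `j` is radial. -/
structure IsRadialProfile (j : EuclideanSpace ℝ (Fin d) → ℝ) : Prop where
  nonneg : ∀ x, x ≠ 0 → 0 ≤ j x
  antitone : ∀ x y, x ≠ 0 → ‖x‖ ≤ ‖y‖ → j y ≤ j x
  integrable : Integrable (fun x => min 1 ‖x‖ * j x)

/-- The anisotropic kernel `φ(x) = g(x / |x|) j(x)`. -/
def anisotropicKernel (g j : EuclideanSpace ℝ (Fin d) → ℝ) (x : EuclideanSpace ℝ (Fin d)) : ℝ :=
  g (‖x‖⁻¹ • x) * j x

/-- `C_φ = ∫ (1 ∧ |x|) φ(x) dx`. -/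
def kernelMass (φ : EuclideanSpace ℝ (Fin d) → ℝ) : ℝ :=
  ∫ x, min 1 ‖x‖ * φ x

/-- The measure `λ_φ(dx) = C_φ⁻¹ (1 ∧ |x|) φ(x) dx`. -/
def kernelMeasure (φ : EuclideanSpace ℝ (Fin d) → ℝ) : Measure (EuclideanSpace ℝ (Fin d)) :=
  volume.withDensity (fun x => ENNReal.ofReal ((kernelMass φ)⁻¹ * (min 1 ‖x‖ * φ x)))

/-- `C_g = ∫_{𝕊^{d-1}} g dℋ^{d-1}`. -/
def sphericalMass (g : EuclideanSpace ℝ (Fin d) → ℝ) : ℝ :=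
  ∫ θ : sphere (0 : EuclideanSpace ℝ (Fin d)) 1, g θ ∂(volume.toSphere)

/-! ### Nonlocal curvatures -/

/-- `H` is the nonlocal mean curvature `H_φ(x, E)`: the integrals of `χ̃_E(y) φ(x - y)` over the
complements of the balls `B_r(x)` converge absolutely, and divided by `κ_{d-2}` they tend to `H` as
`r ↓ 0`. -/
def HasNonlocalMeanCurvature (φ : EuclideanSpace ℝ (Fin d) → ℝ) (x : EuclideanSpace ℝ (Fin d))
    (E : Set (EuclideanSpace ℝ (Fin d))) (H : ℝ) : Prop :=
  (∀ r > 0, IntegrableOn (fun y => signedIndicator E y * φ (x - y)) (ball x r)ᶜ) ∧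
  Tendsto (fun r : ℝ => (sphereArea (d - 2))⁻¹ *
    ∫ y in (ball x r)ᶜ, signedIndicator E y * φ (x - y)) (𝓝[>] 0) (𝓝 H)

/-- The point with coordinates `q = (ρ, h)` in the plane through `x` spanned by `e` and `ν`. -/
def planePoint (x e ν : EuclideanSpace ℝ (Fin d)) (q : ℝ × ℝ) : EuclideanSpace ℝ (Fin d) :=
  x + q.1 • e + q.2 • ν

/-- `K` is the nonlocal directional curvature `K_{φ,e}(x, E)` in the direction of the unit vector
`e` tangent to the boundary of `E` at `x`. With `ν` the outer unit normal of `E` at `x`, integrate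
`χ̃_E(y) |Px - Py|^{d-2} φ(x - y)` over the part outside `B_r(x)` of the plane
`y = x + ρ e + h ν`, where `|Px - Py| = |ρ|`; the integrals converge absolutely, and their halves
tend to `K` as `r ↓ 0`. -/
def HasNonlocalDirectionalCurvature (φ : EuclideanSpace ℝ (Fin d) → ℝ)
    (x : EuclideanSpace ℝ (Fin d)) (e : EuclideanSpace ℝ (Fin d))
    (E : Set (EuclideanSpace ℝ (Fin d))) (K : ℝ) : Prop :=
  let y := planePoint x e (outerNormal E x)
  (∀ r > 0, IntegrableOn (fun q => signedIndicator E (y q) * |q.1| ^ (d - 2) * φ (x - y q))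
    (y ⁻¹' (ball x r)ᶜ)) ∧
  Tendsto (fun r : ℝ => 1 / 2 *
    ∫ q in y ⁻¹' (ball x r)ᶜ, signedIndicator E (y q) * |q.1| ^ (d - 2) * φ (x - y q))
    (𝓝[>] 0) (𝓝 K)

end Kernels

end NonlocalCurvature

end

/-! Write `d = m + 2`. In the plane through `x` spanned by `e` and `ν`, polar coordinates `ρ = r cos
α`, `h = r sin α` turn `|ρ|^m dρ dh` into `r^(m+1) cos^m α dr dα`. The kernel is even, so the factor
`1/2` and the central symmetry replace `χ̃_E` by its even part `symSign` on the half-plane `|α| <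
π/2`. Spherical coordinates around `ν` write the space integral as the integral over tangent unit
vectors `e` of the same half-plane integrals (`space_integral_rawKernel`), so the mean curvature
reduces to the directional ones.

Existence. A `C²` set lies between two paraboloids near `x`, so `symSign` vanishes unless `r ≥ δ` or
`|sin α| ≤ C r` (`symSign_eq_zero`). The slice of this region at radius `r` has angular measure at
most a constant times `1 ∧ r` (`angleMeasure_fanSet_le`). This is the weight for which the profiles
are integrable: the principal values become absolutely convergent integrals, bounded by a constant
times the radial mass `∫ (1 ∧ r) p(r) r^(m+1) dr`. The same bound shows that the perturbations are
negligible.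

Limit. By `tendsto_normal_and_pinched`, the sets `E_n` have at `x` normals `ν_n → ν` and, up to `η
|v|²` with `δ` independent of `n`, the equation `⟪v, ν_n⟫ + B v v / 2 ≤ 0`, where `B` is the Hessian
of the defining function of the limit set. After `α = r β`, the point at radius `r` has height about
`r² β`, so its side is decided by the sign of `β + b` with `b = B e e / 2`, and that of its antipode
by the sign of `-β + b`. The mean of the two signs integrates to `2 b`, so the angular integral
divided by `r` tends to `g(e) B e e = g(e) K_e`, jointly in `n → ∞` and `r ↓ 0`
(`tendsto_angularIntegral_div`). Since the radial mass concentrates at the origin, this is also the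
limit of the curvature divided by the radial mass (`tendsto_integral_of_concentration`). Finally
`C_φ` is the radial mass times the angular mass of `g_ε`, and the latter tends to `C_g`.

For the mean curvature the tangent hyperplanes depend on `n`. Reflections identify them with the
limit hyperplane (`hyperplaneIsometry`), and dominated convergence on its unit sphere concludes. -/

noncomputable section

set_option linter.unusedSectionVars false

namespace NonlocalCurvature

/-! ### Polar coordinates -/

section Polar

/-- The measure `r ^ m dr` on the positive half-line. -/
def radialMeasure (m : ℕ) : Measure ℝ :=
  (volume.restrict (Ioi 0)).withDensity fun r => ENNReal.ofReal (r ^ m)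

/-- The measure `cos α ^ m dα` on `(-π/2, π/2)`. -/
def angleMeasure (m : ℕ) : Measure ℝ :=
  (volume.restrict (Ioo (-(Real.pi / 2)) (Real.pi / 2))).withDensity
    fun a => ENNReal.ofReal (Real.cos a ^ m)

instance (m : ℕ) : SigmaFinite (radialMeasure m) := by
  unfold radialMeasure
  exact SigmaFinite.withDensity_of_ne_top (by simp)

instance (m : ℕ) : SigmaFinite (angleMeasure m) := by
  unfold angleMeasure
  exact SigmaFinite.withDensity_of_ne_top (by simp)

lemma ae_radialMeasure_pos (m : ℕ) : ∀ᵐ r ∂radialMeasure m, 0 < r := by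
  refine (withDensity_absolutelyContinuous _ _).ae_le ?_
  exact ae_restrict_mem measurableSet_Ioi

lemma ae_angleMeasure_mem (m : ℕ) :
    ∀ᵐ a ∂angleMeasure m, a ∈ Ioo (-(Real.pi / 2)) (Real.pi / 2) := by
  refine (withDensity_absolutelyContinuous _ _).ae_le ?_
  exact ae_restrict_mem measurableSet_Ioo

lemma integral_radialMeasure (m : ℕ) (f : ℝ → ℝ) :
    ∫ r, f r ∂radialMeasure m = ∫ r in Ioi 0, r ^ m * f r := by
  unfold radialMeasure
  rw [integral_withDensity_eq_integral_toReal_smul (by fun_prop) (by simp)]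
  refine setIntegral_congr_fun measurableSet_Ioi fun r hr => ?_
  simp [ENNReal.toReal_ofReal (pow_nonneg (le_of_lt hr) m)]

lemma integral_angleMeasure (m : ℕ) (f : ℝ → ℝ) :
    ∫ a, f a ∂angleMeasure m
      = ∫ a in Ioo (-(Real.pi / 2)) (Real.pi / 2), Real.cos a ^ m * f a := by
  unfold angleMeasure
  rw [integral_withDensity_eq_integral_toReal_smul (by fun_prop) (by simp)]
  refine setIntegral_congr_fun measurableSet_Ioo fun a ha => ?_
  simp [ENNReal.toReal_ofReal (pow_nonneg (Real.cos_pos_of_mem_Ioo ha).le m)]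

lemma angleMeasure_le (m : ℕ) :
    angleMeasure m ≤ volume.restrict (Ioo (-(Real.pi / 2)) (Real.pi / 2)) := by
  unfold angleMeasure
  conv_rhs => rw [← withDensity_one (μ := volume.restrict (Ioo (-(Real.pi / 2)) (Real.pi / 2)))]
  refine withDensity_mono ?_
  filter_upwards [ae_restrict_mem measurableSet_Ioo] with a ha
  simp only [Pi.one_apply, ENNReal.ofReal_le_one]
  exact pow_le_one₀ (Real.cos_pos_of_mem_Ioo ha).le (Real.cos_le_one a)

instance (m : ℕ) : IsFiniteMeasure (angleMeasure m) := by
  refine ⟨(angleMeasure_le m univ).trans_lt ?_⟩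
  simp

variable {V : Type*} [NormedAddCommGroup V] [InnerProductSpace ℝ V] [FiniteDimensional ℝ V]
  [MeasurableSpace V] [BorelSpace V]

lemma map_volumeIoiPow (m : ℕ) :
    (Measure.volumeIoiPow m).map (Subtype.val : Ioi (0 : ℝ) → ℝ) = radialMeasure m := by
  ext s hs
  rw [Measure.map_apply measurable_subtype_coe hs, Measure.volumeIoiPow, radialMeasure,
    withDensity_apply _ (measurable_subtype_coe hs), withDensity_apply _ hs]
  rw [Measure.restrict_restrict hs,
    setLIntegral_subtype measurableSet_Ioi _ fun a : ℝ ↦ ENNReal.ofReal (a ^ m),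
    Subtype.image_preimage_coe, inter_comm]

/-- The origin is a null set, so polar coordinates on the punctured space suffice. The radius is
taken in `ℝ`, with a measure carried by the positive half-line, so that these coordinates compose
with those of the half-plane. -/
lemma measurePreserving_polar [Nontrivial V] :
    MeasurePreserving (fun p : sphere (0 : V) 1 × ℝ => p.2 • (p.1 : V))
      ((volume : Measure V).toSphere.prod (radialMeasure (Module.finrank ℝ V - 1))) volume := by
  have h1 := ((volume : Measure V).measurePreserving_homeomorphUnitSphereProd).symm
    (homeomorphUnitSphereProd V).toMeasurableEquiv
  have h2 : MeasurePreserving (Subtype.val : ({0}ᶜ : Set V) → V)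
      ((volume : Measure V).comap Subtype.val) volume := by
    refine ⟨measurable_subtype_coe, ?_⟩
    rw [(MeasurableEmbedding.subtype_coe (measurableSet_singleton _).compl).map_comap,
      Subtype.range_coe]
    exact Measure.restrict_eq_self_of_ae_mem (Measure.ae_ne volume 0)
  have h3 := h2.comp h1
  have h4 : MeasurePreserving
      (Prod.map id Subtype.val : sphere (0 : V) 1 × Ioi (0 : ℝ) → sphere (0 : V) 1 × ℝ)
      ((volume : Measure V).toSphere.prod (Measure.volumeIoiPow (Module.finrank ℝ V - 1)))
      ((volume : Measure V).toSphere.prod (radialMeasure (Module.finrank ℝ V - 1))) := by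
    have h5 : MeasurePreserving (Subtype.val : Ioi (0 : ℝ) → ℝ)
      (Measure.volumeIoiPow (Module.finrank ℝ V - 1))
      (radialMeasure (Module.finrank ℝ V - 1)) := ⟨measurable_subtype_coe, map_volumeIoiPow _⟩
    exact (MeasurePreserving.id _).prod h5
  refine ⟨by fun_prop, ?_⟩
  rw [← h4.map_eq, Measure.map_map (by fun_prop) h4.measurable]
  convert h3.map_eq using 2
  ext p
  simp [homeomorphUnitSphereProd]

lemma lintegral_radialMeasure_prod (m : ℕ) (f : ℝ × ℝ → ENNReal) (hf : Measurable f) :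
    ∫⁻ q, f q ∂((radialMeasure m).prod volume)
      = ∫⁻ q : ℝ × ℝ, (Ioi (0 : ℝ) ×ˢ univ).indicator
          (fun q => ENNReal.ofReal (q.1 ^ m) * f q) q := by
  have : (volume : Measure ℝ) = (volume.restrict univ) := by simp
  conv_lhs => rw [this, radialMeasure, prod_withDensity_left (by fun_prop),
    Measure.prod_restrict, ← Measure.volume_eq_prod]
  rw [lintegral_withDensity_eq_lintegral_mul _ (by fun_prop) hf,
    lintegral_indicator (measurableSet_Ioi.prod MeasurableSet.univ)]
  rfl

/-- The density `ρ^m` equals `r^m cos^m α`, and the Jacobian of polar coordinates supplies one more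
factor `r`. -/
lemma measurePreserving_halfPlane (m : ℕ) :
    MeasurePreserving (fun p : ℝ × ℝ => (p.1 * Real.cos p.2, p.1 * Real.sin p.2))
      ((radialMeasure (m + 1)).prod (angleMeasure m)) ((radialMeasure m).prod volume) := by
  refine ⟨by fun_prop, ?_⟩
  refine Measure.ext_of_lintegral _ fun f hf => ?_
  rw [lintegral_map hf (by fun_prop), lintegral_radialMeasure_prod m f hf,
    ← lintegral_comp_polarCoord_symm, radialMeasure, angleMeasure,
    prod_withDensity (by fun_prop) (by fun_prop), Measure.prod_restrict, ← Measure.volume_eq_prod,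
    lintegral_withDensity_eq_lintegral_mul _ (by fun_prop) (by fun_prop),
    ← lintegral_indicator (measurableSet_Ioi.prod measurableSet_Ioo),
    ← lintegral_indicator polarCoord.open_target.measurableSet]
  refine lintegral_congr fun p => ?_
  have hpi := Real.pi_pos
  by_cases h1 : p ∈ Ioi (0 : ℝ) ×ˢ Ioo (-(Real.pi / 2)) (Real.pi / 2)
  · have h2 : p ∈ polarCoord.target := by
      rw [polarCoord_target]
      exact ⟨h1.1, by linarith [h1.2.1], by linarith [h1.2.2]⟩
    have hr : 0 < p.1 := h1.1
    have hc : 0 < Real.cos p.2 := Real.cos_pos_of_mem_Ioo h1.2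
    rw [indicator_of_mem h1, indicator_of_mem h2, indicator_of_mem (by
      simp only [polarCoord_symm_apply, mem_prod, mem_Ioi, mem_univ, and_true]; positivity)]
    simp only [polarCoord_symm_apply, Pi.mul_apply, smul_eq_mul]
    rw [← ENNReal.ofReal_mul (by positivity), ← mul_assoc, ← ENNReal.ofReal_mul (by positivity)]
    congr 2
    ring
  -- The polar chart runs over angles in `(-π, π)`. Those outside `(-π/2, π/2)` have nonpositive
  -- cosine and land outside the half-plane `ρ > 0`.
  · rw [indicator_of_notMem h1]
    by_cases h2 : p ∈ polarCoord.target
    · rw [indicator_of_mem h2, indicator_of_notMem, smul_zero]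
      rw [polarCoord_target] at h2
      have hr : 0 < p.1 := h2.1
      simp only [polarCoord_symm_apply, mem_prod, mem_Ioi, mem_univ, and_true, not_lt]
      refine mul_nonpos_of_nonneg_of_nonpos hr.le ?_
      by_contra hcon
      push Not at hcon
      refine h1 ⟨hr, ?_, ?_⟩
      · by_contra h3
        have := Real.cos_nonpos_of_pi_div_two_le_of_le (x := -p.2) (by linarith)
          (by linarith [h2.2.1])
        rw [Real.cos_neg] at this
        linarith
      · by_contra h3
        have := Real.cos_nonpos_of_pi_div_two_le_of_le (x := p.2) (by linarith)
          (by linarith [h2.2.2])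
        linarith
    · rw [indicator_of_notMem h2]

variable {W : Type*} [NormedAddCommGroup W] [InnerProductSpace ℝ W] [FiniteDimensional ℝ W]
  [MeasurableSpace W] [BorelSpace W]

/-- Adding a unit vector `ν` orthogonal to the hyperplane `ι W`. -/
lemma measurePreserving_add_smul (ι : W →ₗᵢ[ℝ] V) (ν : V) (hν : ‖ν‖ = 1)
    (hι : ∀ w, ⟪ι w, ν⟫ = 0) (hdim : Module.finrank ℝ V = Module.finrank ℝ W + 1) :
    MeasurePreserving (fun p : W × ℝ => ι p.1 + p.2 • ν) (volume.prod volume) volume := by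
  -- The plain product carries the supremum norm, so the isometry starts from the `L²` product,
  -- whose identification with the plain product preserves volume.
  let L₀ : WithLp 2 (W × ℝ) →ₗᵢ[ℝ] V :=
    { toLinearMap := (ι.toLinearMap.coprod (LinearMap.toSpanSingleton ℝ V ν)).comp
        (WithLp.linearEquiv 2 ℝ (W × ℝ)).toLinearMap
      norm_map' := by
        intro p
        have h1 : ‖ι p.fst + p.snd • ν‖ ^ 2 = ‖p‖ ^ 2 := by
          rw [norm_add_sq_real, real_inner_smul_right, hι, norm_smul, hν, WithLp.prod_norm_sq_eq_of_L2]
          simp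
        exact (sq_eq_sq₀ (norm_nonneg _) (norm_nonneg _)).1 h1 }
  let L := L₀.toLinearIsometryEquiv (by
    rw [hdim, (WithLp.linearEquiv 2 ℝ (W × ℝ)).finrank_eq]; simp)
  have h := L.measurePreserving.comp (WithLp.volume_preserving_toLp W ℝ)
  exact h

/-- Spherical coordinates around the axis `ν`. -/
lemma measurePreserving_spherical [Nontrivial W] (ι : W →ₗᵢ[ℝ] V) (ν : V) (hν : ‖ν‖ = 1)
    (hι : ∀ w, ⟪ι w, ν⟫ = 0) {m : ℕ} (hV : Module.finrank ℝ V = m + 2)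
    (hW : Module.finrank ℝ W = m + 1) :
    MeasurePreserving (fun p : sphere (0 : W) 1 × (ℝ × ℝ) =>
        p.2.1 • (Real.cos p.2.2 • ι p.1 + Real.sin p.2.2 • ν))
      ((volume : Measure W).toSphere.prod ((radialMeasure (m + 1)).prod (angleMeasure m)))
      volume := by
  -- The half-plane coordinates give `(ρ, h)`; then `ρ` and the direction form polar coordinates of
  -- the hyperplane, to which the height `h` along `ν` is added.
  have h1 := (MeasurePreserving.id (volume : Measure W).toSphere).prod
    (measurePreserving_halfPlane m)
  have h2 := (measurePreserving_prodAssoc (volume : Measure W).toSphere (radialMeasure m)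
    (volume : Measure ℝ)).symm MeasurableEquiv.prodAssoc
  have h3 := (measurePreserving_polar (V := W)).prod (MeasurePreserving.id (volume : Measure ℝ))
  rw [hW] at h3
  have h4 := measurePreserving_add_smul ι ν hν hι (by rw [hV, hW])
  have h := h4.comp (h3.comp (h2.comp h1))
  convert h using 1
  ext p
  simp [MeasurableEquiv.prodAssoc, smul_smul]

lemma integrable_radialMeasure_prod_iff (m : ℕ) (f : ℝ × ℝ → ℝ) :
    Integrable f ((radialMeasure m).prod volume)
      ↔ IntegrableOn (fun q : ℝ × ℝ => |q.1| ^ m * f q) (Ioi 0 ×ˢ univ) := by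
  have : (volume : Measure ℝ) = (volume.restrict univ) := by simp
  conv_lhs => rw [this, radialMeasure, prod_withDensity_left (by fun_prop),
    Measure.prod_restrict, ← Measure.volume_eq_prod]
  rw [integrable_withDensity_iff_integrable_smul' (by fun_prop) (by simp)]
  refine integrableOn_congr_fun (fun q hq => ?_) (measurableSet_Ioi.prod MeasurableSet.univ)
  have hq : 0 < q.1 := hq.1
  simp [ENNReal.toReal_ofReal (pow_nonneg hq.le m), abs_of_pos hq]

lemma integral_radialMeasure_prod (m : ℕ) (f : ℝ × ℝ → ℝ) :
    ∫ q, f q ∂((radialMeasure m).prod volume)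
      = ∫ q in Ioi (0 : ℝ) ×ˢ (univ : Set ℝ), |q.1| ^ m * f q := by
  have : (volume : Measure ℝ) = (volume.restrict univ) := by simp
  conv_lhs => rw [this, radialMeasure, prod_withDensity_left (by fun_prop),
    Measure.prod_restrict, ← Measure.volume_eq_prod]
  rw [integral_withDensity_eq_integral_toReal_smul (by fun_prop) (by simp)]
  refine setIntegral_congr_fun (measurableSet_Ioi.prod MeasurableSet.univ) fun q hq => ?_
  have hq : 0 < q.1 := hq.1
  simp [ENNReal.toReal_ofReal (pow_nonneg hq.le m), abs_of_pos hq]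

lemma ae_fst_ne_zero : ∀ᵐ q : ℝ × ℝ, q.1 ≠ 0 := by
  have := Measure.ae_ne (volume : Measure ℝ) 0
  rw [Measure.volume_eq_prod]
  exact Measure.quasiMeasurePreserving_fst.ae this

lemma volume_halfPlanes :
    (volume : Measure (ℝ × ℝ)) = volume.restrict (Ioi 0 ×ˢ univ ∪ Neg.neg ⁻¹' (Ioi 0 ×ˢ univ)) := by
  symm
  refine Measure.restrict_eq_self_of_ae_mem ?_
  filter_upwards [ae_fst_ne_zero] with q hq
  rcases lt_or_gt_of_ne hq with h | h
  · right; simpa using h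
  · left; simpa using h

/-- The plane is the union of two half-planes exchanged by the central symmetry. -/
lemma integrable_abs_pow_mul (m : ℕ) {H : ℝ × ℝ → ℝ}
    (h1 : Integrable H ((radialMeasure m).prod volume))
    (h2 : Integrable (fun q => H (-q)) ((radialMeasure m).prod volume)) :
    Integrable fun q : ℝ × ℝ => |q.1| ^ m * H q := by
  rw [integrable_radialMeasure_prod_iff] at h1 h2
  rw [← integrableOn_univ, IntegrableOn, Measure.restrict_univ, volume_halfPlanes]
  refine IntegrableOn.union h1 ?_
  have h3 := (Measure.measurePreserving_neg (volume : Measure (ℝ × ℝ))).integrableOn_comp_preimage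
    (MeasurableEquiv.neg (ℝ × ℝ)).measurableEmbedding (f := fun q : ℝ × ℝ => |q.1| ^ m * H (-q))
    (s := Ioi 0 ×ˢ univ)
  refine (h3.2 h2).congr_fun (fun q _ => ?_) ?_
  · simp
  · exact measurable_neg (measurableSet_Ioi.prod MeasurableSet.univ)

/-- The left half-plane is the reflection of the right one. This is where the `1/2` in the
definition of the directional curvature becomes an average of the integrand with its reflection. -/
lemma integral_abs_pow_mul (m : ℕ) {H : ℝ × ℝ → ℝ}
    (h1 : Integrable H ((radialMeasure m).prod volume))
    (h2 : Integrable (fun q => H (-q)) ((radialMeasure m).prod volume)) :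
    1 / 2 * ∫ q : ℝ × ℝ, |q.1| ^ m * H q
      = ∫ q, (H q + H (-q)) / 2 ∂((radialMeasure m).prod volume) := by
  have hint := integrable_abs_pow_mul m h1 h2
  have hm : MeasurableSet (Neg.neg ⁻¹' (Ioi (0 : ℝ) ×ˢ univ) : Set (ℝ × ℝ)) :=
    measurable_neg (measurableSet_Ioi.prod MeasurableSet.univ)
  have h3 : ∫ q : ℝ × ℝ in Neg.neg ⁻¹' (Ioi (0 : ℝ) ×ˢ univ), |q.1| ^ m * H q
      = ∫ q : ℝ × ℝ in Ioi (0 : ℝ) ×ˢ univ, |q.1| ^ m * H (-q) := by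
    rw [← (Measure.measurePreserving_neg (volume : Measure (ℝ × ℝ))).setIntegral_preimage_emb
      (MeasurableEquiv.neg (ℝ × ℝ)).measurableEmbedding (fun q : ℝ × ℝ => |q.1| ^ m * H (-q))
      (Ioi 0 ×ˢ univ)]
    exact setIntegral_congr_fun hm fun q _ => by simp
  rw [integral_div, integral_add h1 h2, integral_radialMeasure_prod, integral_radialMeasure_prod,
    ← h3]
  conv_lhs => rw [volume_halfPlanes]
  rw [setIntegral_union _ hm hint.integrableOn hint.integrableOn]
  · ring
  · rw [Set.disjoint_left]
    rintro q hq hq'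
    have h4 : 0 < q.1 := hq.1
    have h5 : 0 < -q.1 := hq'.1
    linarith

lemma integrable_comp_halfPlane_iff (m : ℕ) {H : ℝ × ℝ → ℝ} (hH : Measurable H) :
    Integrable (fun p : ℝ × ℝ => H (p.1 * Real.cos p.2, p.1 * Real.sin p.2))
      ((radialMeasure (m + 1)).prod (angleMeasure m))
      ↔ Integrable H ((radialMeasure m).prod volume) :=
  (measurePreserving_halfPlane m).integrable_comp hH.aestronglyMeasurable

lemma integral_comp_halfPlane (m : ℕ) {H : ℝ × ℝ → ℝ} (hH : Measurable H) :
    ∫ p : ℝ × ℝ, H (p.1 * Real.cos p.2, p.1 * Real.sin p.2)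
      ∂((radialMeasure (m + 1)).prod (angleMeasure m))
      = ∫ q, H q ∂((radialMeasure m).prod volume) := by
  rw [← (measurePreserving_halfPlane m).map_eq,
    integral_map (by fun_prop) hH.aestronglyMeasurable]

end Polar

/-! ### Second order approximation of smooth sets -/

section Approximation

variable {V : Type*} [NormedAddCommGroup V] [InnerProductSpace ℝ V]

/-- Second order Taylor estimate along the segment from `p` to `p + u`. -/
lemma norm_sub_taylor_two_le {G : Type*} [NormedAddCommGroup G] [NormedSpace ℝ G] {f : V → G}
    {p u : V} {B : V →L[ℝ] V →L[ℝ] G} {η : ℝ} (hη : 0 ≤ η)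
    (hf : ∀ t ∈ Icc (0 : ℝ) 1, DifferentiableAt ℝ f (p + t • u))
    (hB : ∀ t ∈ Icc (0 : ℝ) 1,
      ‖fderiv ℝ f (p + t • u) - fderiv ℝ f p - B (t • u)‖ ≤ η * ‖t • u‖) :
    ‖f (p + u) - f p - fderiv ℝ f p u - (1 / 2 : ℝ) • B u u‖ ≤ η * ‖u‖ ^ 2 := by
  -- Mean value inequality for `f` minus its quadratic model. The form `B` need not be the second
  -- derivative at `p`: later it is the Hessian at a nearby point.
  let g : ℝ → G := fun t => f (p + t • u) - t • fderiv ℝ f p u - (t ^ 2 / 2) • B u u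
  have hg : ∀ t ∈ Icc (0 : ℝ) 1, HasDerivWithinAt g
      (fderiv ℝ f (p + t • u) u - fderiv ℝ f p u - t • B u u) (Icc 0 1) t := by
    intro t ht
    have h1 : HasDerivAt (fun t : ℝ => p + t • u) u t := by
      simpa using ((hasDerivAt_id t).smul_const u).const_add p
    have h2 := (hf t ht).hasFDerivAt.comp_hasDerivAt t h1
    have h3 : HasDerivAt (fun t : ℝ => t • fderiv ℝ f p u) (fderiv ℝ f p u) t := by
      simpa using (hasDerivAt_id t).smul_const (fderiv ℝ f p u)
    have h4 : HasDerivAt (fun t : ℝ => (t ^ 2 / 2) • B u u) (t • B u u) t := by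
      have h5 : HasDerivAt (fun t : ℝ => t ^ 2 / 2) t t := by
        exact ((hasDerivAt_pow 2 t).div_const 2).congr_deriv (by simp)
      exact h5.smul_const _
    exact ((h2.sub h3).sub h4).hasDerivWithinAt
  have hb : ∀ t ∈ Ico (0 : ℝ) 1,
      ‖fderiv ℝ f (p + t • u) u - fderiv ℝ f p u - t • B u u‖ ≤ η * ‖u‖ ^ 2 := by
    intro t ht
    have h1 : fderiv ℝ f (p + t • u) u - fderiv ℝ f p u - t • B u u
        = (fderiv ℝ f (p + t • u) - fderiv ℝ f p - B (t • u)) u := by simp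
    rw [h1]
    refine (ContinuousLinearMap.le_opNorm _ _).trans ?_
    have h2 := hB t ⟨ht.1, ht.2.le⟩
    have h3 : ‖t • u‖ ≤ ‖u‖ := by
      rw [norm_smul, Real.norm_of_nonneg ht.1]
      exact mul_le_of_le_one_left (norm_nonneg _) ht.2.le
    calc _ ≤ (η * ‖t • u‖) * ‖u‖ := by gcongr
      _ ≤ (η * ‖u‖) * ‖u‖ := by gcongr
      _ = _ := by ring
  have h := norm_image_sub_le_of_norm_deriv_le_segment_01' hg hb
  convert h using 2
  simp [g]
  abel

/-- Near `x`, up to an error `η ‖v‖ ^ 2`, the set `A` is `{x + v : q v ≤ 0}`. -/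
def Pinched (A : Set V) (x : V) (q : V → ℝ) (η δ : ℝ) : Prop :=
  ∀ v, ‖v‖ < δ → (q v < -(η * ‖v‖ ^ 2) → x + v ∈ A) ∧ (η * ‖v‖ ^ 2 < q v → x + v ∉ A)

/-- The component orthogonal to `ν`, as a continuous linear map. -/
def tangentialCLM (ν : V) : V →L[ℝ] V :=
  ContinuousLinearMap.id ℝ V - (innerSL ℝ ν).smulRight ν

lemma tangentialCLM_apply (ν y : V) : tangentialCLM ν y = tangentialPart ν y := by
  simp [tangentialCLM, tangentialPart, real_inner_comm]

/-- The defining function of a set that is a normal graph near `p`. -/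
def graphDefiningFunction (p ν : V) (f : V → ℝ) (w : V) : ℝ :=
  innerSL ℝ ν (w - p) - f (tangentialCLM ν (w - p))

/-- The Hessian at `p` of the defining function. -/
def graphHessian (ν : V) (f : V → ℝ) : V →L[ℝ] V →L[ℝ] ℝ :=
  -((ContinuousLinearMap.compL ℝ V V ℝ).flip (tangentialCLM ν)).comp
    ((fderiv ℝ (fderiv ℝ f) 0).comp (tangentialCLM ν))

lemma graphHessian_apply (ν : V) (f : V → ℝ) (u v : V) :
    graphHessian ν f u v
      = -fderiv ℝ (fderiv ℝ f) 0 (tangentialCLM ν u) (tangentialCLM ν v) := by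
  simp [graphHessian]

/-! ### Defining functions of normal graphs. -/

section Graph

variable {A : Set V} {p ν : V} {f : V → ℝ}

lemma contDiffAt_graphDefiningFunction (h : IsNormalGraph A p ν f) :
    ContDiffAt ℝ 2 (graphDefiningFunction p ν f) p := by
  unfold graphDefiningFunction
  refine ContDiffAt.sub (by fun_prop) ?_
  have h1 : ContDiffAt ℝ 2 f (tangentialCLM ν (p - p)) := by simpa using h.contDiffAt
  exact ContDiffAt.comp p h1 (by fun_prop)

lemma graphDefiningFunction_self (h : IsNormalGraph A p ν f) :
    graphDefiningFunction p ν f p = 0 := by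
  simp [graphDefiningFunction, h.map_zero]

lemma mem_iff_graphDefiningFunction (h : IsNormalGraph A p ν f) :
    ∀ᶠ w in 𝓝 p, w ∈ A ↔ graphDefiningFunction p ν f w ≤ 0 := by
  filter_upwards [h.mem_iff] with w hw
  rw [hw, graphDefiningFunction, tangentialCLM_apply, sub_nonpos, innerSL_apply_apply,
    real_inner_comm]

lemma fderiv_graphDefiningFunction (h : IsNormalGraph A p ν f) :
    ∀ᶠ w in 𝓝 p, fderiv ℝ (graphDefiningFunction p ν f) w
      = innerSL ℝ ν - (fderiv ℝ f (tangentialCLM ν (w - p))).comp (tangentialCLM ν) := by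
  have h1 : ∀ᶠ z in 𝓝 (0 : V), DifferentiableAt ℝ f z := by
    have := h.contDiffAt.eventually (by simp)
    filter_upwards [this] with z hz
    exact hz.differentiableAt (by simp)
  have h2 : Tendsto (fun w => tangentialCLM ν (w - p)) (𝓝 p) (𝓝 0) := by
    have : Continuous fun w => tangentialCLM ν (w - p) := by fun_prop
    simpa using this.tendsto p
  filter_upwards [h2.eventually h1] with w hw
  have h3 : HasFDerivAt (fun w => w - p) (ContinuousLinearMap.id ℝ V) w :=
    (hasFDerivAt_id w).sub_const p
  have h4 := (innerSL ℝ ν).hasFDerivAt.comp w h3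
  have h5 := hw.hasFDerivAt.comp w ((tangentialCLM ν).hasFDerivAt.comp w h3)
  exact (h4.sub h5).fderiv

lemma fderiv_graphDefiningFunction_self (h : IsNormalGraph A p ν f) :
    fderiv ℝ (graphDefiningFunction p ν f) p = innerSL ℝ ν := by
  rw [(fderiv_graphDefiningFunction h).self_of_nhds]
  simp [h.fderiv_zero]

/-- Strictness allows gradients to be compared at any two points near `p` with the same Hessian. It
is needed because the base point of the Taylor expansion will move with `n`. -/
lemma hasStrictFDerivAt_fderiv_graphDefiningFunction (h : IsNormalGraph A p ν f) :
    HasStrictFDerivAt (fderiv ℝ (graphDefiningFunction p ν f)) (graphHessian ν f) p := by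
  have h1 : ContDiffAt ℝ 1 (fderiv ℝ (graphDefiningFunction p ν f)) p :=
    (contDiffAt_graphDefiningFunction h).fderiv_right (by norm_num)
  have h2 : HasFDerivAt (fderiv ℝ (graphDefiningFunction p ν f)) (graphHessian ν f) p := by
    refine HasFDerivAt.congr_of_eventuallyEq ?_ (fderiv_graphDefiningFunction h)
    have h3 : DifferentiableAt ℝ (fderiv ℝ f) (tangentialCLM ν (p - p)) := by
      have : ContDiffAt ℝ 1 (fderiv ℝ f) 0 := h.contDiffAt.fderiv_right (by norm_num)
      simpa using this.differentiableAt (by simp)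
    have h4 : HasFDerivAt (fun w => w - p) (ContinuousLinearMap.id ℝ V) p :=
      (hasFDerivAt_id p).sub_const p
    have h5 := h3.hasFDerivAt.comp p ((tangentialCLM ν).hasFDerivAt.comp p h4)
    have h6 := (((ContinuousLinearMap.compL ℝ V V ℝ).flip (tangentialCLM ν)).hasFDerivAt.comp p
      h5).const_sub (innerSL ℝ ν)
    have h7 : -((ContinuousLinearMap.compL ℝ V V ℝ).flip (tangentialCLM ν)).comp
        ((fderiv ℝ (fderiv ℝ f) (tangentialCLM ν (p - p))).comp
          ((tangentialCLM ν).comp (ContinuousLinearMap.id ℝ V))) = graphHessian ν f := by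
      ext u v
      simp [graphHessian]
    rw [h7] at h6
    exact h6
  rw [← h2.fderiv]
  exact h1.hasStrictFDerivAt (by simp)

/-- A `C²` set is pinched between two paraboloids at each boundary point. -/
lemma IsNormalGraph.exists_pinched (h : IsNormalGraph A p ν f) :
    ∃ C δ : ℝ, 0 ≤ C ∧ 0 < δ ∧ Pinched A p (fun v => ⟪v, ν⟫) C δ := by
  set F := graphDefiningFunction p ν f
  set B := graphHessian ν f
  have h1 := (hasStrictFDerivAt_fderiv_graphDefiningFunction h).hasFDerivAt.isLittleO.def
    (zero_lt_one)
  have h2 : ∀ᶠ w in 𝓝 p, DifferentiableAt ℝ F w := by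
    have := (contDiffAt_graphDefiningFunction h).eventually (by simp)
    filter_upwards [this] with z hz
    exact hz.differentiableAt (by simp)
  obtain ⟨δ, hδ, hball⟩ := Metric.eventually_nhds_iff_ball.1
    (h1.and (h2.and (mem_iff_graphDefiningFunction h)))
  -- The `1` is the Taylor remainder and `‖B‖` absorbs the quadratic term.
  refine ⟨1 + ‖B‖, δ, by positivity, hδ, fun v hv => ?_⟩
  have hmem : ∀ t ∈ Icc (0 : ℝ) 1, p + t • v ∈ ball p δ := by
    intro t ht
    rw [mem_ball, dist_eq_norm, add_sub_cancel_left, norm_smul, Real.norm_of_nonneg ht.1]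
    exact (mul_le_of_le_one_left (norm_nonneg _) ht.2).trans_lt hv
  have h3 := norm_sub_taylor_two_le (f := F) (p := p) (u := v) (B := B) zero_le_one
    (fun t ht => (hball _ (hmem t ht)).2.1)
    (fun t ht => by simpa using (hball _ (hmem t ht)).1)
  have h4 := (hball _ (hmem 1 (by simp))).2.2
  rw [one_smul] at h4
  have h0 : F p = 0 := graphDefiningFunction_self h
  have h0' : fderiv ℝ F p = innerSL ℝ ν := fderiv_graphDefiningFunction_self h
  rw [h0, h0', innerSL_apply_apply,
    real_inner_comm, Real.norm_eq_abs, abs_le] at h3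
  have h5 : |B v v| ≤ ‖B‖ * ‖v‖ ^ 2 := by
    have := B.le_opNorm₂ v v
    rw [Real.norm_eq_abs] at this
    linarith
  rw [abs_le] at h5
  simp only [smul_eq_mul] at h3
  have h6 : 0 ≤ ‖B‖ * ‖v‖ ^ 2 := by positivity
  refine ⟨fun hlt => h4.2 ?_, fun hlt hcon => ?_⟩
  · simp only [F] at *
    nlinarith
  · have h7 := h4.1 hcon
    simp only [F] at *
    nlinarith

end Graph

/-- A set that lies between two paraboloids has a unique normal. -/
lemma eq_norm_smul_of_pinched {A : Set V} {x ν a : V} {B : V →L[ℝ] V →L[ℝ] ℝ} {C δ η δ' : ℝ}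
    (hν : ‖ν‖ = 1) (hδ : 0 < δ) (hδ' : 0 < δ')
    (h1 : Pinched A x (fun v => ⟪v, ν⟫) C δ)
    (h2 : Pinched A x (fun v => ⟪a, v⟫ + 1 / 2 * B v v) η δ') (ha : a ≠ 0) : a = ‖a‖ • ν := by
  by_contra hne
  have ha' : 0 < ‖a‖ := norm_pos_iff.2 ha
  have hlt : ⟪a, ν⟫ < ‖a‖ := by
    have h3 := real_inner_le_norm a ν
    rw [hν, mul_one] at h3
    refine lt_of_le_of_ne h3 fun h4 => hne ?_
    have h5 : ⟪a, ν⟫ = ‖a‖ * ‖ν‖ := by rw [h4, hν, mul_one]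
    have := inner_eq_norm_mul_iff_real.1 h5
    rw [hν, one_smul] at this
    exact this
  -- Along this vector `a` is negative and `ν` positive, so a short multiple of it would lie in `A`
  -- by one description and outside `A` by the other.
  set v := ν - ‖a‖⁻¹ • a with hv
  have hv1 : ⟪a, v⟫ < 0 := by
    rw [hv, inner_sub_right, real_inner_smul_right, real_inner_self_eq_norm_sq]
    have : ‖a‖⁻¹ * ‖a‖ ^ 2 = ‖a‖ := by field_simp
    linarith
  have hv2 : 0 < ⟪v, ν⟫ := by
    rw [hv, inner_sub_left, real_inner_smul_left, real_inner_self_eq_norm_sq, hν]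
    have : ‖a‖⁻¹ * ⟪a, ν⟫ < 1 := by
      rw [inv_mul_lt_iff₀ ha']; linarith
    linarith
  have e1 : ∀ᶠ t in 𝓝[>] (0 : ℝ), ‖t • v‖ < min δ δ' := by
    have : Tendsto (fun t : ℝ => ‖t • v‖) (𝓝[>] 0) (𝓝 0) := by
      have hc : Continuous fun t : ℝ => ‖t • v‖ := by fun_prop
      simpa using (hc.tendsto 0).mono_left nhdsWithin_le_nhds
    exact this.eventually_lt_const (lt_min hδ hδ')
  have e2 : ∀ᶠ t in 𝓝[>] (0 : ℝ), C * t * ‖v‖ ^ 2 < ⟪v, ν⟫ := by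
    have : Tendsto (fun t : ℝ => C * t * ‖v‖ ^ 2) (𝓝[>] 0) (𝓝 0) := by
      have hc : Continuous fun t : ℝ => C * t * ‖v‖ ^ 2 := by fun_prop
      simpa using (hc.tendsto 0).mono_left nhdsWithin_le_nhds
    exact this.eventually_lt_const hv2
  have e3 : ∀ᶠ t in 𝓝[>] (0 : ℝ), ⟪a, v⟫ + 1 / 2 * t * B v v + η * t * ‖v‖ ^ 2 < 0 := by
    have : Tendsto (fun t : ℝ => ⟪a, v⟫ + 1 / 2 * t * B v v + η * t * ‖v‖ ^ 2)
        (𝓝[>] 0) (𝓝 ⟪a, v⟫) := by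
      have hc : Continuous fun t : ℝ => ⟪a, v⟫ + 1 / 2 * t * B v v + η * t * ‖v‖ ^ 2 := by
        fun_prop
      simpa using (hc.tendsto 0).mono_left nhdsWithin_le_nhds
    exact this.eventually_lt_const hv1
  obtain ⟨t, ht1, ht2, ht3, ht⟩ := (e1.and (e2.and (e3.and self_mem_nhdsWithin))).exists
  have ht : 0 < t := ht
  have hn : ‖t • v‖ ^ 2 = t * (t * ‖v‖ ^ 2) := by
    rw [norm_smul, Real.norm_of_nonneg ht.le]; ring
  refine (h1 (t • v) (ht1.trans_le (min_le_left _ _))).2 ?_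
    ((h2 (t • v) (ht1.trans_le (min_le_right _ _))).1 ?_)
  · simp only [hn, real_inner_smul_left]
    nlinarith [mul_lt_mul_of_pos_left ht2 ht]
  · simp only [hn, real_inner_smul_right, map_smul, smul_apply, smul_eq_mul]
    nlinarith [mul_lt_mul_of_pos_left ht3 ht]

/-! ### Convergence of sets -/

/-- If the defining function were negative at `y`, it would be so nearby by continuity, and `y`
would be an interior point. -/
lemma mem_frontier_graphDefiningFunction_eq_zero {A : Set V} {p ν : V} {f : V → ℝ} {y : V}
    (hA : IsClosed A) (hy : y ∈ frontier A)
    (hmem : ∀ᶠ w in 𝓝 y, w ∈ A ↔ graphDefiningFunction p ν f w ≤ 0)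
    (hcont : ContinuousAt (graphDefiningFunction p ν f) y) :
    graphDefiningFunction p ν f y = 0 := by
  refine le_antisymm (hmem.self_of_nhds.1 (hA.frontier_subset hy)) ?_
  by_contra! hlt
  have : A ∈ 𝓝 y := by
    filter_upwards [hmem, hcont.eventually_lt_const hlt] with w h1 h2
    exact h1.2 h2.le
  exact hy.2 (mem_interior_iff_mem_nhds.2 this)

/-- The displacement of a diffeomorphism is uniformly small with its derivatives. -/
lemma eventually_norm_displacement_lt {Φ : ℕ → (V ≃ V)}
    (h : ∀ k : ℕ, k ≤ 2 →
      TendstoUniformly (fun n y => iteratedFDeriv ℝ k (fun z => Φ n z - z) y) (fun _ => 0) atTop)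
    {ε : ℝ} (hε : 0 < ε) :
    ∀ᶠ n in atTop, ∀ y, ‖Φ n y - y‖ < ε ∧ ‖fderiv ℝ (fun z => Φ n z - z) y‖ < ε ∧
      ‖fderiv ℝ (fderiv ℝ (fun z => Φ n z - z)) y‖ < ε := by
  have h' := fun k hk => Metric.tendstoUniformly_iff.1 (h k hk) ε hε
  filter_upwards [h' 0 (by simp), h' 1 (by simp), h' 2 le_rfl] with n h0 h1 h2 y
  have h0 := h0 y
  have h1 := h1 y
  have h2 := h2 y
  rw [dist_zero_left] at h0 h1 h2
  rw [norm_iteratedFDeriv_zero] at h0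
  rw [← zero_add 1, ← norm_iteratedFDeriv_fderiv, norm_iteratedFDeriv_zero] at h1
  rw [← one_add_one_eq_two, ← norm_iteratedFDeriv_fderiv, ← zero_add 1,
    ← norm_iteratedFDeriv_fderiv, norm_iteratedFDeriv_zero] at h2
  exact ⟨h0, h1, h2⟩

/-- Estimates for a diffeomorphism that is `C²`-close to the identity. -/
lemma displacement_estimates {Φ : V ≃ V} (hΦ : ContDiff ℝ 2 Φ) {ε : ℝ} (hε : 0 < ε)
    (h : ∀ y, ‖Φ y - y‖ < ε ∧ ‖fderiv ℝ (fun z => Φ z - z) y‖ < ε ∧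
      ‖fderiv ℝ (fderiv ℝ (fun z => Φ z - z)) y‖ < ε) (p u : V) :
    ‖Φ (p + u) - Φ p - u‖ ≤ ε * ‖u‖ ∧ ‖Φ (p + u) - Φ p - fderiv ℝ Φ p u‖ ≤ ε * ‖u‖ ^ 2 := by
  set Ψ : V → V := fun z => Φ z - z with hΨ
  have hΨd : ContDiff ℝ 2 Ψ := hΦ.sub contDiff_id
  have hd : Differentiable ℝ Ψ := hΨd.differentiable (by simp)
  have hd' : Differentiable ℝ (fderiv ℝ Ψ) :=
    (hΨd.fderiv_right (m := 1) (by norm_num)).differentiable (by simp)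
  have hf : fderiv ℝ Φ p = ContinuousLinearMap.id ℝ V + fderiv ℝ Ψ p := by
    have h1 : fderiv ℝ Ψ p = fderiv ℝ Φ p - ContinuousLinearMap.id ℝ V := by
      have h2 := ((hΦ.differentiable (by simp)) p).hasFDerivAt.sub (hasFDerivAt_id p)
      exact h2.fderiv
    rw [h1]; abel
  constructor
  · have h1 := convex_univ.norm_image_sub_le_of_norm_fderiv_le (𝕜 := ℝ) (f := Ψ) (C := ε)
      (fun y _ => hd y) (fun y _ => (h y).2.1.le) (mem_univ p) (mem_univ (p + u))
    simp only [hΨ, add_sub_cancel_left] at h1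
    convert h1 using 2
    abel
  -- The second derivative of the displacement is below `ε`, so the zero form is already a good
  -- enough quadratic model.
  · have h1 := norm_sub_taylor_two_le (f := Ψ) (p := p) (u := u) (B := 0) hε.le (fun t _ => hd _)
      (fun t _ => by
        have h2 := convex_univ.norm_image_sub_le_of_norm_fderiv_le (𝕜 := ℝ) (f := fderiv ℝ Ψ)
          (C := ε) (fun y _ => hd' y) (fun y _ => (h y).2.2.le) (mem_univ p)
          (mem_univ (p + t • u))
        simpa using h2)
    convert h1 using 2
    rw [hf]
    simp [hΨ]
    abel

/-- Write `x + v = Φ (y + u)` and expand `F` at `y`. Since `v` differs from `dΦ u` by at most `ε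
|u|²` and from `u` by at most `ε |u|`, the linear term may be read off `v` through `M`, and `B u u`
replaced by `B v v`. The bound `ε ≤ 1/2` gives `|u| ≤ 2 |v|`, which explains the balls of radius `2
δ`, the factors `4 = 2²` and the factor `3 = (1/2) · 2 · (2 + 1)`. -/
lemma pinched_image {A : Set V} {F : V → ℝ} {B : V →L[ℝ] V →L[ℝ] ℝ} {Φ : V ≃ V} {x y : V}
    {M : V →L[ℝ] V} {η ε δ : ℝ} (hη : 0 ≤ η) (hε : 0 < ε) (hε' : ε ≤ 1 / 2)
    (hΦ : ContDiff ℝ 2 Φ)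
    (h : ∀ y, ‖Φ y - y‖ < ε ∧ ‖fderiv ℝ (fun z => Φ z - z) y‖ < ε ∧
      ‖fderiv ℝ (fderiv ℝ (fun z => Φ z - z)) y‖ < ε)
    (hM : M.comp (fderiv ℝ Φ y) = ContinuousLinearMap.id ℝ V) (hxy : Φ y = x) (hy : F y = 0)
    (hA : ∀ w ∈ ball y (2 * δ), w ∈ A ↔ F w ≤ 0)
    (hF : ∀ w ∈ ball y (2 * δ), DifferentiableAt ℝ F w)
    (hB : ∀ w ∈ ball y (2 * δ), ‖fderiv ℝ F w - fderiv ℝ F y - B (w - y)‖ ≤ η * ‖w - y‖) :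
    Pinched (Φ '' A) x (fun v => (fderiv ℝ F y).comp M v + 1 / 2 * B v v)
      (4 * η + (4 * ‖(fderiv ℝ F y).comp M‖ + 3 * ‖B‖) * ε) δ := by
  intro v hv
  obtain ⟨w, hw⟩ := Φ.surjective (x + v)
  set ℓ := (fderiv ℝ F y).comp M
  obtain ⟨u, rfl⟩ : ∃ u, w = y + u := ⟨w - y, by abel⟩
  have hest := displacement_estimates hΦ hε h y u
  rw [hw, hxy, add_sub_cancel_left] at hest
  obtain ⟨h1, h2⟩ := hest
  have hu : ‖u‖ ≤ 2 * ‖v‖ := by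
    have h3 : ‖u‖ ≤ ‖v - u‖ + ‖v‖ := by
      have := norm_sub_norm_le u v
      rw [norm_sub_rev] at this
      linarith
    have h4 : ε * ‖u‖ ≤ 1 / 2 * ‖u‖ := by gcongr
    linarith
  have hmem : ∀ t ∈ Icc (0 : ℝ) 1, y + t • u ∈ ball y (2 * δ) := by
    intro t ht
    rw [mem_ball, dist_eq_norm, add_sub_cancel_left, norm_smul, Real.norm_of_nonneg ht.1]
    calc t * ‖u‖ ≤ ‖u‖ := mul_le_of_le_one_left (norm_nonneg _) ht.2
      _ < 2 * δ := by linarith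
  have h3 := norm_sub_taylor_two_le (f := F) (p := y) (u := u) (B := B) hη
    (fun t ht => hF _ (hmem t ht)) (fun t ht => by simpa using hB _ (hmem t ht))
  have h4 : ‖fderiv ℝ F y u - ℓ v‖ ≤ ‖ℓ‖ * (ε * ‖u‖ ^ 2) := by
    have h5 : fderiv ℝ F y u = ℓ (fderiv ℝ Φ y u) := by
      have := congrArg (fun T : V →L[ℝ] V => T u) hM
      simp only [ContinuousLinearMap.comp_apply, ContinuousLinearMap.id_apply] at this
      simp [ℓ, this]
    rw [h5, ← map_sub]
    refine (ℓ.le_opNorm _).trans ?_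
    rw [norm_sub_rev]
    gcongr
  have h5 : ‖B u u - B v v‖ ≤ ‖B‖ * (ε * ‖u‖) * (‖u‖ + ‖v‖) := by
    have h6 : B u u - B v v = B (u - v) u + B v (u - v) := by simp
    have h7 : ‖u - v‖ ≤ ε * ‖u‖ := by rw [norm_sub_rev]; exact h1
    rw [h6]
    calc _ ≤ ‖B (u - v) u‖ + ‖B v (u - v)‖ := norm_add_le _ _
      _ ≤ ‖B‖ * ‖u - v‖ * ‖u‖ + ‖B‖ * ‖v‖ * ‖u - v‖ :=
        add_le_add (B.le_opNorm₂ _ _) (B.le_opNorm₂ _ _)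
      _ ≤ ‖B‖ * (ε * ‖u‖) * ‖u‖ + ‖B‖ * ‖v‖ * (ε * ‖u‖) := by gcongr
      _ = _ := by ring
  have key : ‖F (y + u) - (ℓ v + 1 / 2 * B v v)‖
      ≤ (4 * η + (4 * ‖ℓ‖ + 3 * ‖B‖) * ε) * ‖v‖ ^ 2 := by
    have h6 : F (y + u) - (ℓ v + 1 / 2 * B v v)
        = (F (y + u) - F y - fderiv ℝ F y u - (1 / 2 : ℝ) • B u u)
          + (fderiv ℝ F y u - ℓ v) + (1 / 2 : ℝ) * (B u u - B v v) := by
      rw [hy, smul_eq_mul]; ring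
    have hu2 : ‖u‖ ^ 2 ≤ 4 * ‖v‖ ^ 2 := by
      calc ‖u‖ ^ 2 ≤ (2 * ‖v‖) ^ 2 := by gcongr
        _ = _ := by ring
    rw [h6]
    calc _ ≤ η * ‖u‖ ^ 2 + ‖ℓ‖ * (ε * ‖u‖ ^ 2) + 1 / 2 * (‖B‖ * (ε * ‖u‖) * (‖u‖ + ‖v‖)) := by
          refine (norm_add₃_le).trans ?_
          rw [norm_mul, Real.norm_of_nonneg (by norm_num : (0 : ℝ) ≤ 1 / 2)]
          gcongr
      _ ≤ η * (4 * ‖v‖ ^ 2) + ‖ℓ‖ * (ε * (4 * ‖v‖ ^ 2))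
          + 1 / 2 * (‖B‖ * (ε * (2 * ‖v‖)) * (2 * ‖v‖ + ‖v‖)) := by gcongr
      _ = _ := by ring
  rw [Real.norm_eq_abs, abs_le] at key
  have hAw := hA (y + u) (by simpa using hmem 1 (by simp))
  rw [← hw, Φ.injective.mem_set_image, hAw]
  exact ⟨fun hlt => by linarith [key.2], fun hlt => by linarith [key.1]⟩

/-- The point `x` comes from `y n = (Φ n)⁻¹ x`, a boundary point of `E` tending to `x`. The defining
function of `E`, expanded at `y n` with its Hessian at `x`, is transported by `Φ n`. The linear
parts converge to the normal, but need not have norm one. -/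
lemma exists_pinched_of_c2Converges {E : Set V} {En : ℕ → Set V} {x ν : V} {f : V → ℝ}
    (hE : IsClosed E) (h_conv : C2Converges En E) (hxn : ∀ n, x ∈ frontier (En n))
    (hG : IsNormalGraph E x ν f) :
    ∃ ℓ : ℕ → V →L[ℝ] ℝ, Tendsto ℓ atTop (𝓝 (innerSL ℝ ν)) ∧
      ∀ η > 0, ∃ δ > 0, ∀ᶠ n in atTop,
        Pinched (En n) x (fun v => ℓ n v + 1 / 2 * graphHessian ν f v v) η δ := by
  obtain ⟨Φ, hΦ, himg, hunif⟩ := h_conv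
  set F := graphDefiningFunction x ν f with hFdef
  set B := graphHessian ν f
  let y : ℕ → V := fun n => (Φ n).symm x
  have hΦy : ∀ n, Φ n (y n) = x := fun n => (Φ n).apply_symm_apply x
  let M : ℕ → V →L[ℝ] V := fun n => fderiv ℝ (Φ n).symm x
  have hD : ∀ n, Differentiable ℝ (Φ n) := fun n => (hΦ n).1.differentiable (by simp)
  have hDs : ∀ n, Differentiable ℝ (Φ n).symm := fun n => (hΦ n).2.differentiable (by simp)
  have hML : ∀ n, (M n).comp (fderiv ℝ (Φ n) (y n)) = ContinuousLinearMap.id ℝ V := by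
    intro n
    have h1 := (hDs n (Φ n (y n))).hasFDerivAt.comp (y n) (hD n (y n)).hasFDerivAt
    rw [hΦy] at h1
    have h2 : (Φ n).symm ∘ Φ n = id := by ext; simp
    rw [h2] at h1
    exact h1.unique (hasFDerivAt_id _)
  have hLM : ∀ n, (fderiv ℝ (Φ n) (y n)).comp (M n) = ContinuousLinearMap.id ℝ V := by
    intro n
    have h1 := HasFDerivAt.comp (g := Φ n) (f := (Φ n).symm) x (hD n (y n)).hasFDerivAt
      (hDs n x).hasFDerivAt
    have h2 : Φ n ∘ (Φ n).symm = id := by ext; simp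
    rw [h2] at h1
    exact h1.unique (hasFDerivAt_id _)
  have hy_lim : Tendsto y atTop (𝓝 x) := by
    rw [Metric.tendsto_nhds]
    intro ε hε
    filter_upwards [eventually_norm_displacement_lt hunif hε] with n hn
    have := (hn (y n)).1
    rw [hΦy] at this
    rwa [dist_comm, dist_eq_norm]
  have hM_lim : Tendsto M atTop (𝓝 (ContinuousLinearMap.id ℝ V)) := by
    rw [Metric.tendsto_nhds]
    intro ε hε
    filter_upwards [eventually_norm_displacement_lt hunif (half_pos hε),
      eventually_norm_displacement_lt hunif (half_pos one_pos)] with n hn hn'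
    have h1 : fderiv ℝ (fun z => Φ n z - z) (y n)
        = fderiv ℝ (Φ n) (y n) - ContinuousLinearMap.id ℝ V :=
      ((hD n (y n)).hasFDerivAt.sub (hasFDerivAt_id (y n))).fderiv
    -- With `Ψ = Φ n - id` this reads `M - 1 = -dΨ ∘ M`. A derivative of norm below `1/2` first
    -- gives `‖M‖ ≤ 2`, and then one of norm below `ε/2` gives `‖M - 1‖ < ε`.
    have h2 : M n - ContinuousLinearMap.id ℝ V
        = -(fderiv ℝ (fun z => Φ n z - z) (y n)).comp (M n) := by
      rw [h1, ContinuousLinearMap.sub_comp, hLM]; simp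
    have h3 : ‖M n - ContinuousLinearMap.id ℝ V‖
        ≤ ‖fderiv ℝ (fun z => Φ n z - z) (y n)‖ * ‖M n‖ := by
      rw [h2, norm_neg]; exact ContinuousLinearMap.opNorm_comp_le _ _
    have h4 : ‖M n‖ ≤ ‖M n - ContinuousLinearMap.id ℝ V‖ + 1 := by
      have h5 := norm_add_le (M n - ContinuousLinearMap.id ℝ V) (ContinuousLinearMap.id ℝ V)
      rw [sub_add_cancel] at h5
      linarith [ContinuousLinearMap.norm_id_le (𝕜 := ℝ) (E := V)]
    have h5 := (hn (y n)).2.1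
    have h6 := (hn' (y n)).2.1
    have h7 := norm_nonneg (M n)
    rw [dist_eq_norm]
    have h8 : ‖M n‖ ≤ 2 := by nlinarith
    nlinarith [norm_nonneg (fderiv ℝ (fun z => Φ n z - z) (y n))]
  have hstrict := hasStrictFDerivAt_fderiv_graphDefiningFunction hG
  have hℓ_lim : Tendsto (fun n => (fderiv ℝ F (y n)).comp (M n)) atTop (𝓝 (innerSL ℝ ν)) := by
    have h1 : Tendsto (fun n => fderiv ℝ F (y n)) atTop (𝓝 (innerSL ℝ ν)) := by
      have h2 := hstrict.hasFDerivAt.continuousAt.tendsto.comp hy_lim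
      rwa [fderiv_graphDefiningFunction_self hG] at h2
    have h3 := ((ContinuousLinearMap.compL ℝ V V ℝ).isBoundedBilinearMap.continuous.tendsto
      (innerSL ℝ ν, ContinuousLinearMap.id ℝ V)).comp (h1.prodMk_nhds hM_lim)
    simpa [Function.comp_def] using h3
  refine ⟨fun n => (fderiv ℝ F (y n)).comp (M n), hℓ_lim, fun η hη => ?_⟩
  have e1 : ∀ᶠ w in 𝓝 x, DifferentiableAt ℝ F w := by
    have := (contDiffAt_graphDefiningFunction hG).eventually (by simp)
    filter_upwards [this] with z hz
    exact hz.differentiableAt (by simp)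
  have e2 := hstrict.isLittleO.def (show (0 : ℝ) < η / 8 by positivity)
  obtain ⟨r₁, hr₁, hball₁⟩ := Metric.eventually_nhds_iff_ball.1
    (e1.and (mem_iff_graphDefiningFunction hG))
  obtain ⟨r₂, hr₂, hball₂⟩ := Metric.eventually_nhds_iff_ball.1 e2
  -- Points within `2 δ` of `y n`, which is itself within `2 δ` of `x`, must stay in both balls.
  set δ := min r₁ r₂ / 4 with hδ
  have hδ0 : 0 < δ := by positivity
  have hδ1 : 4 * δ ≤ r₁ := by linarith [min_le_left r₁ r₂]
  have hδ2 : 4 * δ ≤ r₂ := by linarith [min_le_right r₁ r₂]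
  refine ⟨δ, hδ0, ?_⟩
  -- The error of `pinched_image` is split evenly: `4 (η / 8)` is one half of `η`, and this `ε`
  -- makes the rest at most the other half once the linear part has norm at most `2`.
  set ε := min (1 / 2) (η / (2 * (4 * 2 + 3 * ‖B‖))) with hε
  have hε0 : 0 < ε := by positivity
  have hnorm : ∀ᶠ n in atTop, ‖(fderiv ℝ F (y n)).comp (M n)‖ ≤ 2 := by
    have h1 := hℓ_lim.norm
    rw [innerSL_apply_norm, hG.norm_eq_one] at h1
    exact (h1.eventually_lt_const one_lt_two).mono fun n hn => hn.le
  filter_upwards [eventually_norm_displacement_lt hunif hε0, hnorm,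
    hy_lim.eventually (Metric.ball_mem_nhds x (show 0 < 2 * δ by positivity))] with n hn hn2 hyn
  have hyn : dist (y n) x < 2 * δ := hyn
  have hsub : ∀ w ∈ ball (y n) (2 * δ), w ∈ ball x (4 * δ) := by
    intro w hw
    have hw : dist w (y n) < 2 * δ := hw
    have := dist_triangle w (y n) x
    rw [mem_ball]
    linarith
  have hyfr : y n ∈ frontier E := by
    let Ψ : V ≃ₜ V := { Φ n with
      continuous_toFun := (hΦ n).1.continuous
      continuous_invFun := (hΦ n).2.continuous }
    have h1 : En n = Ψ '' E := himg n
    have h2 := hxn n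
    rw [h1, ← Ψ.image_frontier] at h2
    obtain ⟨z, hz, hzx⟩ := h2
    have : y n = z := by
      simp only [y, ← hzx]
      exact (Φ n).symm_apply_apply z
    rwa [this]
  have hFy : F (y n) = 0 := by
    have hb : ball x r₁ ∈ 𝓝 (y n) := isOpen_ball.mem_nhds (by rw [mem_ball]; linarith)
    refine mem_frontier_graphDefiningFunction_eq_zero hE hyfr ?_ ?_
    · filter_upwards [hb] with w hw using (hball₁ w hw).2
    · exact (hball₁ _ (mem_of_mem_nhds hb)).1.continuousAt
  have hp := pinched_image (A := E) (F := F) (B := B) (Φ := Φ n) (x := x) (y := y n) (M := M n)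
    (η := η / 8) (ε := ε) (δ := δ) (by positivity) hε0 (min_le_left _ _) (hΦ n).1 hn (hML n)
    (hΦy n) hFy (fun w hw => (hball₁ w (ball_subset_ball hδ1 (hsub w hw))).2)
    (fun w hw => (hball₁ w (ball_subset_ball hδ1 (hsub w hw))).1)
    (fun w hw => by
      have h1 : (w, y n) ∈ ball (x, x) r₂ := by
        rw [← ball_prod_same]
        refine ⟨ball_subset_ball hδ2 (hsub w hw), ?_⟩
        rw [mem_ball]; linarith
      exact hball₂ (w, y n) h1)
  rw [← himg n] at hp
  have hle : 4 * (η / 8) + (4 * ‖(fderiv ℝ F (y n)).comp (M n)‖ + 3 * ‖B‖) * ε ≤ η := by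
    have h1 : (4 * ‖(fderiv ℝ F (y n)).comp (M n)‖ + 3 * ‖B‖) * ε
        ≤ (4 * 2 + 3 * ‖B‖) * (η / (2 * (4 * 2 + 3 * ‖B‖))) := by
      gcongr
      exact min_le_right _ _
    have h2 : (4 * 2 + 3 * ‖B‖) * (η / (2 * (4 * 2 + 3 * ‖B‖))) = η / 2 := by
      field_simp
    linarith
  intro v hv
  have h1 := hp v hv
  have h2 := mul_le_mul_of_nonneg_right hle (sq_nonneg ‖v‖)
  exact ⟨fun h3 => h1.1 (by linarith), fun h3 => h1.2 (by linarith)⟩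

/-- Sets converging to `E` have, at a common boundary point `x`, normals converging to the normal
of `E`, and the same second order approximation as `E`. -/
theorem tendsto_normal_and_pinched [CompleteSpace V] {E : Set V} {En : ℕ → Set V} {x ν : V} {f : V → ℝ}
    (hE : IsClosed E) (h_conv : C2Converges En E) (hxn : ∀ n, x ∈ frontier (En n))
    (hG : IsNormalGraph E x ν f) {νn : ℕ → V} {fn : ℕ → V → ℝ}
    (hGn : ∀ n, IsNormalGraph (En n) x (νn n) (fn n)) :
    Tendsto νn atTop (𝓝 ν) ∧
      ∀ η > 0, ∃ δ > 0, ∀ᶠ n in atTop,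
        Pinched (En n) x (fun v => ⟪v, νn n⟫ + 1 / 2 * graphHessian ν f v v) η δ := by
  obtain ⟨ℓ, hℓ, hpin⟩ := exists_pinched_of_c2Converges hE h_conv hxn hG
  set B := graphHessian ν f
  have hnorm : Tendsto (fun n => ‖ℓ n‖) atTop (𝓝 1) := by
    have h1 := hℓ.norm
    rwa [innerSL_apply_norm, hG.norm_eq_one] at h1
  have hpos : ∀ᶠ n in atTop, 0 < ‖ℓ n‖ := hnorm.eventually_const_lt one_pos
  -- The linear part is a positive multiple of the normal by uniqueness of normals. The constants of
  -- `exists_pinched` depend on `n`, which is harmless because only the direction is extracted.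
  have hrep : ∀ᶠ n in atTop, ℓ n = ‖ℓ n‖ • innerSL ℝ (νn n) := by
    obtain ⟨δ, hδ, hev⟩ := hpin 1 one_pos
    filter_upwards [hev, hpos] with n hn hn0
    obtain ⟨C, δ', -, hδ', hp⟩ := (hGn n).exists_pinched
    set a := (InnerProductSpace.toDual ℝ V).symm (ℓ n) with ha
    have hai : ∀ v, ⟪a, v⟫ = ℓ n v := fun v => InnerProductSpace.toDual_symm_apply
    have han : ‖a‖ = ‖ℓ n‖ := LinearIsometryEquiv.norm_map _ _
    have h1 := eq_norm_smul_of_pinched (a := a) (B := B) (hGn n).norm_eq_one hδ' hδ hp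
      (by simpa only [hai] using hn) (by rw [← norm_pos_iff, han]; exact hn0)
    ext v
    rw [← hai, h1, han]
    simp [real_inner_smul_left]
  refine ⟨?_, fun η hη => ?_⟩
  · have h1 : Tendsto (fun n => ‖ℓ n‖⁻¹ • ℓ n) atTop (𝓝 (innerSL ℝ ν)) := by
      simpa using (hnorm.inv₀ one_ne_zero).smul hℓ
    rw [tendsto_iff_norm_sub_tendsto_zero] at h1 ⊢
    refine h1.congr' ?_
    filter_upwards [hrep, hpos] with n hn hn0
    have h2 : ‖ℓ n‖⁻¹ • ℓ n = innerSL ℝ (νn n) := by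
      conv_lhs => rw [hn]
      rw [norm_smul, norm_norm, innerSL_apply_norm, (hGn n).norm_eq_one, mul_one, smul_smul,
        inv_mul_cancel₀ hn0.ne', one_smul]
    rw [h2, ← map_sub, innerSL_apply_norm]
  · obtain ⟨δ, hδ, hev⟩ := hpin (η / 2) (half_pos hη)
    refine ⟨δ, hδ, ?_⟩
    -- Multiplying by `c = ‖ℓ n‖` keeps a margin of `3 η / 4`, and replacing `c B / 2` by `B / 2`
    -- costs at most `η / 8`; more than the required `η / 2` remains.
    have e1 : ∀ᶠ n in atTop, 3 / 4 < ‖ℓ n‖ := hnorm.eventually_const_lt (by norm_num)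
    have e2 : ∀ᶠ n in atTop, |‖ℓ n‖ - 1| * ‖B‖ < η / 4 := by
      have h1 : Tendsto (fun n => |‖ℓ n‖ - 1| * ‖B‖) atTop (𝓝 (|1 - 1| * ‖B‖)) :=
        (hnorm.sub_const 1).abs.mul_const _
      simp only [sub_self, abs_zero, zero_mul] at h1
      exact h1.eventually_lt_const (by positivity)
    filter_upwards [hev, hrep, e1, e2] with n hn hr h1 h2 v hv
    have hℓv : ℓ n v = ‖ℓ n‖ * ⟪v, νn n⟫ := by
      conv_lhs => rw [hr]
      simp [real_inner_comm]
    have h3 := hn v hv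
    simp only [hℓv] at h3
    set c := ‖ℓ n‖
    have h4 : |(c - 1) * B v v| ≤ η / 4 * ‖v‖ ^ 2 := by
      have h5 := B.le_opNorm₂ v v
      rw [Real.norm_eq_abs] at h5
      rw [abs_mul]
      calc |c - 1| * |B v v| ≤ |c - 1| * (‖B‖ * ‖v‖ * ‖v‖) := by gcongr
        _ = |c - 1| * ‖B‖ * ‖v‖ ^ 2 := by ring
        _ ≤ η / 4 * ‖v‖ ^ 2 := by gcongr
    rw [abs_le] at h4
    have h6 : 3 / 4 * (η * ‖v‖ ^ 2) ≤ c * (η * ‖v‖ ^ 2) := by gcongr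
    have hc0 : 0 < c := by linarith
    constructor
    · intro h5
      have h7 := mul_lt_mul_of_pos_left h5 hc0
      exact h3.1 (by nlinarith)
    · intro h5
      have h7 := mul_lt_mul_of_pos_left h5 hc0
      exact h3.2 (by nlinarith)

end Approximation

/-! ### Integrals over a half-plane in polar coordinates -/

section Fan

/-- Radial bounds `p` with `∫ (1 ∧ r) p(r) r ^ n dr < ∞`. -/
structure IsMajorant (n : ℕ) (p : ℝ → ℝ) : Prop where
  measurable : Measurable p
  nonneg : ∀ r, 0 ≤ p r
  integrable : Integrable (fun r => min 1 r * p r) (radialMeasure n)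

/-- The points of the half-plane, in polar coordinates, outside the disk of radius `δ` or between
two parabolas tangent to the axis `α = 0`. -/
def fanSet (C δ : ℝ) : Set (ℝ × ℝ) := {q | δ ≤ q.1 ∨ |Real.sin q.2| ≤ C * q.1}

/-- A constant bounding the angular measure of the slices of `fanSet C δ`. -/
def fanConstant (C δ : ℝ) : ℝ := Real.pi + C * Real.pi + Real.pi / min 1 δ

lemma fanConstant_nonneg {C δ : ℝ} (hC : 0 ≤ C) (hδ : 0 < δ) : 0 ≤ fanConstant C δ := by
  have := Real.pi_pos
  unfold fanConstant
  positivity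

lemma measurableSet_fanSet (C δ : ℝ) : MeasurableSet (fanSet C δ) := by
  have h1 : MeasurableSet {q : ℝ × ℝ | δ ≤ q.1} := measurableSet_le (by fun_prop) (by fun_prop)
  have h2 : MeasurableSet {q : ℝ × ℝ | |Real.sin q.2| ≤ C * q.1} :=
    measurableSet_le (by fun_prop) (by fun_prop)
  exact h1.union h2

lemma angleMeasure_real_univ_le (m : ℕ) : (angleMeasure m).real univ ≤ Real.pi := by
  have h := angleMeasure_le m univ
  have h2 : (volume.restrict (Ioo (-(Real.pi / 2)) (Real.pi / 2))) univ
      = ENNReal.ofReal Real.pi := by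
    simp
  rw [h2] at h
  exact ENNReal.toReal_le_of_le_ofReal Real.pi_pos.le h

/-- By Jordan's inequality `|sin α| ≥ 2 |α| / π`, a slice at radius `r < δ` has length at most `π C
r`. For large `r` the full angle `π` is enough. The three summands of `fanConstant` serve `1 ≤ r <
δ`, `r < min 1 δ` and `r ≥ δ` respectively. -/
lemma angleMeasure_fanSet_le (m : ℕ) {C δ r : ℝ} (hC : 0 ≤ C) (hδ : 0 < δ) (hr : 0 < r) :
    (angleMeasure m).real {a | (r, a) ∈ fanSet C δ} ≤ fanConstant C δ * min 1 r := by
  have hpi := Real.pi_pos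
  have h0 : (angleMeasure m).real {a | (r, a) ∈ fanSet C δ} ≤ Real.pi :=
    (measureReal_mono (subset_univ _)).trans (angleMeasure_real_univ_le m)
  have hmin : 0 < min 1 δ := by positivity
  have hminr : 0 < min 1 r := by positivity
  by_cases h1 : δ ≤ r
  · refine h0.trans ?_
    have h2 : min 1 δ ≤ min 1 r := min_le_min_left _ h1
    have h3 : Real.pi ≤ Real.pi / min 1 δ * min 1 r := by
      rw [div_mul_eq_mul_div, le_div_iff₀ hmin]
      gcongr
    have : 0 ≤ (Real.pi + C * Real.pi) * min 1 r := by positivity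
    unfold fanConstant
    linarith
  push Not at h1
  have hq : 0 ≤ Real.pi / min 1 δ * min 1 r := by positivity
  by_cases h2 : 1 ≤ r
  · refine h0.trans ?_
    unfold fanConstant
    rw [min_eq_left h2] at *
    have : 0 ≤ C * Real.pi := by positivity
    linarith
  push Not at h2
  have h3 : (angleMeasure m).real {a | (r, a) ∈ fanSet C δ} ≤ Real.pi * (C * r) := by
    refine ENNReal.toReal_le_of_le_ofReal (by positivity) ?_
    refine (angleMeasure_le m _).trans ?_
    rw [Measure.restrict_apply' measurableSet_Ioo]
    calc volume ({a | (r, a) ∈ fanSet C δ} ∩ Ioo (-(Real.pi / 2)) (Real.pi / 2))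
        ≤ volume (Icc (-(Real.pi / 2 * (C * r))) (Real.pi / 2 * (C * r))) := by
          refine measure_mono ?_
          rintro a ⟨ha, ha'⟩
          have h4 : |Real.sin a| ≤ C * r := by
            rcases ha with h | h
            · exact absurd h (not_le.2 h1)
            · exact h
          have h5 := Real.mul_abs_le_abs_sin (x := a) (abs_le.2 ⟨ha'.1.le, ha'.2.le⟩)
          have h6 : |a| ≤ Real.pi / 2 * (C * r) := by
            have h7 : |a| = Real.pi / 2 * (2 / Real.pi * |a|) := by field_simp
            rw [h7]
            exact mul_le_mul_of_nonneg_left (h5.trans h4) (by positivity)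
          exact abs_le.1 h6
      _ = ENNReal.ofReal (Real.pi * (C * r)) := by
          rw [Real.volume_Icc]; congr 1; ring
  refine h3.trans ?_
  unfold fanConstant
  rw [min_eq_right h2.le] at *
  have : 0 ≤ Real.pi * r := by positivity
  nlinarith

variable {m : ℕ} {p : ℝ → ℝ}

lemma integral_fanSet_slice (C δ r : ℝ) :
    ∫ a, ‖(fanSet C δ).indicator (fun q => p q.1) (r, a)‖ ∂angleMeasure m
      = |p r| * (angleMeasure m).real {a | (r, a) ∈ fanSet C δ} := by
  have h1 : ∀ a, ‖(fanSet C δ).indicator (fun q => p q.1) (r, a)‖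
      = {a | (r, a) ∈ fanSet C δ}.indicator (fun _ => |p r|) a := by
    intro a
    by_cases h : (r, a) ∈ fanSet C δ
    · rw [indicator_of_mem h, indicator_of_mem (show a ∈ {a | (r, a) ∈ fanSet C δ} from h)]
      rfl
    · rw [indicator_of_notMem h,
        indicator_of_notMem (show a ∉ {a | (r, a) ∈ fanSet C δ} from h), norm_zero]
  have h2 : MeasurableSet {a | (r, a) ∈ fanSet C δ} :=
    measurable_prodMk_left (measurableSet_fanSet C δ)
  simp_rw [h1]
  rw [integral_indicator h2, setIntegral_const,
    smul_eq_mul, mul_comm]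

/-- Fubini: the angular slices contribute the factor `1 ∧ r` that makes `p` integrable at the
origin. -/
lemma IsMajorant.integrable_fanSet (hp : IsMajorant (m + 1) p) {C δ : ℝ} (hC : 0 ≤ C)
    (hδ : 0 < δ) :
    Integrable ((fanSet C δ).indicator fun q => p q.1)
        ((radialMeasure (m + 1)).prod (angleMeasure m)) ∧
      ∫ q, (fanSet C δ).indicator (fun q => p q.1) q
        ∂((radialMeasure (m + 1)).prod (angleMeasure m))
        ≤ fanConstant C δ * ∫ r, min 1 r * p r ∂radialMeasure (m + 1) := by
  have hpm := hp.measurable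
  have hmeas : Measurable ((fanSet C δ).indicator fun q : ℝ × ℝ => p q.1) :=
    (hpm.comp measurable_fst).indicator (measurableSet_fanSet C δ)
  have hbound : ∀ᵐ r ∂radialMeasure (m + 1),
      ∫ a, ‖(fanSet C δ).indicator (fun q => p q.1) (r, a)‖ ∂angleMeasure m
        ≤ fanConstant C δ * (min 1 r * p r) := by
    filter_upwards [ae_radialMeasure_pos (m + 1)] with r hr
    rw [integral_fanSet_slice, abs_of_nonneg (hp.nonneg r)]
    calc _ ≤ p r * (fanConstant C δ * min 1 r) := by
          gcongr
          · exact hp.nonneg r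
          · exact angleMeasure_fanSet_le m hC hδ hr
      _ = _ := by ring
  have hslice : Integrable (fun r => ∫ a, ‖(fanSet C δ).indicator (fun q => p q.1) (r, a)‖
      ∂angleMeasure m) (radialMeasure (m + 1)) := by
    refine (hp.integrable.const_mul (fanConstant C δ)).mono' ?_ ?_
    · exact hmeas.aestronglyMeasurable.norm.integral_prod_right'
    · filter_upwards [hbound] with r hr
      rwa [Real.norm_of_nonneg (integral_nonneg fun a => norm_nonneg _)]
  have hint : Integrable ((fanSet C δ).indicator fun q : ℝ × ℝ => p q.1)
      ((radialMeasure (m + 1)).prod (angleMeasure m)) := by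
    rw [integrable_prod_iff hmeas.aestronglyMeasurable]
    refine ⟨ae_of_all _ fun r => ?_, hslice⟩
    refine Integrable.of_bound (C := |p r|)
      (hmeas.comp measurable_prodMk_left).aestronglyMeasurable (ae_of_all _ fun a => ?_)
    exact (norm_indicator_le_norm_self _ _)
  refine ⟨hint, ?_⟩
  rw [integral_prod _ hint, ← integral_const_mul]
  refine integral_mono_ae hint.integral_prod_left (hp.integrable.const_mul _) ?_
  filter_upwards [hbound] with r hr
  refine le_trans (integral_mono_of_nonneg ?_ ?_ ?_) hr
  · exact ae_of_all _ fun a => indicator_nonneg (fun q _ => hp.nonneg q.1) _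
  · refine Integrable.of_bound (C := |p r|)
      (hmeas.comp measurable_prodMk_left).norm.aestronglyMeasurable (ae_of_all _ fun a => ?_)
    rw [norm_norm]
    exact (norm_indicator_le_norm_self _ _)
  · exact ae_of_all _ fun a => Real.le_norm_self _

lemma ae_fan (m : ℕ) : ∀ᵐ q : ℝ × ℝ ∂(radialMeasure (m + 1)).prod (angleMeasure m),
    0 < q.1 ∧ q.2 ∈ Ioo (-(Real.pi / 2)) (Real.pi / 2) :=
  (Measure.quasiMeasurePreserving_fst.ae (ae_radialMeasure_pos (m + 1))).and
    (Measure.quasiMeasurePreserving_snd.ae (ae_angleMeasure_mem m))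

/-- A function dominated by a majorant on a fan-shaped set is integrable. -/
lemma IsMajorant.integrable_and_abs_integral_le (hp : IsMajorant (m + 1) p) {C δ : ℝ}
    (hC : 0 ≤ C) (hδ : 0 < δ) {G : ℝ × ℝ → ℝ} (hG : Measurable G)
    (hle : ∀ q : ℝ × ℝ, 0 < q.1 → |G q| ≤ (fanSet C δ).indicator (fun q => p q.1) q) :
    Integrable G ((radialMeasure (m + 1)).prod (angleMeasure m)) ∧
      |∫ q, G q ∂((radialMeasure (m + 1)).prod (angleMeasure m))|
        ≤ fanConstant C δ * ∫ r, min 1 r * p r ∂radialMeasure (m + 1) := by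
  obtain ⟨h1, h2⟩ := hp.integrable_fanSet hC hδ
  have h3 : ∀ᵐ q ∂(radialMeasure (m + 1)).prod (angleMeasure m),
      ‖G q‖ ≤ (fanSet C δ).indicator (fun q => p q.1) q := by
    filter_upwards [ae_fan m] with q hq using hle q hq.1
  exact ⟨h1.mono' hG.aestronglyMeasurable h3, (norm_integral_le_of_norm_le h1 h3).trans h2⟩

lemma IsMajorant.integrable_tail {n : ℕ} (hp : IsMajorant n p) {R : ℝ} (hR : 0 < R) :
    Integrable ((Ici R).indicator p) (radialMeasure n) := by
  have hmin : 0 < min 1 R := by positivity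
  refine (hp.integrable.const_mul (min 1 R)⁻¹).mono'
    (hp.measurable.indicator measurableSet_Ici).aestronglyMeasurable ?_
  filter_upwards [ae_radialMeasure_pos n] with r hr
  have hp0 := hp.nonneg r
  have hminr : 0 < min 1 r := by positivity
  by_cases h : r ∈ Ici R
  · rw [indicator_of_mem h, Real.norm_of_nonneg hp0, ← mul_assoc]
    refine le_mul_of_one_le_left hp0 ?_
    rw [inv_mul_eq_div, one_le_div hmin]
    exact min_le_min_left _ h
  · rw [indicator_of_notMem h, norm_zero]
    positivity

lemma IsMajorant.integrable_tail_prod (hp : IsMajorant (m + 1) p) {R : ℝ} (hR : 0 < R) :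
    Integrable (fun q : ℝ × ℝ => (Ici R).indicator p q.1)
      ((radialMeasure (m + 1)).prod (angleMeasure m)) :=
  (hp.integrable_tail hR).comp_fst _

end Fan

/-! ### Symmetrization -/

section Symmetrization

variable {V : Type*} [NormedAddCommGroup V] [InnerProductSpace ℝ V]

lemma signedIndicator_of_mem {A : Set V} {y : V} (h : y ∈ A) : signedIndicator A y = -1 := by
  simp [signedIndicator, h]

lemma signedIndicator_of_notMem {A : Set V} {y : V} (h : y ∉ A) : signedIndicator A y = 1 := by
  simp [signedIndicator, h]

lemma abs_signedIndicator (A : Set V) (y : V) : |signedIndicator A y| = 1 := by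
  by_cases h : y ∈ A
  · rw [signedIndicator_of_mem h]; simp
  · rw [signedIndicator_of_notMem h]; simp

/-- The even part of `w ↦ χ̃_A(x + w)`. -/
def symSign (A : Set V) (x w : V) : ℝ := (signedIndicator A (x + w) + signedIndicator A (x - w)) / 2

lemma abs_symSign_le (A : Set V) (x w : V) : |symSign A x w| ≤ 1 := by
  unfold symSign
  rw [abs_div, abs_two]
  have h := abs_add_le (signedIndicator A (x + w)) (signedIndicator A (x - w))
  rw [abs_signedIndicator, abs_signedIndicator] at h
  linarith

lemma measurable_signedIndicator [MeasurableSpace V] [BorelSpace V] {A : Set V}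
    (hA : IsClosed A) : Measurable (signedIndicator A) := by
  unfold signedIndicator
  exact (measurable_const.indicator hA.measurableSet.compl).sub
    (measurable_const.indicator hA.measurableSet)

/-- The unit vector at angle `α` from `e` in the plane spanned by `e` and `ν`. -/
def planeDir (e ν : V) (a : ℝ) : V := Real.cos a • e + Real.sin a • ν

section

variable {e ν : V}

lemma norm_smul_add_smul (he : ‖e‖ = 1) (hν : ‖ν‖ = 1) (heν : ⟪e, ν⟫ = 0) (s t : ℝ) :
    ‖s • e + t • ν‖ ^ 2 = s ^ 2 + t ^ 2 := by
  rw [norm_add_sq_real, real_inner_smul_left, real_inner_smul_right, heν, norm_smul, norm_smul, he,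
    hν]
  simp

lemma norm_planeDir (he : ‖e‖ = 1) (hν : ‖ν‖ = 1) (heν : ⟪e, ν⟫ = 0) (a : ℝ) :
    ‖planeDir e ν a‖ = 1 := by
  have h := norm_smul_add_smul he hν heν (Real.cos a) (Real.sin a)
  rw [Real.cos_sq_add_sin_sq] at h
  exact (sq_eq_sq₀ (norm_nonneg _) zero_le_one).1 (by rw [one_pow]; exact h)

lemma norm_smul_planeDir (he : ‖e‖ = 1) (hν : ‖ν‖ = 1) (heν : ⟪e, ν⟫ = 0) {r : ℝ} (hr : 0 ≤ r)
    (a : ℝ) : ‖r • planeDir e ν a‖ = r := by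
  rw [norm_smul, norm_planeDir he hν heν, mul_one, Real.norm_of_nonneg hr]

lemma inner_planeDir (hν : ‖ν‖ = 1) (heν : ⟪e, ν⟫ = 0) (a : ℝ) :
    ⟪planeDir e ν a, ν⟫ = Real.sin a := by
  rw [planeDir, inner_add_left, real_inner_smul_left, real_inner_smul_left, heν,
    real_inner_self_eq_norm_sq, hν]
  simp

/-- Off the fan the height `|r sin α|` exceeds the pinching error `C r²`, so exactly one of two
antipodal points belongs to `A` and their signs cancel. -/
lemma symSign_eq_zero {A : Set V} {x : V} {C δ : ℝ} (h : Pinched A x (fun v => ⟪v, ν⟫) C δ)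
    (he : ‖e‖ = 1) (hν : ‖ν‖ = 1) (heν : ⟪e, ν⟫ = 0) {q : ℝ × ℝ} (hr : 0 < q.1)
    (hq : q ∉ fanSet C δ) : symSign A x (q.1 • planeDir e ν q.2) = 0 := by
  obtain ⟨r, a⟩ := q
  simp only [fanSet, mem_ofPred_eq, not_or, not_le] at hq hr ⊢
  obtain ⟨h1, h2⟩ := hq
  set v := r • planeDir e ν a with hv
  have hn : ‖v‖ = r := norm_smul_planeDir he hν heν hr.le a
  have hi : ⟪v, ν⟫ = r * Real.sin a := by
    rw [hv, real_inner_smul_left, inner_planeDir hν heν]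
  have hp := h v (by rw [hn]; exact h1)
  have hm := h (-v) (by rw [norm_neg, hn]; exact h1)
  simp only [norm_neg, inner_neg_left, hn, hi, ← sub_eq_add_neg] at hp hm
  have h3 : C * r ^ 2 < |r * Real.sin a| := by
    rw [abs_mul, abs_of_pos hr]
    nlinarith
  unfold symSign
  rcases lt_abs.1 h3 with h4 | h4
  · rw [signedIndicator_of_notMem (hp.2 h4), signedIndicator_of_mem (hm.1 (by linarith))]
    norm_num
  · rw [signedIndicator_of_mem (hp.1 (by linarith)), signedIndicator_of_notMem (hm.2 h4)]
    norm_num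

end

variable [MeasurableSpace V] [BorelSpace V] [FiniteDimensional ℝ V]

lemma measurable_symSign {A : Set V} (hA : IsClosed A) (x : V) : Measurable (symSign A x) := by
  have := measurable_signedIndicator hA
  unfold symSign
  exact ((this.comp (by fun_prop)).add (this.comp (by fun_prop))).div_const 2

/-- The integrand of the nonlocal curvatures, symmetrized and truncated to `R ≤ |w|`. -/
def truncKernel (k : V → ℝ) (A : Set V) (x : V) (R : ℝ) (w : V) : ℝ :=
  {w : V | R ≤ ‖w‖}.indicator (fun w => symSign A x w * k w) w

lemma measurable_truncKernel {k : V → ℝ} (hk : Measurable k) {A : Set V} (hA : IsClosed A)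
    (x : V) (R : ℝ) : Measurable (truncKernel k A x R) :=
  ((measurable_symSign hA x).mul hk).indicator (measurableSet_le (by fun_prop) (by fun_prop))

/-- The nonlocal directional curvature with the disk of radius `R` removed. -/
def fanIntegral (m : ℕ) (k : V → ℝ) (A : Set V) (x e ν : V) (R : ℝ) : ℝ :=
  ∫ q : ℝ × ℝ, truncKernel k A x R (q.1 • planeDir e ν q.2)
    ∂(radialMeasure (m + 1)).prod (angleMeasure m)

lemma continuous_smul_planeDir (e ν : V) :
    Continuous fun q : ℝ × ℝ => q.1 • planeDir e ν q.2 := by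
  unfold planeDir
  fun_prop

section

variable {m : ℕ} {k : V → ℝ} {A : Set V} {x e ν : V} {p : ℝ → ℝ} {C δ : ℝ}

lemma abs_truncKernel_le (hkp : ∀ w, w ≠ 0 → |k w| ≤ p ‖w‖)
    (h : Pinched A x (fun v => ⟪v, ν⟫) C δ) (he : ‖e‖ = 1) (hν : ‖ν‖ = 1) (heν : ⟪e, ν⟫ = 0)
    (R : ℝ) (q : ℝ × ℝ) (hq : 0 < q.1) :
    |truncKernel k A x R (q.1 • planeDir e ν q.2)|
      ≤ (fanSet C δ).indicator (fun q => p q.1) q := by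
  have hn : ‖q.1 • planeDir e ν q.2‖ = q.1 := norm_smul_planeDir he hν heν hq.le _
  have hne : q.1 • planeDir e ν q.2 ≠ 0 := by rw [← norm_pos_iff, hn]; exact hq
  refine (norm_indicator_le_norm_self (E := ℝ) _ _).trans ?_
  rw [Real.norm_eq_abs, abs_mul]
  by_cases hqf : q ∈ fanSet C δ
  · rw [indicator_of_mem hqf]
    have h1 := hkp _ hne
    rw [hn] at h1
    calc _ ≤ 1 * p q.1 := by
          gcongr
          exact abs_symSign_le _ _ _
      _ = _ := one_mul _
  · rw [indicator_of_notMem hqf, symSign_eq_zero h he hν heν hq hqf]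
    simp

lemma integrable_truncKernel_and_abs_fanIntegral_le (hk : Measurable k) (hA : IsClosed A)
    (hkp : ∀ w, w ≠ 0 → |k w| ≤ p ‖w‖) (hp : IsMajorant (m + 1) p)
    (hC : 0 ≤ C) (hδ : 0 < δ) (h : Pinched A x (fun v => ⟪v, ν⟫) C δ)
    (he : ‖e‖ = 1) (hν : ‖ν‖ = 1) (heν : ⟪e, ν⟫ = 0) (R : ℝ) :
    Integrable (fun q : ℝ × ℝ => truncKernel k A x R (q.1 • planeDir e ν q.2))
        ((radialMeasure (m + 1)).prod (angleMeasure m)) ∧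
      |fanIntegral m k A x e ν R|
        ≤ fanConstant C δ * ∫ r, min 1 r * p r ∂radialMeasure (m + 1) :=
  hp.integrable_and_abs_integral_le hC hδ
    ((measurable_truncKernel hk hA x R).comp (continuous_smul_planeDir e ν).measurable)
    (abs_truncKernel_le hkp h he hν heν R)

/-- Dominated convergence: the majorant on the fan does not depend on `R`, so after symmetrization
the principal value is a plain integral. -/
lemma tendsto_fanIntegral (hk : Measurable k) (hA : IsClosed A)
    (hkp : ∀ w, w ≠ 0 → |k w| ≤ p ‖w‖) (hp : IsMajorant (m + 1) p)
    (hC : 0 ≤ C) (hδ : 0 < δ) (h : Pinched A x (fun v => ⟪v, ν⟫) C δ)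
    (he : ‖e‖ = 1) (hν : ‖ν‖ = 1) (heν : ⟪e, ν⟫ = 0) :
    Tendsto (fanIntegral m k A x e ν) (𝓝[>] 0) (𝓝 (fanIntegral m k A x e ν 0)) := by
  refine tendsto_integral_filter_of_dominated_convergence _ (Eventually.of_forall fun R => ?_)
    (Eventually.of_forall fun R => ?_) (hp.integrable_fanSet hC hδ).1 ?_
  · exact ((measurable_truncKernel hk hA x R).comp
      (continuous_smul_planeDir e ν).measurable).aestronglyMeasurable
  · filter_upwards [ae_fan m] with q hq
    exact abs_truncKernel_le hkp h he hν heν R q hq.1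
  · filter_upwards [ae_fan m] with q hq
    refine tendsto_const_nhds.congr' ?_
    filter_upwards [Ioo_mem_nhdsGT hq.1] with R hR
    have hn : ‖q.1 • planeDir e ν q.2‖ = q.1 := norm_smul_planeDir he hν heν hq.1.le _
    rw [truncKernel, truncKernel, indicator_of_mem, indicator_of_mem]
    · simp only [mem_ofPred_eq, hn]; exact hR.2.le
    · simp

end

end Symmetrization

/-! ### Existence of the nonlocal curvatures -/

section Existence

/-! ### Symmetrization and principal values in coordinates. -/

section General

variable {V : Type*} [NormedAddCommGroup V] [InnerProductSpace ℝ V] [FiniteDimensional ℝ V]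
  [MeasurableSpace V] [BorelSpace V]

/-- The integrand of the nonlocal curvatures, truncated to `R ≤ |w|`. -/
def rawKernel (k : V → ℝ) (A : Set V) (x : V) (R : ℝ) (w : V) : ℝ :=
  {w : V | R ≤ ‖w‖}.indicator (fun w => signedIndicator A (x + w) * k w) w

variable {m : ℕ} {k : V → ℝ} {A : Set V} {x e ν : V} {p : ℝ → ℝ} {C δ : ℝ}

lemma measurable_rawKernel (hk : Measurable k) (hA : IsClosed A) (x : V) (R : ℝ) :
    Measurable (rawKernel k A x R) :=
  (((measurable_signedIndicator hA).comp (by fun_prop)).mul hk).indicator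
    (measurableSet_le (by fun_prop) (by fun_prop))

lemma rawKernel_add_neg (hk : ∀ w, k (-w) = k w) (R : ℝ) (w : V) :
    (rawKernel k A x R w + rawKernel k A x R (-w)) / 2 = truncKernel k A x R w := by
  unfold rawKernel truncKernel
  by_cases h : R ≤ ‖w‖
  · rw [indicator_of_mem (by exact h), indicator_of_mem (by simpa using h),
      indicator_of_mem (by exact h), hk, symSign, ← sub_eq_add_neg]
    ring
  · rw [indicator_of_notMem (by exact h), indicator_of_notMem (by simpa using h),
      indicator_of_notMem (by exact h)]
    simp

lemma abs_rawKernel_le (hkp : ∀ w, w ≠ 0 → |k w| ≤ p ‖w‖) {R : ℝ} (hR : 0 < R) (w : V) :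
    |rawKernel k A x R w| ≤ (Ici R).indicator p ‖w‖ := by
  unfold rawKernel
  by_cases h : R ≤ ‖w‖
  · rw [indicator_of_mem (by exact h), indicator_of_mem (by exact h), abs_mul, abs_signedIndicator,
      one_mul]
    exact hkp w (norm_pos_iff.1 (hR.trans_le h))
  · rw [indicator_of_notMem (by exact h), indicator_of_notMem (by exact h), abs_zero]

/-- The point of the half-plane with polar coordinates `(r, α)`. -/
lemma polar_smul_add (e ν : V) (q : ℝ × ℝ) :
    (q.1 * Real.cos q.2) • e + (q.1 * Real.sin q.2) • ν = q.1 • planeDir e ν q.2 := by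
  rw [planeDir, smul_add, smul_smul, smul_smul]

lemma integrable_rawKernel_halfPlane (hk : Measurable k) (hA : IsClosed A)
    (hkp : ∀ w, w ≠ 0 → |k w| ≤ p ‖w‖) (hp : IsMajorant (m + 1) p)
    (he : ‖e‖ = 1) (hν : ‖ν‖ = 1) (heν : ⟪e, ν⟫ = 0) {R : ℝ} (hR : 0 < R) :
    Integrable (fun q : ℝ × ℝ => rawKernel k A x R (q.1 • e + q.2 • ν))
        ((radialMeasure m).prod volume) ∧
      Integrable (fun q : ℝ × ℝ => rawKernel k A x R (-(q.1 • e + q.2 • ν)))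
        ((radialMeasure m).prod volume) := by
  have hm := measurable_rawKernel hk hA x R
  have h1 : Measurable fun q : ℝ × ℝ => rawKernel k A x R (q.1 • e + q.2 • ν) :=
    hm.comp (by fun_prop)
  have h2 : Measurable fun q : ℝ × ℝ => rawKernel k A x R (-(q.1 • e + q.2 • ν)) :=
    hm.comp (by fun_prop)
  rw [← integrable_comp_halfPlane_iff m h1, ← integrable_comp_halfPlane_iff m h2]
  simp only [polar_smul_add]
  have h3 := (continuous_smul_planeDir e ν).measurable
  constructor
  · refine (hp.integrable_tail_prod hR).mono' (hm.comp h3).aestronglyMeasurable ?_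
    filter_upwards [ae_fan m] with q hq
    have h4 := abs_rawKernel_le (A := A) (x := x) hkp hR (q.1 • planeDir e ν q.2)
    rwa [norm_smul_planeDir he hν heν hq.1.le] at h4
  · refine (hp.integrable_tail_prod hR).mono' (hm.comp h3.neg).aestronglyMeasurable ?_
    filter_upwards [ae_fan m] with q hq
    have h4 := abs_rawKernel_le (A := A) (x := x) hkp hR (-(q.1 • planeDir e ν q.2))
    rwa [norm_neg, norm_smul_planeDir he hν heν hq.1.le] at h4

/-- For `R > 0` the unsymmetrized integrand is integrable, so the two half-planes may be folded
together. Only the folded form survives `R ↓ 0`. -/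
lemma plane_integral_rawKernel (hk : Measurable k) (hA : IsClosed A) (hk' : ∀ w, k (-w) = k w)
    (hkp : ∀ w, w ≠ 0 → |k w| ≤ p ‖w‖) (hp : IsMajorant (m + 1) p)
    (he : ‖e‖ = 1) (hν : ‖ν‖ = 1) (heν : ⟪e, ν⟫ = 0) {R : ℝ} (hR : 0 < R) :
    Integrable (fun q : ℝ × ℝ => |q.1| ^ m * rawKernel k A x R (q.1 • e + q.2 • ν)) ∧
      1 / 2 * ∫ q : ℝ × ℝ, |q.1| ^ m * rawKernel k A x R (q.1 • e + q.2 • ν)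
        = fanIntegral m k A x e ν R := by
  obtain ⟨h1, h2⟩ := integrable_rawKernel_halfPlane (x := x) hk hA hkp hp he hν heν hR
  have h2' : Integrable (fun q : ℝ × ℝ => rawKernel k A x R ((-q).1 • e + (-q).2 • ν))
      ((radialMeasure m).prod volume) := by
    convert h2 using 3 with q
    simp; abel
  refine ⟨integrable_abs_pow_mul m h1 h2', ?_⟩
  rw [integral_abs_pow_mul m h1 h2', fanIntegral]
  have h3 : ∀ q : ℝ × ℝ, (rawKernel k A x R (q.1 • e + q.2 • ν)
      + rawKernel k A x R ((-q).1 • e + (-q).2 • ν)) / 2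
      = truncKernel k A x R (q.1 • e + q.2 • ν) := by
    intro q
    rw [← rawKernel_add_neg hk']
    congr 3
    simp; abel
  have h4 : Measurable fun q : ℝ × ℝ => truncKernel k A x R (q.1 • e + q.2 • ν) :=
    (measurable_truncKernel hk hA x R).comp (by fun_prop)
  simp_rw [h3]
  rw [← integral_comp_halfPlane m h4]
  simp only [polar_smul_add]

variable {W : Type*} [NormedAddCommGroup W] [InnerProductSpace ℝ W] [FiniteDimensional ℝ W]
  [MeasurableSpace W] [BorelSpace W]

/-- Averaging over `w ↦ -w` leaves the integral unchanged, and the half-planes bounded by the axis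
`ν`, one for each tangent direction, fill the space. Fubini also yields the measurability in the
direction. -/
lemma space_integral_rawKernel [Nontrivial W] (ι : W →ₗᵢ[ℝ] V) (hν : ‖ν‖ = 1)
    (hι : ∀ w, ⟪ι w, ν⟫ = 0) (hV : Module.finrank ℝ V = m + 2) (hW : Module.finrank ℝ W = m + 1)
    (hk : Measurable k) (hA : IsClosed A) (hk' : ∀ w, k (-w) = k w)
    (hkp : ∀ w, w ≠ 0 → |k w| ≤ p ‖w‖) (hp : IsMajorant (m + 1) p) {R : ℝ} (hR : 0 < R) :
    Integrable (rawKernel k A x R) ∧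
      AEStronglyMeasurable (fun e : sphere (0 : W) 1 => fanIntegral m k A x (ι e) ν R)
        (volume : Measure W).toSphere ∧
      ∫ w, rawKernel k A x R w
        = ∫ e : sphere (0 : W) 1, fanIntegral m k A x (ι e) ν R ∂(volume : Measure W).toSphere := by
  have hmp := measurePreserving_spherical ι ν hν hι hV hW
  have hm := measurable_rawKernel hk hA x R
  have hmt := measurable_truncKernel hk hA x R
  have hnorm : ∀ (e : sphere (0 : W) 1) (q : ℝ × ℝ), 0 < q.1 →
      ‖q.1 • planeDir (ι e) ν q.2‖ = q.1 := fun e q hq =>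
    norm_smul_planeDir (by rw [ι.norm_map]; simp) hν (hι _) hq.le _
  have hint : Integrable (rawKernel k A x R) := by
    rw [← hmp.integrable_comp hm.aestronglyMeasurable]
    refine ((hp.integrable_tail_prod hR).comp_snd _).mono'
      (hm.comp hmp.measurable).aestronglyMeasurable ?_
    have hae : ∀ᵐ z ∂(volume : Measure W).toSphere.prod
        ((radialMeasure (m + 1)).prod (angleMeasure m)), 0 < z.2.1 :=
      Measure.quasiMeasurePreserving_snd.ae ((ae_fan m).mono fun q hq => hq.1)
    filter_upwards [hae] with z hz
    have h4 := abs_rawKernel_le (A := A) (x := x) hkp hR (z.2.1 • planeDir (ι z.1) ν z.2.2)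
    rwa [hnorm _ _ hz] at h4
  have htr : Integrable (truncKernel k A x R) := by
    have : truncKernel k A x R = fun w => (rawKernel k A x R w + rawKernel k A x R (-w)) / 2 :=
      funext fun w => (rawKernel_add_neg hk' R w).symm
    rw [this]
    exact (hint.add hint.comp_neg).div_const 2
  have hcomp := (hmp.integrable_comp hmt.aestronglyMeasurable).2 htr
  refine ⟨hint, hcomp.aestronglyMeasurable.integral_prod_right', ?_⟩
  have h1 : ∫ w, rawKernel k A x R w = ∫ w, truncKernel k A x R w := by
    simp_rw [← rawKernel_add_neg hk']
    rw [integral_div, integral_add hint hint.comp_neg, integral_neg_eq_self]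
    ring
  rw [h1, ← hmp.map_eq, integral_map hmp.measurable.aemeasurable hmt.aestronglyMeasurable]
  exact integral_prod _ hcomp

/-- The mean over directions of the directional curvatures. -/
lemma tendsto_space_integral_rawKernel [Nontrivial W] (ι : W →ₗᵢ[ℝ] V) (hν : ‖ν‖ = 1)
    (hι : ∀ w, ⟪ι w, ν⟫ = 0) (hV : Module.finrank ℝ V = m + 2) (hW : Module.finrank ℝ W = m + 1)
    (hk : Measurable k) (hA : IsClosed A) (hk' : ∀ w, k (-w) = k w)
    (hkp : ∀ w, w ≠ 0 → |k w| ≤ p ‖w‖) (hp : IsMajorant (m + 1) p)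
    (hC : 0 ≤ C) (hδ : 0 < δ) (h : Pinched A x (fun v => ⟪v, ν⟫) C δ) :
    AEStronglyMeasurable (fun e : sphere (0 : W) 1 => fanIntegral m k A x (ι e) ν 0)
        (volume : Measure W).toSphere ∧
      Tendsto (fun R => ∫ w, rawKernel k A x R w) (𝓝[>] 0)
        (𝓝 (∫ e : sphere (0 : W) 1, fanIntegral m k A x (ι e) ν 0
          ∂(volume : Measure W).toSphere)) := by
  have hone : ∀ e : sphere (0 : W) 1, ‖ι e‖ = 1 := fun e => by rw [ι.norm_map]; simp
  have hlim : ∀ e : sphere (0 : W) 1, Tendsto (fanIntegral m k A x (ι e) ν) (𝓝[>] 0)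
      (𝓝 (fanIntegral m k A x (ι e) ν 0)) := fun e =>
    tendsto_fanIntegral hk hA hkp hp hC hδ h (hone e) hν (hι _)
  have hev : ∀ᶠ R in 𝓝[>] (0 : ℝ),
      AEStronglyMeasurable (fun e : sphere (0 : W) 1 => fanIntegral m k A x (ι e) ν R)
        (volume : Measure W).toSphere := by
    filter_upwards [self_mem_nhdsWithin] with R hR
    exact (space_integral_rawKernel (x := x) ι hν hι hV hW hk hA hk' hkp hp hR).2.1
  refine ⟨?_, ?_⟩
  -- Fubini gives measurability only for `R > 0`; a sequence `R ↓ 0` passes it to the limit.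
  · obtain ⟨u, hu⟩ := exists_seq_tendsto (𝓝[>] (0 : ℝ))
    obtain ⟨N, hN⟩ := (hu.eventually hev).exists_forall_of_atTop
    exact aestronglyMeasurable_of_tendsto_ae atTop (f := fun n (e : sphere (0 : W) 1) =>
      fanIntegral m k A x (ι e) ν (u (n + N))) (fun n => hN _ (by simp))
      (ae_of_all _ fun e => (hlim e).comp (hu.comp (tendsto_add_atTop_nat N)))
  · have h1 := tendsto_integral_filter_of_dominated_convergence
      (μ := (volume : Measure W).toSphere) (l := 𝓝[>] (0 : ℝ))
      (F := fun R (e : sphere (0 : W) 1) => fanIntegral m k A x (ι e) ν R)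
      (f := fun e : sphere (0 : W) 1 => fanIntegral m k A x (ι e) ν 0)
      (fun _ => fanConstant C δ * ∫ r, min 1 r * p r ∂radialMeasure (m + 1)) hev
      (Eventually.of_forall fun R => ae_of_all _ fun e =>
        (integrable_truncKernel_and_abs_fanIntegral_le hk hA hkp hp hC hδ h (hone e) hν (hι _)
          R).2) (integrable_const _) (ae_of_all _ hlim)
    refine h1.congr' ?_
    filter_upwards [self_mem_nhdsWithin] with R hR
    exact (space_integral_rawKernel (x := x) ι hν hι hV hW hk hA hk' hkp hp hR).2.2.symm

end General

variable {m : ℕ} {k : EuclideanSpace ℝ (Fin (m + 2)) → ℝ} {A : Set (EuclideanSpace ℝ (Fin (m + 2)))}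
  {x : EuclideanSpace ℝ (Fin (m + 2))} {p : ℝ → ℝ} {C δ : ℝ}

/-- Every integral avoids a ball around `x`, so the value of the kernel at the origin never enters;
it may be reset to make the kernel measurable and even. -/
lemma HasNonlocalDirectionalCurvature.congr {d : ℕ} {k k' : EuclideanSpace ℝ (Fin d) → ℝ}
    {x e : EuclideanSpace ℝ (Fin d)} {A : Set (EuclideanSpace ℝ (Fin d))} {K : ℝ}
    (h : HasNonlocalDirectionalCurvature k x e A K) (hkk : ∀ w, w ≠ 0 → k w = k' w) :
    HasNonlocalDirectionalCurvature k' x e A K := by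
  have hm : ∀ r : ℝ, MeasurableSet (planePoint x e (outerNormal A x) ⁻¹' (ball x r)ᶜ) := by
    intro r
    refine measurableSet_ball.compl.preimage ?_
    unfold planePoint
    fun_prop
  have hne : ∀ r > 0, EqOn
      (fun q => signedIndicator A (planePoint x e (outerNormal A x) q) * |q.1| ^ (d - 2) *
        k (x - planePoint x e (outerNormal A x) q))
      (fun q => signedIndicator A (planePoint x e (outerNormal A x) q) * |q.1| ^ (d - 2) *
        k' (x - planePoint x e (outerNormal A x) q))
      (planePoint x e (outerNormal A x) ⁻¹' (ball x r)ᶜ) := by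
    intro r hr q hq
    have : x - planePoint x e (outerNormal A x) q ≠ 0 := by
      rw [sub_ne_zero]
      intro heq
      rw [mem_preimage, ← heq] at hq
      exact hq (mem_ball_self hr)
    simp only [hkk _ this]
  refine ⟨fun r hr => (h.1 r hr).congr_fun (hne r hr) (hm r), h.2.congr' ?_⟩
  filter_upwards [self_mem_nhdsWithin] with r hr
  rw [setIntegral_congr_fun (hm r) (hne r hr)]

lemma HasNonlocalMeanCurvature.congr {d : ℕ} {k k' : EuclideanSpace ℝ (Fin d) → ℝ}
    {x : EuclideanSpace ℝ (Fin d)} {A : Set (EuclideanSpace ℝ (Fin d))} {K : ℝ}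
    (h : HasNonlocalMeanCurvature k x A K) (hkk : ∀ w, w ≠ 0 → k w = k' w) :
    HasNonlocalMeanCurvature k' x A K := by
  have hne : ∀ r > 0, EqOn (fun y => signedIndicator A y * k (x - y))
      (fun y => signedIndicator A y * k' (x - y)) (ball x r)ᶜ := by
    intro r hr y hy
    have : x - y ≠ 0 := by
      rw [sub_ne_zero]
      rintro rfl
      exact hy (mem_ball_self hr)
    simp only [hkk _ this]
  refine ⟨fun r hr => (h.1 r hr).congr_fun (hne r hr) measurableSet_ball.compl, h.2.congr' ?_⟩
  filter_upwards [self_mem_nhdsWithin] with r hr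
  rw [setIntegral_congr_fun measurableSet_ball.compl (hne r hr)]

lemma hasNonlocalDirectionalCurvature_fanIntegral (hk : Measurable k) (hA : IsClosed A)
    (hk' : ∀ w, k (-w) = k w)
    (hkp : ∀ w, w ≠ 0 → |k w| ≤ p ‖w‖) (hp : IsMajorant (m + 1) p)
    (hC : 0 ≤ C) (hδ : 0 < δ) (h : Pinched A x (fun v => ⟪v, outerNormal A x⟫) C δ)
    {e : EuclideanSpace ℝ (Fin (m + 2))} (he : ‖e‖ = 1) (hν : ‖outerNormal A x‖ = 1)
    (heν : ⟪e, outerNormal A x⟫ = 0) :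
    HasNonlocalDirectionalCurvature k x e A (fanIntegral m k A x e (outerNormal A x) 0) := by
  set ν := outerNormal A x with hνdef
  have hm : ∀ r : ℝ, MeasurableSet (planePoint x e ν ⁻¹' (ball x r)ᶜ) := by
    intro r
    refine measurableSet_ball.compl.preimage ?_
    unfold planePoint
    fun_prop
  have hind : ∀ R : ℝ, (planePoint x e ν ⁻¹' (ball x R)ᶜ).indicator
      (fun q => signedIndicator A (planePoint x e ν q) * |q.1| ^ (m + 2 - 2) *
        k (x - planePoint x e ν q))
      = fun q : ℝ × ℝ => |q.1| ^ m * rawKernel k A x R (q.1 • e + q.2 • ν) := by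
    intro R
    ext q
    have h1 : planePoint x e ν q = x + (q.1 • e + q.2 • ν) := by rw [planePoint, add_assoc]
    have h2 : k (x - planePoint x e ν q) = k (q.1 • e + q.2 • ν) := by
      rw [h1, ← hk']; congr 1; abel
    have h3 : q ∈ planePoint x e ν ⁻¹' (ball x R)ᶜ ↔ R ≤ ‖q.1 • e + q.2 • ν‖ := by
      rw [mem_preimage, h1, mem_compl_iff, mem_ball, dist_eq_norm, add_sub_cancel_left, not_lt]
    unfold rawKernel
    by_cases h4 : R ≤ ‖q.1 • e + q.2 • ν‖
    · rw [indicator_of_mem (h3.2 h4), indicator_of_mem (by exact h4), h2, h1]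
      simp only [Nat.add_sub_cancel]
      ring
    · rw [indicator_of_notMem (fun h5 => h4 (h3.1 h5)), indicator_of_notMem (by exact h4), mul_zero]
  refine ⟨fun R hR => ?_, ?_⟩
  · rw [← integrable_indicator_iff (hm R)]
    simp only [← hνdef]
    rw [hind R]
    exact (plane_integral_rawKernel hk hA hk' hkp hp he hν heν hR).1
  · refine (tendsto_fanIntegral hk hA hkp hp hC hδ h he hν heν).congr' ?_
    filter_upwards [self_mem_nhdsWithin] with R hR
    simp only [← hνdef]
    rw [← integral_indicator (hm R), hind R,
      (plane_integral_rawKernel hk hA hk' hkp hp he hν heν hR).2]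

/-- The model `W` of the tangent hyperplane is left free, so that a single sphere can serve all the
sets `E_n`. -/
lemma hasNonlocalMeanCurvature_integral {W : Type*} [NormedAddCommGroup W] [InnerProductSpace ℝ W]
    [FiniteDimensional ℝ W] [MeasurableSpace W] [BorelSpace W] [Nontrivial W]
    {ν : EuclideanSpace ℝ (Fin (m + 2))} (ι : W →ₗᵢ[ℝ] EuclideanSpace ℝ (Fin (m + 2)))
    (hν : ‖ν‖ = 1) (hι : ∀ w, ⟪ι w, ν⟫ = 0) (hW : Module.finrank ℝ W = m + 1)
    (hk : Measurable k) (hA : IsClosed A) (hk' : ∀ w, k (-w) = k w)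
    (hkp : ∀ w, w ≠ 0 → |k w| ≤ p ‖w‖) (hp : IsMajorant (m + 1) p)
    (hC : 0 ≤ C) (hδ : 0 < δ) (h : Pinched A x (fun v => ⟪v, ν⟫) C δ) :
    HasNonlocalMeanCurvature k x A ((sphereArea m)⁻¹ *
      ∫ e : sphere (0 : W) 1, fanIntegral m k A x (ι e) ν 0 ∂(volume : Measure W).toSphere) := by
  have hV : Module.finrank ℝ (EuclideanSpace ℝ (Fin (m + 2))) = m + 2 := by simp
  have hind : ∀ (R : ℝ) w, (ball x R)ᶜ.indicator
      (fun y => signedIndicator A y * k (x - y)) (x + w) = rawKernel k A x R w := by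
    intro R w
    have h3 : x + w ∈ (ball x R)ᶜ ↔ R ≤ ‖w‖ := by
      rw [mem_compl_iff, mem_ball, dist_eq_norm, add_sub_cancel_left, not_lt]
    unfold rawKernel
    by_cases h4 : R ≤ ‖w‖
    · rw [indicator_of_mem (h3.2 h4), indicator_of_mem (by exact h4), ← hk']
      congr 2
      abel
    · rw [indicator_of_notMem (fun h5 => h4 (h3.1 h5)), indicator_of_notMem (by exact h4)]
  refine ⟨fun R hR => ?_, ?_⟩
  · rw [← integrable_indicator_iff measurableSet_ball.compl]
    have h1 := (space_integral_rawKernel (x := x) ι hν hι hV hW hk hA hk' hkp hp hR).1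
    rw [← funext (hind R)] at h1
    exact (measurePreserving_add_left volume x).integrable_comp_emb
      (MeasurableEquiv.addLeft x).measurableEmbedding |>.1 h1
  · refine Tendsto.const_mul _ ?_
    refine (tendsto_space_integral_rawKernel (x := x) ι hν hι hV hW hk hA hk' hkp hp hC hδ
      h).2.congr fun R => ?_
    rw [← integral_indicator measurableSet_ball.compl, ← funext (hind R)]
    exact integral_add_left_eq_self _ x

end Existence

/-! ### The limit of the angular integrals -/

section AngularLimit

variable {V : Type*} [NormedAddCommGroup V] [InnerProductSpace ℝ V] [FiniteDimensional ℝ V]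
  [MeasurableSpace V] [BorelSpace V]

/-- The angular integral at radius `r` of the nonlocal curvature with kernel `g (w / |w|) p(|w|)`. -/
def angularIntegral (m : ℕ) (g : V → ℝ) (A : Set V) (x e ν : V) (r : ℝ) : ℝ :=
  ∫ a, symSign A x (r • planeDir e ν a) * g (planeDir e ν a) ∂angleMeasure m

lemma continuous_planeDir (e ν : V) : Continuous (planeDir e ν) := by
  unfold planeDir
  fun_prop

lemma planeDir_mem_sphere {e ν : V} (he : ‖e‖ = 1) (hν : ‖ν‖ = 1) (heν : ⟪e, ν⟫ = 0) (a : ℝ) :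
    planeDir e ν a ∈ sphere (0 : V) 1 := by
  rw [mem_sphere_zero_iff_norm, norm_planeDir he hν heν]

lemma continuous_comp_planeDir {g : V → ℝ} (hg : ContinuousOn g (sphere 0 1)) {e ν : V}
    (he : ‖e‖ = 1) (hν : ‖ν‖ = 1) (heν : ⟪e, ν⟫ = 0) : Continuous fun a => g (planeDir e ν a) :=
  hg.comp_continuous (continuous_planeDir e ν) (planeDir_mem_sphere he hν heν)

/-- Valid at every radius, not only small ones: it controls the part of the mass away from the
origin in the concentration argument. -/
lemma abs_angularIntegral_le {m : ℕ} {g : V → ℝ} {A : Set V} {x e ν : V}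
    (he : ‖e‖ = 1) (hν : ‖ν‖ = 1) (heν : ⟪e, ν⟫ = 0) {C δ G : ℝ} (hC : 0 ≤ C) (hδ : 0 < δ)
    (h : Pinched A x (fun v => ⟪v, ν⟫) C δ) (hG : ∀ θ ∈ sphere (0 : V) 1, |g θ| ≤ G)
    {r : ℝ} (hr : 0 < r) :
    |angularIntegral m g A x e ν r| ≤ G * fanConstant C δ * min 1 r := by
  have hG0 : 0 ≤ G := (abs_nonneg _).trans (hG _ (planeDir_mem_sphere he hν heν 0))
  have hms : MeasurableSet {a | (r, a) ∈ fanSet C δ} :=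
    measurable_prodMk_left (measurableSet_fanSet C δ)
  have hle : ∀ a, ‖symSign A x (r • planeDir e ν a) * g (planeDir e ν a)‖
      ≤ {a | (r, a) ∈ fanSet C δ}.indicator (fun _ => G) a := by
    intro a
    by_cases ha : (r, a) ∈ fanSet C δ
    · rw [indicator_of_mem (show a ∈ {a | (r, a) ∈ fanSet C δ} from ha), Real.norm_eq_abs, abs_mul]
      calc _ ≤ 1 * G := by
            gcongr
            · exact abs_symSign_le _ _ _
            · exact hG _ (planeDir_mem_sphere he hν heν a)
        _ = G := one_mul _
    · rw [indicator_of_notMem (show a ∉ {a | (r, a) ∈ fanSet C δ} from ha)]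
      have := symSign_eq_zero h he hν heν (q := (r, a)) hr ha
      simp only at this
      rw [this]
      simp
  have h1 := norm_integral_le_of_norm_le (μ := angleMeasure m)
    ((integrable_const G).indicator hms) (ae_of_all _ hle)
  rw [integral_indicator hms, setIntegral_const, smul_eq_mul] at h1
  refine h1.trans ?_
  calc _ ≤ (fanConstant C δ * min 1 r) * G := by
        gcongr
        exact angleMeasure_fanSet_le m hC hδ hr
    _ = _ := by ring

lemma Pinched.of_hessian {A : Set V} {x ν : V} {B : V →L[ℝ] V →L[ℝ] ℝ} {η δ : ℝ}
    (h : Pinched A x (fun v => ⟪v, ν⟫ + 1 / 2 * B v v) η δ) :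
    Pinched A x (fun v => ⟪v, ν⟫) (η + ‖B‖ / 2) δ := by
  intro v hv
  have h1 := B.le_opNorm₂ v v
  rw [Real.norm_eq_abs, abs_le] at h1
  obtain ⟨h2, h3⟩ := h v hv
  exact ⟨fun h4 => h2 (by linarith), fun h4 => h3 (by linarith)⟩

/-- The filter `n → ∞`, `r ↓ 0`. -/
def smallScale : Filter (ℕ × ℝ) := atTop ×ˢ 𝓝[>] (0 : ℝ)

/-- Required for dominated convergence along this filter. -/
instance : smallScale.IsCountablyGenerated := by
  unfold smallScale
  infer_instance

lemma tendsto_fst_smallScale : Tendsto Prod.fst smallScale atTop := tendsto_fst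

lemma tendsto_snd_smallScale : Tendsto Prod.snd smallScale (𝓝 0) :=
  tendsto_snd.mono_right nhdsWithin_le_nhds

lemma eventually_pos_smallScale : ∀ᶠ z in smallScale, 0 < z.2 :=
  tendsto_snd.eventually self_mem_nhdsWithin

/-! ### Blow-up of the angular integral at the boundary point. -/

section Limit

variable {A : ℕ → Set V} {x ν e₀ : V} {νn en : ℕ → V} {B : V →L[ℝ] V →L[ℝ] ℝ}

/-- Near `x`, which side of the boundary a point lies on is decided by the quadratic
approximation. -/
lemma eventually_signedIndicator_eq
    (hpin : ∀ η > 0, ∃ δ > 0, ∀ᶠ n in atTop,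
      Pinched (A n) x (fun v => ⟪v, νn n⟫ + 1 / 2 * B v v) η δ)
    {v : ℕ × ℝ → V} {c : ℝ} (hc : c ≠ 0) (hv : ∀ᶠ z in smallScale, ‖v z‖ = z.2)
    (hlim : Tendsto (fun z : ℕ × ℝ => (⟪v z, νn z.1⟫ + 1 / 2 * B (v z) (v z)) / z.2 ^ 2)
      smallScale (𝓝 c)) :
    ∀ᶠ z in smallScale, signedIndicator (A z.1) (x + v z) = Real.sign c := by
  -- The quotient tends to `c`, so it eventually passes `c / 2`, exactly the pinching error allowed
  -- here.
  obtain ⟨δ, hδ, hev⟩ := hpin (|c| / 2) (by positivity)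
  have e1 := tendsto_fst_smallScale.eventually hev
  have e2 : ∀ᶠ z in smallScale, z.2 < δ := tendsto_snd_smallScale.eventually_lt_const hδ
  rcases lt_or_gt_of_ne hc with h | h
  · rw [abs_of_neg h] at e1
    have e3 := hlim.eventually_lt_const (show c < c / 2 by linarith)
    filter_upwards [e1, e2, e3, hv, eventually_pos_smallScale] with z h1 h2 h3 h4 h5
    rw [Real.sign_of_neg h]
    refine signedIndicator_of_mem ((h1 (v z) (by rwa [h4])).1 ?_)
    rw [div_lt_iff₀ (by positivity)] at h3
    rw [h4]
    linarith
  · rw [abs_of_pos h] at e1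
    have e3 := hlim.eventually_const_lt (show c / 2 < c by linarith)
    filter_upwards [e1, e2, e3, hv, eventually_pos_smallScale] with z h1 h2 h3 h4 h5
    rw [Real.sign_of_pos h]
    refine signedIndicator_of_notMem ((h1 (v z) (by rwa [h4])).2 ?_)
    rw [lt_div_iff₀ (by positivity)] at h3
    rw [h4]
    linarith

lemma tendsto_sin_mul_div (b : ℝ) :
    Tendsto (fun r : ℝ => Real.sin (r * b) / r) (𝓝[>] 0) (𝓝 b) := by
  have h1 : HasDerivAt (fun r : ℝ => Real.sin (r * b)) b 0 := by
    have h2 : HasDerivAt (fun r : ℝ => r * b) b 0 := by simpa using (hasDerivAt_id 0).mul_const b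
    simpa using h2.sin
  have h3 := (hasDerivAt_iff_tendsto_slope.1 h1).mono_left
    (nhdsWithin_mono 0 (fun r (hr : 0 < r) => (hr.ne' : r ≠ 0)))
  refine h3.congr fun r => ?_
  rw [slope_def_field]
  simp

/-- The two signs agree, with value `sign b`, when `|β| < |b|`, and cancel when `|β| > |b|`. -/
lemma integral_sign_add_sign (b : ℝ) :
    ∫ β : ℝ, (Real.sign (β + b) + Real.sign (-β + b)) / 2 = 2 * b := by
  have hae : (fun β : ℝ => (Real.sign (β + b) + Real.sign (-β + b)) / 2)
      =ᵐ[volume] (Ioo (-|b|) |b|).indicator fun _ => Real.sign b := by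
    filter_upwards [Measure.ae_ne volume b, Measure.ae_ne volume (-b)] with β h1 h2
    have h1' : -β + b ≠ 0 := fun h => h1 (by linarith)
    have h2' : β + b ≠ 0 := fun h => h2 (by linarith)
    by_cases hmem : β ∈ Ioo (-|b|) |b|
    · rw [indicator_of_mem hmem]
      rcases lt_trichotomy b 0 with hb | hb | hb
      · rw [abs_of_neg hb] at hmem
        rw [Real.sign_of_neg hb, Real.sign_of_neg (by linarith [hmem.2]),
          Real.sign_of_neg (by linarith [hmem.1])]
        norm_num
      · rw [hb, abs_zero] at hmem
        linarith [hmem.1, hmem.2]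
      · rw [abs_of_pos hb] at hmem
        rw [Real.sign_of_pos hb, Real.sign_of_pos (by linarith [hmem.1]),
          Real.sign_of_pos (by linarith [hmem.2])]
        norm_num
    · rw [indicator_of_notMem hmem]
      have hcase : |b| ≤ |β| := by
        by_contra! hlt
        exact hmem (abs_lt.1 hlt)
      have hprod : (β + b) * (-β + b) < 0 := by
        have h3 : (β + b) * (-β + b) = |b| ^ 2 - |β| ^ 2 := by rw [sq_abs, sq_abs]; ring
        have h4 : (β + b) * (-β + b) ≤ 0 := by
          rw [h3]
          have := pow_le_pow_left₀ (abs_nonneg b) hcase 2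
          linarith
        exact lt_of_le_of_ne h4 (mul_ne_zero h2' h1')
      rcases mul_neg_iff.1 hprod with ⟨h3, h4⟩ | ⟨h3, h4⟩
      · rw [Real.sign_of_pos h3, Real.sign_of_neg h4]; norm_num
      · rw [Real.sign_of_neg h3, Real.sign_of_pos h4]; norm_num
  rw [integral_congr_ae hae, integral_indicator measurableSet_Ioo, setIntegral_const,
    Measure.real, Real.volume_Ioo, ENNReal.toReal_ofReal (by linarith [abs_nonneg b]), smul_eq_mul]
  have : Real.sign b * |b| = b := by
    rcases lt_trichotomy b 0 with hb | hb | hb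
    · rw [Real.sign_of_neg hb, abs_of_neg hb]; ring
    · simp [hb]
    · rw [Real.sign_of_pos hb, abs_of_pos hb]; ring
  linear_combination 2 * this

/-- The angular integral after the change of variables `α = r β`. -/
def rescaledIntegrand (m : ℕ) (g : V → ℝ) (A : Set V) (x e ν : V) (r β : ℝ) : ℝ :=
  (Ioo (-(Real.pi / 2)) (Real.pi / 2)).indicator (fun a => Real.cos a ^ m *
    (symSign A x (r • planeDir e ν a) * g (planeDir e ν a))) (r * β)

lemma measurable_rescaledIntegrand {m : ℕ} {g : V → ℝ} (hg : ContinuousOn g (sphere 0 1))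
    {A : Set V} (hA : IsClosed A) (x : V) {e ν : V} (he : ‖e‖ = 1) (hν : ‖ν‖ = 1)
    (heν : ⟪e, ν⟫ = 0) (r : ℝ) : Measurable (rescaledIntegrand m g A x e ν r) := by
  have h0 : Measurable fun a : ℝ => Real.cos a ^ m := by fun_prop
  have hc : Continuous fun a : ℝ => r • planeDir e ν a := (continuous_planeDir e ν).const_smul r
  have h1 : Measurable fun a : ℝ => symSign A x (r • planeDir e ν a) * g (planeDir e ν a) :=
    ((measurable_symSign hA x).comp hc.measurable).mul
      (continuous_comp_planeDir hg he hν heν).measurable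
  have h2 : Measurable fun β : ℝ => r * β := by fun_prop
  have h3 : Measurable fun a : ℝ => Real.cos a ^ m *
      (symSign A x (r • planeDir e ν a) * g (planeDir e ν a)) := h0.mul h1
  have h4 := h3.indicator (measurableSet_Ioo (a := -(Real.pi / 2)) (b := Real.pi / 2))
  have h5 := h4.comp h2
  change Measurable fun β => rescaledIntegrand m g A x e ν r β
  simpa only [rescaledIntegrand, Function.comp_def] using h5

lemma integral_rescaledIntegrand (m : ℕ) (g : V → ℝ) (A : Set V) (x e ν : V) {r : ℝ}
    (hr : 0 < r) :
    ∫ β, rescaledIntegrand m g A x e ν r β = angularIntegral m g A x e ν r / r := by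
  unfold rescaledIntegrand angularIntegral
  rw [Measure.integral_comp_mul_left (fun a => (Ioo (-(Real.pi / 2)) (Real.pi / 2)).indicator
    (fun a => Real.cos a ^ m * (symSign A x (r • planeDir e ν a) * g (planeDir e ν a))) a),
    integral_indicator measurableSet_Ioo, integral_angleMeasure, abs_of_pos (inv_pos.2 hr),
    smul_eq_mul, inv_mul_eq_div]

/-- In the fan `|sin (r β)| ≤ C r`, and Jordan's inequality then confines `β` to an interval
independent of `r`: this is the domination for the blow-up. -/
lemma abs_rescaledIntegrand_le {m : ℕ} {g : V → ℝ} {A : Set V} {x e ν : V}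
    (he : ‖e‖ = 1) (hν : ‖ν‖ = 1) (heν : ⟪e, ν⟫ = 0) {C δ G : ℝ}
    (h : Pinched A x (fun v => ⟪v, ν⟫) C δ) (hG : ∀ θ ∈ sphere (0 : V) 1, |g θ| ≤ G)
    {r : ℝ} (hr : 0 < r) (hrδ : r < δ) (β : ℝ) :
    |rescaledIntegrand m g A x e ν r β|
      ≤ (Icc (-(Real.pi / 2 * C)) (Real.pi / 2 * C)).indicator (fun _ => G) β := by
  have hG0 : 0 ≤ G := (abs_nonneg _).trans (hG _ (planeDir_mem_sphere he hν heν 0))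
  have hpi := Real.pi_pos
  unfold rescaledIntegrand
  by_cases h1 : r * β ∈ Ioo (-(Real.pi / 2)) (Real.pi / 2)
  · rw [indicator_of_mem h1]
    by_cases h2 : (r, r * β) ∈ fanSet C δ
    · have h3 : |Real.sin (r * β)| ≤ C * r := by
        rcases h2 with h4 | h4
        · exact absurd h4 (not_le.2 hrδ)
        · exact h4
      have h5 := Real.mul_abs_le_abs_sin (x := r * β) (abs_le.2 ⟨h1.1.le, h1.2.le⟩)
      have h6 : |β| ≤ Real.pi / 2 * C := by
        rw [abs_mul, abs_of_pos hr] at h5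
        have h7 : 2 / Real.pi * |β| * r ≤ C * r := by linarith
        have h8 := le_of_mul_le_mul_right h7 hr
        have h9 : |β| = Real.pi / 2 * (2 / Real.pi * |β|) := by field_simp
        rw [h9]
        exact mul_le_mul_of_nonneg_left h8 (by positivity)
      rw [indicator_of_mem (show β ∈ Icc _ _ from abs_le.1 h6), abs_mul, abs_mul, abs_pow]
      calc _ ≤ 1 * (1 * G) := by
            gcongr
            · exact pow_le_one₀ (abs_nonneg _) (Real.abs_cos_le_one _)
            · exact abs_symSign_le _ _ _
            · exact hG _ (planeDir_mem_sphere he hν heν _)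
        _ = G := by ring
    · have := symSign_eq_zero h he hν heν (q := (r, r * β)) hr h2
      simp only at this
      rw [this]
      simp only [zero_mul, mul_zero, abs_zero]
      exact indicator_nonneg (fun _ _ => hG0) _
  · rw [indicator_of_notMem h1, abs_zero]
    exact indicator_nonneg (fun _ _ => hG0) _

/-- At angle `r β` the height is `r sin (r β)`, so the quadratic approximation divided by `r²` tends
to `β + B e₀ e₀ / 2`, and at the antipode to `-β + B e₀ e₀ / 2`. Both must be nonzero for the sides
to be determined. -/
lemma tendsto_rescaledIntegrand {m : ℕ} {g : ℕ → V → ℝ} {g₀ : V → ℝ}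
    (hg : TendstoUniformlyOn g g₀ atTop (sphere 0 1)) (hg₀ : ContinuousOn g₀ (sphere 0 1))
    (hpin : ∀ η > 0, ∃ δ > 0, ∀ᶠ n in atTop,
      Pinched (A n) x (fun v => ⟪v, νn n⟫ + 1 / 2 * B v v) η δ)
    (hν : Tendsto νn atTop (𝓝 ν)) (he : Tendsto en atTop (𝓝 e₀)) (he₀ : ‖e₀‖ = 1)
    (hν1 : ∀ n, ‖νn n‖ = 1) (he1 : ∀ n, ‖en n‖ = 1) (heν : ∀ n, ⟪en n, νn n⟫ = 0) {β : ℝ}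
    (h1 : β + 1 / 2 * B e₀ e₀ ≠ 0) (h2 : -β + 1 / 2 * B e₀ e₀ ≠ 0) :
    Tendsto (fun z : ℕ × ℝ => rescaledIntegrand m (g z.1) (A z.1) x (en z.1) (νn z.1) z.2 β)
      smallScale (𝓝 ((Real.sign (β + 1 / 2 * B e₀ e₀) + Real.sign (-β + 1 / 2 * B e₀ e₀)) / 2
        * g₀ e₀)) := by
  have hrβ : Tendsto (fun z : ℕ × ℝ => z.2 * β) smallScale (𝓝 0) := by
    simpa using tendsto_snd_smallScale.mul_const β
  have hcos : Tendsto (fun z : ℕ × ℝ => Real.cos (z.2 * β)) smallScale (𝓝 1) := by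
    simpa [Function.comp_def] using (Real.continuous_cos.tendsto 0).comp hrβ
  have hsin : Tendsto (fun z : ℕ × ℝ => Real.sin (z.2 * β)) smallScale (𝓝 0) := by
    simpa [Function.comp_def] using (Real.continuous_sin.tendsto 0).comp hrβ
  have hdir : Tendsto (fun z : ℕ × ℝ => planeDir (en z.1) (νn z.1) (z.2 * β)) smallScale
      (𝓝 e₀) := by
    unfold planeDir
    simpa using (hcos.smul (he.comp tendsto_fst_smallScale)).add
      (hsin.smul (hν.comp tendsto_fst_smallScale))
  have hgl : Tendsto (fun z : ℕ × ℝ => g z.1 (planeDir (en z.1) (νn z.1) (z.2 * β))) smallScale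
      (𝓝 (g₀ e₀)) := by
    have hmem : ∀ z : ℕ × ℝ, planeDir (en z.1) (νn z.1) (z.2 * β) ∈ sphere (0 : V) 1 :=
      fun z => planeDir_mem_sphere (he1 _) (hν1 _) (heν _) _
    have h3 : Tendsto (fun z : ℕ × ℝ => g₀ (planeDir (en z.1) (νn z.1) (z.2 * β))) smallScale
        (𝓝 (g₀ e₀)) :=
      (hg₀ e₀ (mem_sphere_zero_iff_norm.2 he₀)).tendsto.comp
        (tendsto_nhdsWithin_iff.2 ⟨hdir, Eventually.of_forall hmem⟩)
    rw [Metric.tendsto_nhds] at h3 ⊢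
    intro η hη
    filter_upwards [h3 (η / 2) (half_pos hη), tendsto_fst_smallScale.eventually
      (Metric.tendstoUniformlyOn_iff.1 hg (η / 2) (half_pos hη))] with z h4 h5
    have h6 := h5 _ (hmem z)
    rw [dist_comm] at h6
    calc _ ≤ _ + _ := dist_triangle _ (g₀ (planeDir (en z.1) (νn z.1) (z.2 * β))) _
      _ < η := by linarith
  have hs := (tendsto_sin_mul_div β).comp (tendsto_snd (f := (atTop : Filter ℕ)))
  have hBc : Continuous fun v : V => 1 / 2 * B v v := by fun_prop
  have hBl : Tendsto (fun z : ℕ × ℝ => 1 / 2 * B (planeDir (en z.1) (νn z.1) (z.2 * β))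
      (planeDir (en z.1) (νn z.1) (z.2 * β))) smallScale (𝓝 (1 / 2 * B e₀ e₀)) :=
    (hBc.tendsto e₀).comp hdir
  have hnorm : ∀ᶠ z in smallScale, ‖z.2 • planeDir (en z.1) (νn z.1) (z.2 * β)‖ = z.2 := by
    filter_upwards [eventually_pos_smallScale] with z hz
    exact norm_smul_planeDir (he1 _) (hν1 _) (heν _) hz.le _
  have s1 := eventually_signedIndicator_eq hpin
    (v := fun z => z.2 • planeDir (en z.1) (νn z.1) (z.2 * β)) h1 hnorm (by
      refine (hs.add hBl).congr' ?_
      filter_upwards [eventually_pos_smallScale] with z hz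
      rw [real_inner_smul_left, inner_planeDir (hν1 _) (heν _)]
      simp only [map_smul, smul_apply, smul_eq_mul, Function.comp_apply]
      field_simp)
  have s2 := eventually_signedIndicator_eq hpin
    (v := fun z => -(z.2 • planeDir (en z.1) (νn z.1) (z.2 * β))) h2
    (by simpa only [norm_neg] using hnorm) (by
      refine (hs.neg.add hBl).congr' ?_
      filter_upwards [eventually_pos_smallScale] with z hz
      rw [inner_neg_left, real_inner_smul_left, inner_planeDir (hν1 _) (heν _)]
      simp only [map_neg, neg_apply, map_smul, smul_apply, smul_eq_mul,
        Function.comp_apply]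
      field_simp)
  have hmain := (hcos.pow m).mul (hgl.const_mul
    ((Real.sign (β + 1 / 2 * B e₀ e₀) + Real.sign (-β + 1 / 2 * B e₀ e₀)) / 2))
  rw [one_pow, one_mul] at hmain
  refine hmain.congr' ?_
  have hpi := Real.pi_pos
  filter_upwards [s1, s2, hrβ.eventually (Ioo_mem_nhds (a := -(Real.pi / 2)) (b := Real.pi / 2)
    (by linarith) (by linarith))] with z h3 h4 h5
  rw [rescaledIntegrand, indicator_of_mem (show z.2 * β ∈ Ioo _ _ from h5), symSign, sub_eq_add_neg, h3, h4]

lemma exists_forall_sphere_abs_le {g₀ : V → ℝ} (hg₀ : ContinuousOn g₀ (sphere 0 1)) :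
    ∃ G, ∀ θ ∈ sphere (0 : V) 1, |g₀ θ| ≤ G :=
  (isCompact_sphere (0 : V) 1).exists_bound_of_continuousOn hg₀

lemma eventually_forall_sphere_abs_le {g : ℕ → V → ℝ} {g₀ : V → ℝ}
    (hg : TendstoUniformlyOn g g₀ atTop (sphere 0 1)) {G : ℝ}
    (hG : ∀ θ ∈ sphere (0 : V) 1, |g₀ θ| ≤ G) :
    ∀ᶠ n in atTop, ∀ θ ∈ sphere (0 : V) 1, |g n θ| ≤ G + 1 := by
  filter_upwards [Metric.tendstoUniformlyOn_iff.1 hg 1 one_pos] with n hn θ hθ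
  have h1 := hn θ hθ
  rw [dist_comm, Real.dist_eq] at h1
  have h2 := abs_sub_abs_le_abs_sub (g n θ) (g₀ θ)
  linarith [hG θ hθ]

/-- Dominated convergence in `β`. The limit is joint in `n` and `r`, because the scale on which the
kernels concentrate varies with `n`. -/
lemma tendsto_angularIntegral_div {m : ℕ} {g : ℕ → V → ℝ} {g₀ : V → ℝ}
    (hgn : ∀ n, ContinuousOn (g n) (sphere 0 1))
    (hg : TendstoUniformlyOn g g₀ atTop (sphere 0 1)) (hg₀ : ContinuousOn g₀ (sphere 0 1))
    (hA : ∀ n, IsClosed (A n))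
    (hpin : ∀ η > 0, ∃ δ > 0, ∀ᶠ n in atTop,
      Pinched (A n) x (fun v => ⟪v, νn n⟫ + 1 / 2 * B v v) η δ)
    (hν : Tendsto νn atTop (𝓝 ν)) (he : Tendsto en atTop (𝓝 e₀)) (he₀ : ‖e₀‖ = 1)
    (hν1 : ∀ n, ‖νn n‖ = 1) (he1 : ∀ n, ‖en n‖ = 1) (heν : ∀ n, ⟪en n, νn n⟫ = 0) :
    Tendsto (fun z : ℕ × ℝ => angularIntegral m (g z.1) (A z.1) x (en z.1) (νn z.1) z.2 / z.2)
      smallScale (𝓝 (g₀ e₀ * B e₀ e₀)) := by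
  obtain ⟨G, hG⟩ := exists_forall_sphere_abs_le hg₀
  obtain ⟨δ, hδ, hev⟩ := hpin 1 one_pos
  have hlim : ∫ β : ℝ, (Real.sign (β + 1 / 2 * B e₀ e₀) + Real.sign (-β + 1 / 2 * B e₀ e₀)) / 2
        * g₀ e₀ = g₀ e₀ * B e₀ e₀ := by
    rw [integral_mul_const, integral_sign_add_sign]; ring
  rw [← hlim]
  refine (tendsto_integral_filter_of_dominated_convergence (μ := volume) (l := smallScale)
    (F := fun z β => rescaledIntegrand m (g z.1) (A z.1) x (en z.1) (νn z.1) z.2 β)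
    ((Icc (-(Real.pi / 2 * (1 + ‖B‖ / 2))) (Real.pi / 2 * (1 + ‖B‖ / 2))).indicator
      fun _ => G + 1) (Eventually.of_forall fun z => ?_) ?_ ?_ ?_).congr' ?_
  · exact (measurable_rescaledIntegrand (hgn z.1) (hA z.1) x (he1 _) (hν1 _) (heν _)
      z.2).aestronglyMeasurable
  · filter_upwards [tendsto_fst_smallScale.eventually hev, eventually_pos_smallScale,
      tendsto_snd_smallScale.eventually_lt_const hδ,
      tendsto_fst_smallScale.eventually (eventually_forall_sphere_abs_le hg hG)] with z h1 h2 h3 h4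
    exact ae_of_all _ fun β => abs_rescaledIntegrand_le (he1 _) (hν1 _) (heν _) h1.of_hessian h4
      h2 h3 β
  · exact (integrable_indicator_iff measurableSet_Icc).2 (integrableOn_const (by simp))
  · filter_upwards [Measure.ae_ne volume (1 / 2 * B e₀ e₀),
      Measure.ae_ne volume (-(1 / 2 * B e₀ e₀))] with β h1 h2
    exact tendsto_rescaledIntegrand hg hg₀ hpin hν he he₀ hν1 he1 heν
      (fun h => h2 (by linarith)) (fun h => h1 (by linarith))
  · filter_upwards [eventually_pos_smallScale] with z hz
    exact integral_rescaledIntegrand _ _ _ _ _ _ hz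

end Limit

end AngularLimit

/-! ### Concentration at the origin -/

section Concentration

variable {m : ℕ}

/-- The mass `∫ (1 ∧ r) p(r) r ^ (m + 1) dr`. -/
def radialMass (m : ℕ) (p : ℝ → ℝ) : ℝ := ∫ r, min 1 r * p r ∂radialMeasure (m + 1)

lemma radialMass_nonneg {p : ℝ → ℝ} (hp : IsMajorant (m + 1) p) : 0 ≤ radialMass m p := by
  refine integral_nonneg_of_ae ?_
  filter_upwards [ae_radialMeasure_pos (m + 1)] with r hr
  exact mul_nonneg (le_min zero_le_one hr.le) (hp.nonneg r)

/-- Mass concentrating at the origin picks out the limit at the origin. -/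
lemma tendsto_integral_of_concentration {p I : ℕ → ℝ → ℝ} {D a : ℝ}
    (hp : ∀ n, IsMajorant (m + 1) (p n)) (hpos : ∀ᶠ n in atTop, 0 < radialMass m (p n))
    (hconc : ∀ R > 0, Tendsto (fun n => (radialMass m (p n))⁻¹ *
      ∫ r, (Ici R).indicator (fun r => min 1 r * p n r) r ∂radialMeasure (m + 1)) atTop (𝓝 0))
    (hI : ∀ᶠ n in atTop, Integrable (fun r => p n r * I n r) (radialMeasure (m + 1)))
    (hD : ∀ᶠ n in atTop, ∀ r > 0, |I n r| ≤ D * min 1 r)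
    (hlim : Tendsto (fun z : ℕ × ℝ => I z.1 z.2 / z.2) smallScale (𝓝 a)) :
    Tendsto (fun n => (radialMass m (p n))⁻¹ * ∫ r, p n r * I n r ∂radialMeasure (m + 1)) atTop
      (𝓝 a) := by
  rw [Metric.tendsto_nhds]
  intro η hη
  have h1 := hlim.eventually (Metric.ball_mem_nhds a (half_pos hη))
  rw [smallScale] at h1
  obtain ⟨P, hP, Q, hQ, hPQ⟩ := eventually_prod_iff.1 h1
  obtain ⟨δ₀, hδ₀, hδQ⟩ := mem_nhdsGT_iff_exists_Ioo_subset.1 hQ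
  have hδ₀ : 0 < δ₀ := hδ₀
  -- Below `δ ≤ 1` the weight `1 ∧ r` is `r`, and `I n r / r` is within `η / 2` of `a`; beyond `δ`
  -- the mass fraction tends to zero.
  set δ := min 1 δ₀ with hδ
  have hδ0 : 0 < δ := by positivity
  have htail := (hconc δ hδ0).const_mul (D + |a|)
  rw [mul_zero] at htail
  filter_upwards [hP, hpos, hI, hD, htail.eventually_lt_const (half_pos hη)] with n hPn hM hIn hDn ht
  set M := radialMass m (p n)
  set T := ∫ r, (Ici δ).indicator (fun r => min 1 r * p n r) r ∂radialMeasure (m + 1)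
  have hind : Integrable ((Ici δ).indicator fun r => min 1 r * p n r) (radialMeasure (m + 1)) :=
    (hp n).integrable.indicator measurableSet_Ici
  have hbound : ∀ᵐ r ∂radialMeasure (m + 1), ‖p n r * I n r - a * (min 1 r * p n r)‖
      ≤ η / 2 * (min 1 r * p n r)
        + (D + |a|) * (Ici δ).indicator (fun r => min 1 r * p n r) r := by
    filter_upwards [ae_radialMeasure_pos (m + 1)] with r hr
    have hp0 := (hp n).nonneg r
    have hmin : 0 < min 1 r := by positivity
    rw [Real.norm_eq_abs]
    by_cases hrδ : r ∈ Ici δ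
    · rw [indicator_of_mem hrδ]
      calc _ ≤ |p n r * I n r| + |a * (min 1 r * p n r)| := abs_sub _ _
        _ = p n r * |I n r| + |a| * (min 1 r * p n r) := by
            rw [abs_mul, abs_mul, abs_of_nonneg hp0, abs_of_nonneg (mul_nonneg hmin.le hp0)]
        _ ≤ p n r * (D * min 1 r) + |a| * (min 1 r * p n r) := by
            gcongr
            exact hDn r hr
        _ = (D + |a|) * (min 1 r * p n r) := by ring
        _ ≤ _ := le_add_of_nonneg_left (by positivity)
    · rw [indicator_of_notMem hrδ, mul_zero, add_zero]
      have hrlt : r < δ := not_le.1 hrδ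
      have hmin' : min 1 r = r := min_eq_right (hrlt.le.trans (min_le_left _ _))
      have h2 := hPQ hPn (hδQ ⟨hr, hrlt.trans_le (min_le_right _ _)⟩)
      have h2 : |I n r / r - a| < η / 2 := h2
      rw [hmin']
      have h3 : p n r * I n r - a * (r * p n r) = (r * p n r) * (I n r / r - a) := by
        field_simp
      rw [h3, abs_mul, abs_of_nonneg (mul_nonneg hr.le hp0), mul_comm (η / 2)]
      gcongr
  have h4 := norm_integral_le_of_norm_le
    (((hp n).integrable.const_mul (η / 2)).add (hind.const_mul (D + |a|))) hbound
  rw [integral_sub hIn ((hp n).integrable.const_mul a), integral_const_mul] at h4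
  simp only [Pi.add_apply] at h4
  rw [integral_add ((hp n).integrable.const_mul (η / 2)) (hind.const_mul (D + |a|)),
    integral_const_mul, integral_const_mul] at h4
  change ‖(∫ r, p n r * I n r ∂radialMeasure (m + 1)) - a * M‖ ≤ η / 2 * M + (D + |a|) * T at h4
  rw [Real.dist_eq]
  have h5 : M⁻¹ * (∫ r, p n r * I n r ∂radialMeasure (m + 1)) - a
      = M⁻¹ * ((∫ r, p n r * I n r ∂radialMeasure (m + 1)) - a * M) := by
    field_simp
  rw [h5, abs_mul, abs_of_pos (inv_pos.2 hM)]
  calc _ ≤ M⁻¹ * (η / 2 * M + (D + |a|) * T) := by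
        gcongr
        exact h4
    _ = η / 2 + (D + |a|) * (M⁻¹ * T) := by field_simp
    _ < η := by linarith

end Concentration

/-! ### Kernels in polar coordinates -/

section ProductKernels

lemma IsMajorant.add {n : ℕ} {p p' : ℝ → ℝ} (hp : IsMajorant n p) (hp' : IsMajorant n p') :
    IsMajorant n fun r => p r + p' r where
  measurable := hp.measurable.add hp'.measurable
  nonneg r := add_nonneg (hp.nonneg r) (hp'.nonneg r)
  integrable := by
    simp only [mul_add]
    exact hp.integrable.add hp'.integrable

lemma IsMajorant.const_mul {n : ℕ} {p : ℝ → ℝ} (hp : IsMajorant n p) {c : ℝ} (hc : 0 ≤ c) :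
    IsMajorant n fun r => c * p r where
  measurable := hp.measurable.const_mul c
  nonneg r := mul_nonneg hc (hp.nonneg r)
  integrable := by simpa only [mul_left_comm] using hp.integrable.const_mul c

lemma integrable_radialMeasure_iff (n : ℕ) (f : ℝ → ℝ) :
    Integrable f (radialMeasure n) ↔ IntegrableOn (fun r => r ^ n * f r) (Ioi 0) := by
  rw [radialMeasure, integrable_withDensity_iff_integrable_smul' (by fun_prop) (by simp)]
  refine integrableOn_congr_fun (fun r hr => ?_) measurableSet_Ioi
  have hr : 0 < r := hr
  simp [ENNReal.toReal_ofReal (pow_nonneg hr.le n)]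

/-- A radial profile is a function of the norm. -/
lemma IsRadialProfile.exists_isMajorant {m : ℕ} {j : EuclideanSpace ℝ (Fin (m + 2)) → ℝ}
    (hj : IsRadialProfile j) : ∃ p, IsMajorant (m + 1) p ∧ ∀ w, w ≠ 0 → j w = p ‖w‖ := by
  set u : EuclideanSpace ℝ (Fin (m + 2)) := EuclideanSpace.single 0 1 with hu
  have hu1 : ‖u‖ = 1 := by simp [hu]
  have hnorm : ∀ r : ℝ, 0 < r → ‖r • u‖ = r := fun r hr => by
    rw [norm_smul, hu1, mul_one, Real.norm_of_nonneg hr.le]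
  have hne : ∀ r : ℝ, 0 < r → r • u ≠ 0 := fun r hr => by
    rw [← norm_pos_iff, hnorm r hr]; exact hr
  let p : ℝ → ℝ := (Ioi 0).indicator fun r => j (r • u)
  have hp_pos : ∀ r, 0 < r → p r = j (r • u) := fun r hr => indicator_of_mem (mem_Ioi.2 hr) _
  have hp0 : ∀ r, 0 ≤ p r := fun r => indicator_nonneg (fun r hr => hj.nonneg _ (hne r hr)) r
  have hjp : ∀ w, w ≠ 0 → j w = p ‖w‖ := by
    intro w hw
    have hw' := norm_pos_iff.2 hw
    rw [hp_pos _ hw']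
    exact le_antisymm (hj.antitone _ _ (hne _ hw') (hnorm _ hw').le)
      (hj.antitone _ _ hw (hnorm _ hw').ge)
  refine ⟨p, ⟨?_, hp0, ?_⟩, hjp⟩
  -- `p` is nonincreasing on the positive half-line and zero elsewhere, so its superlevel sets at
  -- heights `c ≥ 0` are intervals.
  · refine measurable_of_Ioi fun c => ?_
    by_cases hc : c < 0
    · have : p ⁻¹' Ioi c = univ := by
        ext r; simpa using hc.trans_le (hp0 r)
      rw [this]; exact MeasurableSet.univ
    · push Not at hc
      refine OrdConnected.measurableSet ⟨fun r₁ h₁ r₂ h₂ s hs => ?_⟩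
      have h1 : 0 < r₁ := by
        by_contra hcon
        have : p r₁ = 0 := indicator_of_notMem hcon _
        have h₁ : c < p r₁ := h₁
        linarith
      have hs0 : 0 < s := h1.trans_le hs.1
      have h₂ : c < p r₂ := h₂
      refine lt_of_lt_of_le h₂ ?_
      rw [hp_pos _ hs0, hp_pos _ (hs0.trans_le hs.2)]
      refine hj.antitone _ _ (hne _ hs0) ?_
      rw [hnorm _ hs0, hnorm _ (hs0.trans_le hs.2)]
      exact hs.2
  · rw [integrable_radialMeasure_iff]
    have h1 := hj.integrable
    have h2 : (fun w : EuclideanSpace ℝ (Fin (m + 2)) => min 1 ‖w‖ * j w)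
        = fun w => (fun r => min 1 r * p r) ‖w‖ := by
      ext w
      by_cases hw : w = 0
      · simp [hw]
      · rw [hjp w hw]
    rw [h2] at h1
    simpa using (integrable_fun_norm_addHaar volume (f := fun r => min 1 r * p r)).1 h1

variable {V : Type*} [NormedAddCommGroup V] [InnerProductSpace ℝ V]

/-- The function `g (w / |w|)`, extended by zero to the origin. -/
def angularPart (g : V → ℝ) (w : V) : ℝ := ({0}ᶜ : Set V).indicator (fun w => g (‖w‖⁻¹ • w)) w

/-- The kernel `g (w / |w|) p (|w|)`, extended by zero to the origin. -/
def productKernel (g : V → ℝ) (p : ℝ → ℝ) (w : V) : ℝ := angularPart g w * p ‖w‖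

lemma inv_norm_smul_mem_sphere {w : V} (hw : w ≠ 0) : ‖w‖⁻¹ • w ∈ sphere (0 : V) 1 := by
  rw [mem_sphere_zero_iff_norm, norm_smul, norm_inv, norm_norm, inv_mul_cancel₀ (by simpa using hw)]

lemma angularPart_of_ne {g : V → ℝ} {w : V} (hw : w ≠ 0) : angularPart g w = g (‖w‖⁻¹ • w) :=
  indicator_of_mem (by simpa using hw) _

lemma angularPart_zero (g : V → ℝ) : angularPart g 0 = 0 := by simp [angularPart]

lemma angularPart_smul {g : V → ℝ} {θ : V} (hθ : ‖θ‖ = 1) {r : ℝ} (hr : 0 < r) :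
    angularPart g (r • θ) = g θ := by
  have hn : ‖r • θ‖ = r := by rw [norm_smul, hθ, mul_one, Real.norm_of_nonneg hr.le]
  rw [angularPart_of_ne (by rw [← norm_pos_iff, hn]; exact hr), hn, smul_smul,
    inv_mul_cancel₀ hr.ne', one_smul]

lemma abs_angularPart_le {g : V → ℝ} {G : ℝ} (hG : ∀ θ ∈ sphere (0 : V) 1, |g θ| ≤ G) {w : V}
    (hw : w ≠ 0) : |angularPart g w| ≤ G := by
  rw [angularPart_of_ne hw]
  exact hG _ (inv_norm_smul_mem_sphere hw)

lemma abs_productKernel_le {g : V → ℝ} {p : ℝ → ℝ} {G : ℝ} (hp : ∀ r, 0 ≤ p r)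
    (hG : ∀ θ ∈ sphere (0 : V) 1, |g θ| ≤ G) {w : V} (hw : w ≠ 0) :
    |productKernel g p w| ≤ G * p ‖w‖ := by
  rw [productKernel, abs_mul, abs_of_nonneg (hp _)]
  exact mul_le_mul_of_nonneg_right (abs_angularPart_le hG hw) (hp _)

lemma productKernel_neg {g : V → ℝ} (hg : ∀ θ ∈ sphere (0 : V) 1, g (-θ) = g θ) (p : ℝ → ℝ)
    (w : V) : productKernel g p (-w) = productKernel g p w := by
  unfold productKernel
  rw [norm_neg]
  congr 1
  by_cases hw : w = 0
  · simp [hw]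
  · rw [angularPart_of_ne hw, angularPart_of_ne (neg_ne_zero.2 hw), norm_neg, smul_neg,
      hg _ (inv_norm_smul_mem_sphere hw)]

variable [FiniteDimensional ℝ V] [MeasurableSpace V] [BorelSpace V]

open Classical in
lemma measurable_angularPart {g : V → ℝ} (hg : ContinuousOn g (sphere 0 1)) :
    Measurable (angularPart g) := by
  have h1 : ContinuousOn (fun w : V => g (‖w‖⁻¹ • w)) {0}ᶜ := by
    refine hg.comp ?_ fun w hw => inv_norm_smul_mem_sphere hw
    exact (continuousOn_id.norm.inv₀ fun w hw => by simpa using hw).smul continuousOn_id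
  have h2 := h1.measurable_piecewise (g := fun _ => (0 : ℝ)) continuousOn_const
    (measurableSet_singleton (0 : V)).compl
  convert h2 using 1
  ext w
  simp [angularPart, indicator, piecewise]

lemma measurable_productKernel {g : V → ℝ} (hg : ContinuousOn g (sphere 0 1)) {p : ℝ → ℝ}
    (hp : Measurable p) : Measurable (productKernel g p) :=
  (measurable_angularPart hg).mul (hp.comp measurable_norm)

variable {m : ℕ}

lemma integral_angularPart_mul (hV : Module.finrank ℝ V = m + 2) {g : V → ℝ}
    (hg : ContinuousOn g (sphere 0 1)) {F : ℝ → ℝ} (hF : Measurable F) :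
    ∫ w, angularPart g w * F ‖w‖
      = (∫ θ : sphere (0 : V) 1, g θ ∂(volume : Measure V).toSphere)
        * ∫ r, F r ∂radialMeasure (m + 1) := by
  have : Nontrivial V := Module.nontrivial_of_finrank_pos (R := ℝ) (by omega)
  have hmp := measurePreserving_polar (V := V)
  rw [hV, show m + 2 - 1 = m + 1 by omega] at hmp
  have hm : Measurable fun w => angularPart g w * F ‖w‖ :=
    (measurable_angularPart hg).mul (hF.comp measurable_norm)
  rw [← integral_prod_mul]
  conv_lhs => rw [← hmp.map_eq, integral_map hmp.measurable.aemeasurable hm.aestronglyMeasurable]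
  refine integral_congr_ae ?_
  have hae : ∀ᵐ z ∂(volume : Measure V).toSphere.prod (radialMeasure (m + 1)), 0 < z.2 :=
    Measure.quasiMeasurePreserving_snd.ae (ae_radialMeasure_pos (m + 1))
  filter_upwards [hae] with z hz
  have h1 : ‖(z.1 : V)‖ = 1 := by simp
  rw [angularPart_smul h1 hz, norm_smul, h1, mul_one, Real.norm_of_nonneg hz.le]

lemma integrable_angularPart_mul (hV : Module.finrank ℝ V = m + 2) {g : V → ℝ}
    (hg : ContinuousOn g (sphere 0 1)) {F : ℝ → ℝ} (hF : Measurable F)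
    (hFi : Integrable F (radialMeasure (m + 1))) :
    Integrable fun w => angularPart g w * F ‖w‖ := by
  have : Nontrivial V := Module.nontrivial_of_finrank_pos (R := ℝ) (by omega)
  have hmp := measurePreserving_polar (V := V)
  rw [hV, show m + 2 - 1 = m + 1 by omega] at hmp
  have hm : Measurable fun w => angularPart g w * F ‖w‖ :=
    (measurable_angularPart hg).mul (hF.comp measurable_norm)
  rw [← hmp.integrable_comp hm.aestronglyMeasurable]
  obtain ⟨G, hG⟩ := exists_forall_sphere_abs_le hg
  refine ((hFi.comp_snd (volume : Measure V).toSphere).norm.const_mul G).mono'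
    (hm.comp hmp.measurable).aestronglyMeasurable ?_
  have hae : ∀ᵐ z ∂(volume : Measure V).toSphere.prod (radialMeasure (m + 1)), 0 < z.2 :=
    Measure.quasiMeasurePreserving_snd.ae (ae_radialMeasure_pos (m + 1))
  filter_upwards [hae] with z hz
  have h1 : ‖(z.1 : V)‖ = 1 := by simp
  simp only [Function.comp_apply]
  rw [angularPart_smul h1 hz, norm_smul, h1, mul_one, Real.norm_of_nonneg hz.le, norm_mul]
  exact mul_le_mul_of_nonneg_right (hG _ z.1.2) (norm_nonneg _)

/-- Fubini in polar coordinates: the radial factor is constant on each arc. -/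
lemma fanIntegral_productKernel {g : V → ℝ} (hg : ContinuousOn g (sphere 0 1)) {p : ℝ → ℝ}
    (hp : IsMajorant (m + 1) p) {A : Set V} (hA : IsClosed A) {x e ν : V}
    (he : ‖e‖ = 1) (hν : ‖ν‖ = 1) (heν : ⟪e, ν⟫ = 0) {C δ : ℝ} (hC : 0 ≤ C) (hδ : 0 < δ)
    (h : Pinched A x (fun v => ⟪v, ν⟫) C δ) :
    Integrable (fun r => p r * angularIntegral m g A x e ν r) (radialMeasure (m + 1)) ∧
      fanIntegral m (productKernel g p) A x e ν 0
        = ∫ r, p r * angularIntegral m g A x e ν r ∂radialMeasure (m + 1) := by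
  obtain ⟨G, hG⟩ := exists_forall_sphere_abs_le hg
  have hG0 : 0 ≤ G := (abs_nonneg _).trans (hG e (mem_sphere_zero_iff_norm.2 he))
  have h1 := (integrable_truncKernel_and_abs_fanIntegral_le (x := x)
    (measurable_productKernel hg hp.measurable) hA
    (fun w hw => abs_productKernel_le hp.nonneg hG hw) (hp.const_mul hG0) hC hδ h he hν heν 0).1
  have h2 : ∀ r > 0, ∫ a, truncKernel (productKernel g p) A x 0 (r • planeDir e ν a)
      ∂angleMeasure m = p r * angularIntegral m g A x e ν r := by
    intro r hr
    unfold angularIntegral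
    rw [← integral_const_mul]
    refine integral_congr_ae (ae_of_all _ fun a => ?_)
    simp only
    rw [truncKernel, indicator_of_mem (by simp), productKernel,
      angularPart_smul (norm_planeDir he hν heν a) hr, norm_smul_planeDir he hν heν hr.le]
    ring
  have h3 : (fun r => ∫ a, truncKernel (productKernel g p) A x 0 (r • planeDir e ν a)
      ∂angleMeasure m) =ᵐ[radialMeasure (m + 1)] fun r => p r * angularIntegral m g A x e ν r := by
    filter_upwards [ae_radialMeasure_pos (m + 1)] with r hr using h2 r hr
  refine ⟨h1.integral_prod_left.congr h3, ?_⟩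
  rw [fanIntegral, integral_prod _ h1]
  exact integral_congr_ae h3

lemma truncKernel_add (k k' : V → ℝ) (A : Set V) (x : V) (R : ℝ) (w : V) :
    truncKernel (fun w => k w + k' w) A x R w = truncKernel k A x R w + truncKernel k' A x R w := by
  unfold truncKernel
  by_cases h : R ≤ ‖w‖
  · rw [indicator_of_mem (by exact h), indicator_of_mem (by exact h),
      indicator_of_mem (by exact h), mul_add]
  · rw [indicator_of_notMem (by exact h), indicator_of_notMem (by exact h),
      indicator_of_notMem (by exact h), add_zero]

end ProductKernels

/-! ### The limit of the directional curvatures -/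

section DirectionalLimit

variable {V : Type*} [NormedAddCommGroup V] [InnerProductSpace ℝ V] [FiniteDimensional ℝ V]
  [MeasurableSpace V] [BorelSpace V]

/-- Kernels `g n (w / |w|) p n (|w|) + ψ n w` with mass concentrating at the origin, where `g n`
converges uniformly and `ψ n` is negligible. -/
structure IsConcentrating (m : ℕ) (g : ℕ → V → ℝ) (g₀ : V → ℝ) (p pbar : ℕ → ℝ → ℝ)
    (ψ : ℕ → V → ℝ) : Prop where
  majorant : ∀ n, IsMajorant (m + 1) (p n)
  majorant_bar : ∀ n, IsMajorant (m + 1) (pbar n)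
  continuousOn : ∀ n, ContinuousOn (g n) (sphere 0 1)
  tendsto : TendstoUniformlyOn g g₀ atTop (sphere 0 1)
  continuousOn_lim : ContinuousOn g₀ (sphere 0 1)
  mass_pos : ∀ n, 0 < radialMass m (p n)
  concentration : ∀ R > 0, Tendsto (fun n => (radialMass m (p n))⁻¹ *
      ∫ r, (Ici R).indicator (fun r => min 1 r * p n r) r ∂radialMeasure (m + 1)) atTop (𝓝 0)
  measurable : ∀ n, Measurable (ψ n)
  abs_le : ∀ n w, w ≠ 0 → |ψ n w| ≤ pbar n ‖w‖
  small : Tendsto (fun n => (radialMass m (p n))⁻¹ * radialMass m (pbar n)) atTop (𝓝 0)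

variable {m : ℕ} {g : ℕ → V → ℝ} {g₀ : V → ℝ} {p pbar : ℕ → ℝ → ℝ} {ψ : ℕ → V → ℝ}
  {A : ℕ → Set V} {x ν e₀ : V} {νn en : ℕ → V} {B : V →L[ℝ] V →L[ℝ] ℝ}

lemma IsConcentrating.fanIntegral_add (hK : IsConcentrating m g g₀ p pbar ψ) (n : ℕ) {A : Set V}
    (hA : IsClosed A) {e ν : V} (he : ‖e‖ = 1) (hν : ‖ν‖ = 1) (heν : ⟪e, ν⟫ = 0) {C δ : ℝ}
    (hC : 0 ≤ C) (hδ : 0 < δ) (h : Pinched A x (fun v => ⟪v, ν⟫) C δ) :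
    fanIntegral m (fun w => productKernel (g n) (p n) w + ψ n w) A x e ν 0
      = fanIntegral m (productKernel (g n) (p n)) A x e ν 0 + fanIntegral m (ψ n) A x e ν 0 := by
  obtain ⟨G, hG⟩ := exists_forall_sphere_abs_le (hK.continuousOn n)
  have hG0 : 0 ≤ G := (abs_nonneg _).trans (hG e (mem_sphere_zero_iff_norm.2 he))
  have h1 := (integrable_truncKernel_and_abs_fanIntegral_le (x := x)
    (measurable_productKernel (hK.continuousOn n) (hK.majorant n).measurable) hA
    (fun w hw => abs_productKernel_le (hK.majorant n).nonneg hG hw)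
    ((hK.majorant n).const_mul hG0) hC hδ h he hν heν 0).1
  have h2 := (integrable_truncKernel_and_abs_fanIntegral_le (x := x) (hK.measurable n) hA
    (hK.abs_le n) (hK.majorant_bar n) hC hδ h he hν heν 0).1
  unfold fanIntegral
  rw [← integral_add h1 h2]
  simp only [truncKernel_add]

lemma IsConcentrating.abs_fanIntegral_le (hK : IsConcentrating m g g₀ p pbar ψ) (n : ℕ)
    {A : Set V} (hA : IsClosed A) {e ν : V} (he : ‖e‖ = 1) (hν : ‖ν‖ = 1) (heν : ⟪e, ν⟫ = 0)
    {C δ G : ℝ} (hC : 0 ≤ C) (hδ : 0 < δ) (h : Pinched A x (fun v => ⟪v, ν⟫) C δ)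
    (hG : ∀ θ ∈ sphere (0 : V) 1, |g n θ| ≤ G) :
    |fanIntegral m (fun w => productKernel (g n) (p n) w + ψ n w) A x e ν 0|
      ≤ fanConstant C δ * (G * radialMass m (p n) + radialMass m (pbar n)) := by
  have hG0 : 0 ≤ G := (abs_nonneg _).trans (hG e (mem_sphere_zero_iff_norm.2 he))
  have h1 := (integrable_truncKernel_and_abs_fanIntegral_le (x := x)
    (measurable_productKernel (hK.continuousOn n) (hK.majorant n).measurable) hA
    (fun w hw => abs_productKernel_le (hK.majorant n).nonneg hG hw)
    ((hK.majorant n).const_mul hG0) hC hδ h he hν heν 0).2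
  have h2 := (integrable_truncKernel_and_abs_fanIntegral_le (x := x) (hK.measurable n) hA
    (hK.abs_le n) (hK.majorant_bar n) hC hδ h he hν heν 0).2
  have h3 : ∫ r, min 1 r * (G * p n r) ∂radialMeasure (m + 1) = G * radialMass m (p n) := by
    rw [radialMass, ← integral_const_mul]
    simp only [mul_left_comm]
  rw [h3] at h1
  rw [hK.fanIntegral_add n hA he hν heν hC hδ h]
  refine (abs_add_le _ _).trans ?_
  rw [mul_add]
  exact add_le_add h1 h2

/-- Uniform bound for the normalized directional curvatures. -/
lemma IsConcentrating.exists_bound (hK : IsConcentrating m g g₀ p pbar ψ)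
    (hA : ∀ n, IsClosed (A n)) (hν1 : ∀ n, ‖νn n‖ = 1) {C δ : ℝ} (hC : 0 ≤ C) (hδ : 0 < δ)
    (hpin : ∀ᶠ n in atTop, Pinched (A n) x (fun v => ⟪v, νn n⟫) C δ) :
    ∃ c, ∀ᶠ n in atTop, ∀ e, ‖e‖ = 1 → ⟪e, νn n⟫ = 0 →
      |(radialMass m (p n))⁻¹ *
        fanIntegral m (fun w => productKernel (g n) (p n) w + ψ n w) (A n) x e (νn n) 0| ≤ c := by
  obtain ⟨G, hG⟩ := exists_forall_sphere_abs_le hK.continuousOn_lim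
  refine ⟨fanConstant C δ * (G + 1 + 1), ?_⟩
  filter_upwards [hpin, eventually_forall_sphere_abs_le hK.tendsto hG,
    hK.small.eventually_lt_const one_pos] with n h1 h2 h3 e he heν
  have hM := hK.mass_pos n
  rw [abs_mul, abs_of_pos (inv_pos.2 hM)]
  have hf := fanConstant_nonneg hC hδ
  calc _ ≤ (radialMass m (p n))⁻¹ *
        (fanConstant C δ * ((G + 1) * radialMass m (p n) + radialMass m (pbar n))) := by
        gcongr
        exact hK.abs_fanIntegral_le n (hA n) he (hν1 n) heν hC hδ h1 h2
    _ = fanConstant C δ * (G + 1 + (radialMass m (p n))⁻¹ * radialMass m (pbar n)) := by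
        field_simp
    _ ≤ _ := by gcongr

/-- The limit of the normalized directional curvatures. -/
lemma IsConcentrating.tendsto_fanIntegral (hK : IsConcentrating m g g₀ p pbar ψ)
    (hA : ∀ n, IsClosed (A n))
    (hpin : ∀ η > 0, ∃ δ > 0, ∀ᶠ n in atTop,
      Pinched (A n) x (fun v => ⟪v, νn n⟫ + 1 / 2 * B v v) η δ)
    (hν : Tendsto νn atTop (𝓝 ν)) (he : Tendsto en atTop (𝓝 e₀)) (he₀ : ‖e₀‖ = 1)
    (hν1 : ∀ n, ‖νn n‖ = 1) (he1 : ∀ n, ‖en n‖ = 1) (heν : ∀ n, ⟪en n, νn n⟫ = 0) :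
    Tendsto (fun n => (radialMass m (p n))⁻¹ *
      fanIntegral m (fun w => productKernel (g n) (p n) w + ψ n w) (A n) x (en n) (νn n) 0)
      atTop (𝓝 (g₀ e₀ * B e₀ e₀)) := by
  obtain ⟨δ, hδ, hev⟩ := hpin 1 one_pos
  have hC : 0 ≤ 1 + ‖B‖ / 2 := by positivity
  have hev' : ∀ᶠ n in atTop, Pinched (A n) x (fun v => ⟪v, νn n⟫) (1 + ‖B‖ / 2) δ :=
    hev.mono fun n hn => hn.of_hessian
  obtain ⟨G, hG⟩ := exists_forall_sphere_abs_le hK.continuousOn_lim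
  have h1 := tendsto_integral_of_concentration (m := m) (p := p)
    (I := fun n => angularIntegral m (g n) (A n) x (en n) (νn n))
    (D := (G + 1) * fanConstant (1 + ‖B‖ / 2) δ) hK.majorant
    (Eventually.of_forall hK.mass_pos) hK.concentration
    (by
      filter_upwards [hev'] with n hn
      exact (fanIntegral_productKernel (hK.continuousOn n) (hK.majorant n) (hA n) (he1 n) (hν1 n)
        (heν n) hC hδ hn).1)
    (by
      filter_upwards [hev', eventually_forall_sphere_abs_le hK.tendsto hG] with n hn hGn r hr
      exact abs_angularIntegral_le (he1 n) (hν1 n) (heν n) hC hδ hn hGn hr)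
    (tendsto_angularIntegral_div hK.continuousOn hK.tendsto hK.continuousOn_lim hA hpin hν he he₀
      hν1 he1 heν)
  -- The perturbation needs no limit of its own: the fan bound controls it by its radial mass, which
  -- is negligible.
  have h2 : Tendsto (fun n => (radialMass m (p n))⁻¹ *
      fanIntegral m (ψ n) (A n) x (en n) (νn n) 0) atTop (𝓝 0) := by
    have h3 := hK.small.const_mul (fanConstant (1 + ‖B‖ / 2) δ)
    rw [mul_zero] at h3
    refine squeeze_zero_norm' ?_ h3
    filter_upwards [hev'] with n hn
    have h4 := (integrable_truncKernel_and_abs_fanIntegral_le (x := x) (hK.measurable n) (hA n)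
      (hK.abs_le n) (hK.majorant_bar n) hC hδ hn (he1 n) (hν1 n) (heν n) 0).2
    rw [norm_mul, Real.norm_of_nonneg (inv_pos.2 (hK.mass_pos n)).le, Real.norm_eq_abs,
      mul_left_comm]
    exact mul_le_mul_of_nonneg_left h4 (inv_pos.2 (hK.mass_pos n)).le
  have h3 := h1.add h2
  rw [add_zero] at h3
  refine h3.congr' ?_
  filter_upwards [hev'] with n hn
  rw [hK.fanIntegral_add n (hA n) (he1 n) (hν1 n) (heν n) hC hδ hn, mul_add,
    (fanIntegral_productKernel (hK.continuousOn n) (hK.majorant n) (hA n) (he1 n) (hν1 n)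
        (heν n) hC hδ hn).2]

end DirectionalLimit

/-! ### Masses of the kernels -/

section Masses

variable {m : ℕ} {g j : EuclideanSpace ℝ (Fin (m + 2)) → ℝ} {p : ℝ → ℝ}

lemma min_one_norm_mul_anisotropicKernel (hjp : ∀ w, w ≠ 0 → j w = p ‖w‖)
    (w : EuclideanSpace ℝ (Fin (m + 2))) :
    min 1 ‖w‖ * anisotropicKernel g j w = angularPart g w * (min 1 ‖w‖ * p ‖w‖) := by
  by_cases hw : w = 0
  · simp [hw, angularPart_zero]
  · rw [anisotropicKernel, angularPart_of_ne hw, hjp w hw]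
    ring

/-- This factorization is the source of `C_g⁻¹` in the limits; the analysis itself normalizes by the
radial mass alone. -/
lemma kernelMass_anisotropicKernel (hg : ContinuousOn g (sphere 0 1))
    (hp : IsMajorant (m + 1) p) (hjp : ∀ w, w ≠ 0 → j w = p ‖w‖) :
    kernelMass (anisotropicKernel g j) = sphericalMass g * radialMass m p := by
  have hm := hp.measurable
  unfold kernelMass
  simp_rw [min_one_norm_mul_anisotropicKernel hjp]
  exact integral_angularPart_mul (by simp) hg (F := fun r => min 1 r * p r) (by fun_prop)

lemma integral_min_one_norm_mul (hp : IsMajorant (m + 1) p) (hjp : ∀ w, w ≠ 0 → j w = p ‖w‖) :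
    ∫ w, min 1 ‖w‖ * j w
      = (volume : Measure (EuclideanSpace ℝ (Fin (m + 2)))).toSphere.real univ
        * radialMass m p := by
  have h1 := kernelMass_anisotropicKernel (g := fun _ => 1) continuousOn_const hp hjp
  simpa [kernelMass, anisotropicKernel, sphericalMass] using h1

/-- The angular mass cancels, so the tightness hypothesis concerns only the radial profile. -/
lemma toReal_kernelMeasure_compl_ball (hg : ContinuousOn g (sphere 0 1))
    (hg0 : ∀ θ ∈ sphere (0 : EuclideanSpace ℝ (Fin (m + 2))) 1, 0 ≤ g θ)
    (hp : IsMajorant (m + 1) p) (hjp : ∀ w, w ≠ 0 → j w = p ‖w‖) (hS : 0 < sphericalMass g)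
    (R : ℝ) :
    (kernelMeasure (anisotropicKernel g j) (ball 0 R)ᶜ).toReal
      = (radialMass m p)⁻¹ *
        ∫ r, (Ici R).indicator (fun r => min 1 r * p r) r ∂radialMeasure (m + 1) := by
  have hm := hp.measurable
  set C := kernelMass (anisotropicKernel g j) with hCdef
  have hC : C = sphericalMass g * radialMass m p := kernelMass_anisotropicKernel hg hp hjp
  have hM := radialMass_nonneg hp
  have hC0 : 0 ≤ C := by rw [hC]; positivity
  have hFm : Measurable fun r => min 1 r * p r := by fun_prop
  have hint : Integrable fun w : EuclideanSpace ℝ (Fin (m + 2)) =>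
      min 1 ‖w‖ * anisotropicKernel g j w := by
    simp_rw [min_one_norm_mul_anisotropicKernel hjp]
    exact integrable_angularPart_mul (by simp) hg (F := fun r => min 1 r * p r) hFm hp.integrable
  have hnn : ∀ w : EuclideanSpace ℝ (Fin (m + 2)),
      0 ≤ C⁻¹ * (min 1 ‖w‖ * anisotropicKernel g j w) := by
    intro w
    rw [min_one_norm_mul_anisotropicKernel hjp]
    have h1 : 0 ≤ angularPart g w :=
      indicator_nonneg (fun w hw => hg0 _ (inv_norm_smul_mem_sphere hw)) w
    have h2 := hp.nonneg ‖w‖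
    positivity
  rw [kernelMeasure, withDensity_apply _ measurableSet_ball.compl,
    ← ofReal_integral_eq_lintegral_ofReal (hint.const_mul _).integrableOn (ae_of_all _ hnn),
    ENNReal.toReal_ofReal (integral_nonneg hnn), integral_const_mul,
    ← integral_indicator measurableSet_ball.compl]
  have h1 : ∀ w, (ball (0 : EuclideanSpace ℝ (Fin (m + 2))) R)ᶜ.indicator
      (fun w => min 1 ‖w‖ * anisotropicKernel g j w) w
      = angularPart g w * (Ici R).indicator (fun r => min 1 r * p r) ‖w‖ := by
    intro w
    by_cases h : R ≤ ‖w‖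
    · rw [indicator_of_mem (by simpa using h), indicator_of_mem (by exact h),
        min_one_norm_mul_anisotropicKernel hjp]
    · rw [indicator_of_notMem (by simpa using h), indicator_of_notMem (by exact h), mul_zero]
  simp_rw [h1]
  rw [integral_angularPart_mul (m := m) (by simp) hg (hFm.indicator measurableSet_Ici), hC, mul_inv]
  have h2 : ∫ θ : sphere (0 : EuclideanSpace ℝ (Fin (m + 2))) 1, g θ ∂volume.toSphere
      = sphericalMass g := rfl
  rw [h2]
  field_simp

/-- By monotonicity a profile positive at one point is positive at all smaller radii, a set of
positive measure. -/
lemma radialMass_pos (hp : IsMajorant (m + 1) p) (hj : IsRadialProfile j)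
    (hjp : ∀ w, w ≠ 0 → j w = p ‖w‖) (hpos : ∃ w, w ≠ 0 ∧ 0 < j w) : 0 < radialMass m p := by
  obtain ⟨w, hw, hjw⟩ := hpos
  have hw0 := norm_pos_iff.2 hw
  have hp_pos : ∀ r ∈ Ioc 0 ‖w‖, 0 < p r := by
    intro r hr
    have hn : ‖(r / ‖w‖) • w‖ = r := by
      rw [norm_smul, Real.norm_of_nonneg (div_nonneg hr.1.le hw0.le), div_mul_cancel₀ _ hw0.ne']
    have hne : (r / ‖w‖) • w ≠ 0 := by rw [← norm_pos_iff, hn]; exact hr.1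
    rw [← hn, ← hjp _ hne]
    exact hjw.trans_le (hj.antitone _ _ hne (by rw [hn]; exact hr.2))
  unfold radialMass
  rw [integral_radialMeasure]
  have hint := (integrable_radialMeasure_iff _ _).1 hp.integrable
  rw [setIntegral_pos_iff_support_of_nonneg_ae _ hint]
  · refine lt_of_lt_of_le ?_ (measure_mono (s := Ioc 0 ‖w‖) fun r hr => ⟨?_, hr.1⟩)
    · simpa using hw0
    · have h1 := hp_pos r hr
      have h2 : 0 < r := hr.1
      have h3 : 0 < min 1 r := by positivity
      rw [Function.mem_support]
      positivity
  · filter_upwards [ae_restrict_mem measurableSet_Ioi] with r hr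
    have hr : 0 < r := hr
    have h1 := hp.nonneg r
    have h3 : 0 < min 1 r := by positivity
    simp only [Pi.zero_apply]
    positivity

end Masses

/-! ### Total mass of the angular densities. -/

section SphericalMass

variable {d : ℕ}

lemma tendsto_sphericalMass {g : ℕ → EuclideanSpace ℝ (Fin d) → ℝ}
    {g₀ : EuclideanSpace ℝ (Fin d) → ℝ} (hgc : ∀ n, ContinuousOn (g n) (sphere 0 1))
    (hg : TendstoUniformlyOn g g₀ atTop (sphere 0 1)) (hg₀ : ContinuousOn g₀ (sphere 0 1)) :
    Tendsto (fun n => sphericalMass (g n)) atTop (𝓝 (sphericalMass g₀)) := by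
  obtain ⟨G, hG⟩ := exists_forall_sphere_abs_le hg₀
  refine tendsto_integral_filter_of_dominated_convergence (fun _ => G + 1)
    (Eventually.of_forall fun n => ?_) ?_ (integrable_const _) (ae_of_all _ fun θ => ?_)
  · exact ((hgc n).comp_continuous continuous_subtype_val fun θ => θ.2).aestronglyMeasurable
  · filter_upwards [eventually_forall_sphere_abs_le hg hG] with n hn
    exact ae_of_all _ fun θ => hn θ θ.2
  · exact hg.tendsto_at θ.2

lemma sphericalMass_pos {g₀ : EuclideanSpace ℝ (Fin d) → ℝ} (hg₀ : ContinuousOn g₀ (sphere 0 1))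
    (hnn : ∀ θ ∈ sphere (0 : EuclideanSpace ℝ (Fin d)) 1, 0 ≤ g₀ θ)
    (hne : ∃ θ ∈ sphere (0 : EuclideanSpace ℝ (Fin d)) 1, g₀ θ ≠ 0) : 0 < sphericalMass g₀ := by
  obtain ⟨θ, hθ, hθ0⟩ := hne
  have hc : Continuous fun θ : sphere (0 : EuclideanSpace ℝ (Fin d)) 1 => g₀ θ :=
    hg₀.comp_continuous continuous_subtype_val fun θ => θ.2
  exact hc.integral_pos_of_hasCompactSupport_nonneg_nonzero (x := ⟨θ, hθ⟩)
    (HasCompactSupport.of_compactSpace _) (fun θ => hnn θ θ.2) hθ0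

end SphericalMass

/-! ### Normals and reflections -/

section Normals

variable {V : Type*} [NormedAddCommGroup V] [InnerProductSpace ℝ V]

lemma IsC2Set.isClosed {E : Set V} (hE : IsC2Set E) : IsClosed E := by
  rw [← hE.closure_interior]
  exact isClosed_closure

lemma IsC2Set.exists_isNormalGraph_outerNormal {E : Set V} (hE : IsC2Set E) {x : V}
    (hx : x ∈ frontier E) : ∃ f : V → ℝ, IsNormalGraph E x (outerNormal E x) f := by
  have h := hE.exists_graph x hx
  rw [outerNormal, dif_pos h]
  exact h.choose_spec

/-- The graph function returned is the very one chosen in the definition of the curvature, so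
independence of that choice need not be proved. -/
lemma exists_directionalCurvature_eq {E : Set V} {x : V}
    (h : ∃ f : V → ℝ, IsNormalGraph E x (outerNormal E x) f) :
    ∃ f : V → ℝ, IsNormalGraph E x (outerNormal E x) f ∧
      ∀ e, ⟪e, outerNormal E x⟫ = 0 →
        directionalCurvature E x e = graphHessian (outerNormal E x) f e e := by
  refine ⟨h.choose, h.choose_spec, fun e he => ?_⟩
  rw [directionalCurvature, dif_pos h, graphHessian_apply, tangentialCLM_apply, tangentialPart, he,
    zero_smul, sub_zero]

/-- An isometry of the hyperplane orthogonal to `ν` onto the hyperplane orthogonal to `ν'`, close to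
the inclusion if `ν'` is close to `ν`. -/
def hyperplaneIsometry (ν ν' : V) : (ℝ ∙ ν)ᗮ →ₗᵢ[ℝ] V :=
  ((ℝ ∙ (ν + ν'))ᗮ.reflection).toLinearIsometry.comp (ℝ ∙ ν)ᗮ.subtypeₗᵢ

/-- The reflection across the hyperplane orthogonal to `ν + ν'` sends `ν` to `-ν'` and preserves
orthogonality. -/
lemma inner_hyperplaneIsometry {ν ν' : V} (hν : ‖ν‖ = 1) (hν' : ‖ν'‖ = 1) (w : (ℝ ∙ ν)ᗮ) :
    ⟪hyperplaneIsometry ν ν' w, ν'⟫ = 0 := by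
  have h1 : (ℝ ∙ (ν + ν'))ᗮ.reflection ν = -ν' := by
    have h2 := Submodule.reflection_sub (v := ν) (w := -ν') (by rw [norm_neg, hν, hν'])
    simpa only [sub_neg_eq_add] using h2
  have h3 : ν' = -(ℝ ∙ (ν + ν'))ᗮ.reflection ν := by rw [h1, neg_neg]
  have h4 : ⟪hyperplaneIsometry ν ν' w, (ℝ ∙ (ν + ν'))ᗮ.reflection ν⟫ = ⟪(w : V), ν⟫ :=
    (ℝ ∙ (ν + ν'))ᗮ.reflection.inner_map_map (w : V) ν
  have h5 : ⟪(w : V), ν⟫ = 0 := Submodule.mem_orthogonal_singleton_iff_inner_left.1 w.2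
  rw [h1, inner_neg_right] at h4
  linarith

/-- The reflection moves `w` by a multiple of `⟪ν + νn, w⟫`, which tends to `2 ⟪ν, w⟫ = 0`.
Reflecting along the sum of the normals keeps the denominator away from zero. -/
lemma tendsto_hyperplaneIsometry {ν : V} {νn : ℕ → V} (hν : ‖ν‖ = 1)
    (h : Tendsto νn atTop (𝓝 ν)) (w : (ℝ ∙ ν)ᗮ) :
    Tendsto (fun n => hyperplaneIsometry ν (νn n) w) atTop (𝓝 (w : V)) := by
  have h5 : ⟪ν, (w : V)⟫ = 0 := Submodule.mem_orthogonal_singleton_iff_inner_right.1 w.2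
  have h1 : ∀ n, hyperplaneIsometry ν (νn n) w
      = (w : V) - (2 : ℝ) • (⟪ν + νn n, (w : V)⟫ / ‖ν + νn n‖ ^ 2) • (ν + νn n) := by
    intro n
    change (ℝ ∙ (ν + νn n))ᗮ.reflection (w : V) = _
    rw [Submodule.reflection_orthogonal_apply, Submodule.reflection_singleton_apply]
    simp [two_smul]
  simp_rw [h1]
  have h2 : Tendsto (fun n => ν + νn n) atTop (𝓝 (ν + ν)) := h.const_add ν
  have hne : ‖ν + ν‖ ^ 2 ≠ 0 := by
    rw [← two_smul ℝ ν, norm_smul, hν]; norm_num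
  have h3 : Tendsto (fun n => ⟪ν + νn n, (w : V)⟫) atTop (𝓝 ⟪ν + ν, (w : V)⟫) :=
    h2.inner tendsto_const_nhds
  have h4 := (((h3.div (h2.norm.pow 2) hne).smul h2).const_smul (2 : ℝ)).const_sub (w : V)
  simpa [inner_add_left, h5] using h4

lemma lebesgue_eq_volume (W : Type*) [NormedAddCommGroup W] [InnerProductSpace ℝ W]
    [FiniteDimensional ℝ W] [MeasurableSpace W] [BorelSpace W] :
    lebesgue W = (volume : Measure W) :=
  (stdOrthonormalBasis ℝ W).addHaar_eq_volume

lemma integral_tangentSphereMeasure [FiniteDimensional ℝ V] [MeasurableSpace V] [BorelSpace V]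
    (ν : V) (F : V → ℝ) :
    ∫ e, F e ∂tangentSphereMeasure ν
      = ∫ e : sphere (0 : (ℝ ∙ ν)ᗮ) 1, F ((e : (ℝ ∙ ν)ᗮ) : V)
        ∂(volume : Measure (ℝ ∙ ν)ᗮ).toSphere := by
  unfold tangentSphereMeasure
  rw [lebesgue_eq_volume]
  have h1 : MeasurableEmbedding (fun w : (ℝ ∙ ν)ᗮ => (w : V)) :=
    MeasurableEmbedding.subtype_coe (Submodule.isClosed_orthogonal _).measurableSet
  have h2 : MeasurableEmbedding (fun e : sphere (0 : (ℝ ∙ ν)ᗮ) 1 => (e : (ℝ ∙ ν)ᗮ)) :=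
    MeasurableEmbedding.subtype_coe isClosed_sphere.measurableSet
  exact (h1.comp h2).integral_map F

end Normals

end NonlocalCurvature

end

/-! ### Proof of the proposition. -/

open NonlocalCurvature in
theorem proposition4p3 (d : ℕ) (hd : 2 ≤ d)
    -- the kernels `φ_ε(x) = g_ε(x / |x|) j_ε(x)`, `ε > 0`
    (j g : ℝ → EuclideanSpace ℝ (Fin d) → ℝ) (g₀ : EuclideanSpace ℝ (Fin d) → ℝ)
    (hj : ∀ ε > 0, IsRadialProfile (j ε))
    (hj_pos : ∀ ε > 0, ∃ x, x ≠ 0 ∧ 0 < j ε x)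
    (hg_cont : ∀ ε > 0, ContinuousOn (g ε) (sphere 0 1))
    (hg_nonneg : ∀ ε > 0, ∀ θ ∈ sphere (0 : EuclideanSpace ℝ (Fin d)) 1, 0 ≤ g ε θ)
    (hg_even : ∀ ε > 0, ∀ θ ∈ sphere (0 : EuclideanSpace ℝ (Fin d)) 1, g ε (-θ) = g ε θ)
    (hg_lim : TendstoUniformlyOn g g₀ (𝓝[>] 0) (sphere 0 1))
    (hg_ne : ∃ θ ∈ sphere (0 : EuclideanSpace ℝ (Fin d)) 1, g₀ θ ≠ 0)
    (φ : ℝ → EuclideanSpace ℝ (Fin d) → ℝ)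
    (hφ : ∀ ε > 0, φ ε = anisotropicKernel (g ε) (j ε))
    (h_tight : ∀ R > 0, Tendsto (fun ε => kernelMeasure (φ ε) (ball 0 R)ᶜ) (𝓝[>] 0) (𝓝 0))
    -- the perturbations
    (ψ jbar : ℝ → EuclideanSpace ℝ (Fin d) → ℝ)
    (hψ_meas : ∀ ε > 0, Measurable (ψ ε))
    (hψ_sum : ∀ ε > 0, ∀ x, x ≠ 0 → 0 ≤ φ ε x + ψ ε x)
    (hψ_even : ∀ ε > 0, ∀ x, ψ ε (-x) = ψ ε x)
    (hψ_le : ∀ ε > 0, ∀ x, x ≠ 0 → |ψ ε x| ≤ jbar ε x)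
    (hjbar : ∀ ε > 0, IsRadialProfile (jbar ε))
    (h_small : Tendsto (fun ε => (kernelMass (φ ε))⁻¹ * ∫ x, min 1 ‖x‖ * jbar ε x)
      (𝓝[>] 0) (𝓝 0))
    -- the parameters, the sets and the point
    (ε : ℕ → ℝ) (hε_pos : ∀ n, 0 < ε n) (hε_lim : Tendsto ε atTop (𝓝 0))
    (E : Set (EuclideanSpace ℝ (Fin d))) (hE : IsC2Set E)
    (En : ℕ → Set (EuclideanSpace ℝ (Fin d))) (hEn : ∀ n, IsC2Set (En n))
    (h_conv : C2Converges En E)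
    (x : EuclideanSpace ℝ (Fin d)) (hx : x ∈ frontier E) (hxn : ∀ n, x ∈ frontier (En n)) :
    -- directional curvatures; `e n = e₀` is allowed when `e₀` is tangent to all the sets `En n`
    (∀ e₀ : EuclideanSpace ℝ (Fin d), ‖e₀‖ = 1 → inner ℝ e₀ (outerNormal E x) = 0 →
      ∀ e : ℕ → EuclideanSpace ℝ (Fin d),
        (∀ n, ‖e n‖ = 1 ∧ inner ℝ (e n) (outerNormal (En n) x) = 0) →
        Tendsto e atTop (𝓝 e₀) →
        ∃ K : ℕ → ℝ,
          (∀ n, HasNonlocalDirectionalCurvature (fun y => φ (ε n) y + ψ (ε n) y) x (e n) (En n)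
            (K n)) ∧
          Tendsto (fun n => (kernelMass (φ (ε n)))⁻¹ * K n) atTop
            (𝓝 ((sphericalMass g₀)⁻¹ * g₀ e₀ * directionalCurvature E x e₀))) ∧
    -- mean curvatures
    (∃ H : ℕ → ℝ,
      (∀ n, HasNonlocalMeanCurvature (fun y => φ (ε n) y + ψ (ε n) y) x (En n) (H n)) ∧
      Tendsto (fun n => (kernelMass (φ (ε n)))⁻¹ * H n) atTop
        (𝓝 ((sphericalMass g₀ * sphereArea (d - 2))⁻¹ *
          ∫ e, g₀ e * directionalCurvature E x e ∂(tangentSphereMeasure (outerNormal E x))))) := by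
  obtain ⟨m, rfl⟩ := Nat.exists_eq_add_of_le' hd
  simp only [Nat.add_sub_cancel]
  have hε : Tendsto ε atTop (𝓝[>] 0) :=
    tendsto_nhdsWithin_iff.2 ⟨hε_lim, Eventually.of_forall hε_pos⟩
  -- radial parts of the kernels
  choose p hp hjp using fun n => (hj (ε n) (hε_pos n)).exists_isMajorant
  choose pbar hpbar hjbarp using fun n => (hjbar (ε n) (hε_pos n)).exists_isMajorant
  have hgc : ∀ n, ContinuousOn (g (ε n)) (sphere 0 1) := fun n => hg_cont _ (hε_pos n)
  have hgu : TendstoUniformlyOn (fun n => g (ε n)) g₀ atTop (sphere 0 1) :=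
    fun u hu => hε.eventually (hg_lim u hu)
  have hg₀ : ContinuousOn g₀ (sphere 0 1) :=
    hgu.continuousOn (Eventually.of_forall hgc).frequently
  have hg₀_nonneg : ∀ θ ∈ sphere (0 : EuclideanSpace ℝ (Fin (m + 2))) 1, 0 ≤ g₀ θ :=
    fun θ hθ => ge_of_tendsto' (hgu.tendsto_at hθ) fun n => hg_nonneg _ (hε_pos n) θ hθ
  have hS₀ := sphericalMass_pos hg₀ hg₀_nonneg hg_ne
  have hS := tendsto_sphericalMass hgc hgu hg₀
  have hM : ∀ n, 0 < radialMass m (p n) := fun n =>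
    radialMass_pos (hp n) (hj _ (hε_pos n)) (hjp n) (hj_pos _ (hε_pos n))
  have hmass : ∀ n, kernelMass (φ (ε n)) = sphericalMass (g (ε n)) * radialMass m (p n) :=
    fun n => by
      rw [hφ _ (hε_pos n)]
      exact kernelMass_anisotropicKernel (hgc n) (hp n) (hjp n)
  -- the perturbations, modified at the origin
  let χ : ℕ → EuclideanSpace ℝ (Fin (m + 2)) → ℝ := fun n => ({0}ᶜ : Set _).indicator (ψ (ε n))
  have hχ_ne : ∀ n w, w ≠ 0 → χ n w = ψ (ε n) w := fun n w hw => indicator_of_mem (by exact hw) _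
  have hK : IsConcentrating m (fun n => g (ε n)) g₀ p pbar χ :=
    { majorant := hp
      majorant_bar := hpbar
      continuousOn := hgc
      tendsto := hgu
      continuousOn_lim := hg₀
      mass_pos := hM
      concentration := by
        intro R hR
        have h1 := (ENNReal.tendsto_toReal ENNReal.zero_ne_top).comp ((h_tight R hR).comp hε)
        rw [ENNReal.toReal_zero] at h1
        refine h1.congr' ?_
        filter_upwards [hS.eventually_const_lt hS₀] with n hn
        simp only [Function.comp_apply]
        rw [hφ _ (hε_pos n)]
        exact toReal_kernelMeasure_compl_ball (hgc n) (hg_nonneg _ (hε_pos n)) (hp n) (hjp n) hn R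
      measurable := fun n => (hψ_meas _ (hε_pos n)).indicator (measurableSet_singleton _).compl
      abs_le := fun n w hw => by
        rw [hχ_ne n w hw, ← hjbarp n w hw]
        exact hψ_le _ (hε_pos n) w hw
      small := by
        have : Nontrivial (EuclideanSpace ℝ (Fin (m + 2))) :=
          Module.nontrivial_of_finrank_pos (R := ℝ) (by simp)
        have hσ : (volume : Measure (EuclideanSpace ℝ (Fin (m + 2)))).toSphere.real univ ≠ 0 := by
          rw [measureReal_def]
          exact ENNReal.toReal_ne_zero.2
            ⟨Measure.measure_univ_ne_zero.2 (Measure.toSphere_ne_zero _), measure_ne_top _ _⟩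
        -- The hypothesis divides by the full mass and integrates over space. Multiplying by the
        -- angular mass of `g` and dividing by the area of the sphere leaves the ratio of radial
        -- masses.
        have h1 := ((h_small.comp hε).mul hS).mul_const
          ((volume : Measure (EuclideanSpace ℝ (Fin (m + 2)))).toSphere.real univ)⁻¹
        rw [zero_mul, zero_mul] at h1
        refine h1.congr' ?_
        filter_upwards [hS.eventually_const_lt hS₀] with n hn
        have h2 := hM n
        simp only [Function.comp_apply]
        rw [hmass n, integral_min_one_norm_mul (hpbar n) (hjbarp n)]
        field_simp }
  -- the kernels
  let k : ℕ → EuclideanSpace ℝ (Fin (m + 2)) → ℝ :=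
    fun n w => productKernel (g (ε n)) (p n) w + χ n w
  have hk_eq : ∀ n w, w ≠ 0 → k n w = φ (ε n) w + ψ (ε n) w := by
    intro n w hw
    simp only [k]
    rw [hχ_ne n w hw, productKernel, angularPart_of_ne hw, hφ _ (hε_pos n), anisotropicKernel,
      hjp n w hw]
  have hk_meas : ∀ n, Measurable (k n) := fun n =>
    (measurable_productKernel (hgc n) (hp n).measurable).add (hK.measurable n)
  have hk_even : ∀ n w, k n (-w) = k n w := by
    intro n w
    simp only [k]
    rw [productKernel_neg (hg_even _ (hε_pos n))]
    congr 1
    by_cases hw : w = 0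
    · simp [hw]
    · rw [hχ_ne n w hw, hχ_ne n (-w) (neg_ne_zero.2 hw), hψ_even _ (hε_pos n)]
  choose G hG using fun n => exists_forall_sphere_abs_le (hgc n)
  have hk_le : ∀ n w, w ≠ 0 → |k n w| ≤ |G n| * p n ‖w‖ + pbar n ‖w‖ := by
    intro n w hw
    refine (abs_add_le _ _).trans (add_le_add ?_ (hK.abs_le n w hw))
    exact abs_productKernel_le (hp n).nonneg (fun θ hθ => (hG n θ hθ).trans (le_abs_self _)) hw
  have hk_maj : ∀ n, IsMajorant (m + 1) fun r => |G n| * p n r + pbar n r := fun n =>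
    ((hp n).const_mul (abs_nonneg _)).add (hpbar n)
  -- the sets
  obtain ⟨f, hf, hcurv⟩ :=
    exists_directionalCurvature_eq (hE.exists_isNormalGraph_outerNormal hx)
  choose fn hfn using fun n => (hEn n).exists_isNormalGraph_outerNormal (hxn n)
  have hclosed : ∀ n, IsClosed (En n) := fun n => (hEn n).isClosed
  have hν1 : ∀ n, ‖outerNormal (En n) x‖ = 1 := fun n => (hfn n).norm_eq_one
  -- These constants depend on `n` and serve existence for every `n`; the uniform estimates come
  -- from `hpin_lim`, which holds only for large `n`.
  choose C δ hC hδ hpin using fun n => (hfn n).exists_pinched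
  obtain ⟨hν_lim, hpin_lim⟩ := tendsto_normal_and_pinched hE.isClosed h_conv hxn hf hfn
  have hnorm : ∀ n, (kernelMass (φ (ε n)))⁻¹
      = (sphericalMass (g (ε n)))⁻¹ * (radialMass m (p n))⁻¹ := fun n => by rw [hmass n, mul_inv]
  have hS_inv := hS.inv₀ hS₀.ne'
  refine ⟨fun e₀ he₀ he₀ν e he he_lim => ?_, ?_⟩
  · refine ⟨fun n => fanIntegral m (k n) (En n) x (e n) (outerNormal (En n) x) 0, fun n => ?_, ?_⟩
    · exact (hasNonlocalDirectionalCurvature_fanIntegral (hk_meas n) (hclosed n) (hk_even n)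
        (hk_le n) (hk_maj n) (hC n) (hδ n) (hpin n) (he n).1 (hν1 n) (he n).2).congr (hk_eq n)
    · have h1 := hS_inv.mul (hK.tendsto_fanIntegral hclosed hpin_lim hν_lim he_lim he₀ hν1
        (fun n => (he n).1) (fun n => (he n).2))
      rw [hcurv e₀ he₀ν, mul_assoc]
      refine h1.congr fun n => ?_
      rw [hnorm n, mul_assoc]
  · set ν := outerNormal E x with hν
    have hfin : Module.finrank ℝ (ℝ ∙ ν)ᗮ = m + 1 := by
      have : Fact (Module.finrank ℝ (EuclideanSpace ℝ (Fin (m + 2))) = m + 1 + 1) := ⟨by simp⟩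
      exact Submodule.finrank_orthogonal_span_singleton
        (norm_pos_iff.1 (by rw [hf.norm_eq_one]; exact one_pos))
    have : Nontrivial (ℝ ∙ ν)ᗮ := Module.nontrivial_of_finrank_pos (R := ℝ) (by omega)
    -- All mean curvatures are written over the unit sphere of the limit tangent hyperplane, where
    -- the limit can be taken under the integral.
    let ι : ∀ n, (ℝ ∙ ν)ᗮ →ₗᵢ[ℝ] EuclideanSpace ℝ (Fin (m + 2)) :=
      fun n => hyperplaneIsometry ν (outerNormal (En n) x)
    have hι : ∀ n w, ⟪ι n w, outerNormal (En n) x⟫ = 0 := fun n w =>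
      inner_hyperplaneIsometry hf.norm_eq_one (hν1 n) w
    have hι1 : ∀ n (e : sphere (0 : (ℝ ∙ ν)ᗮ) 1), ‖ι n e‖ = 1 := fun n e => by
      rw [(ι n).norm_map]; simp
    refine ⟨fun n => (sphereArea m)⁻¹ * ∫ e : sphere (0 : (ℝ ∙ ν)ᗮ) 1,
      fanIntegral m (k n) (En n) x (ι n e) (outerNormal (En n) x) 0
        ∂(volume : Measure (ℝ ∙ ν)ᗮ).toSphere, fun n => ?_, ?_⟩
    · exact (hasNonlocalMeanCurvature_integral (ι n) (hν1 n) (hι n) hfin (hk_meas n) (hclosed n)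
        (hk_even n) (hk_le n) (hk_maj n) (hC n) (hδ n) (hpin n)).congr (hk_eq n)
    · rw [integral_tangentSphereMeasure]
      obtain ⟨δ₀, hδ₀, hev⟩ := hpin_lim 1 one_pos
      obtain ⟨c, hc⟩ := hK.exists_bound hclosed hν1
        (by positivity : 0 ≤ 1 + ‖graphHessian ν f‖ / 2) hδ₀ (hev.mono fun n hn => hn.of_hessian)
      have h1 : Tendsto (fun n => ∫ e : sphere (0 : (ℝ ∙ ν)ᗮ) 1, (radialMass m (p n))⁻¹ *
          fanIntegral m (k n) (En n) x (ι n e) (outerNormal (En n) x) 0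
            ∂(volume : Measure (ℝ ∙ ν)ᗮ).toSphere) atTop
          (𝓝 (∫ e : sphere (0 : (ℝ ∙ ν)ᗮ) 1, g₀ ((e : (ℝ ∙ ν)ᗮ) : EuclideanSpace ℝ (Fin (m + 2)))
            * directionalCurvature E x ((e : (ℝ ∙ ν)ᗮ) : EuclideanSpace ℝ (Fin (m + 2)))
            ∂(volume : Measure (ℝ ∙ ν)ᗮ).toSphere)) := by
        refine tendsto_integral_filter_of_dominated_convergence (fun _ => c)
          (Eventually.of_forall fun n => ?_) ?_ (integrable_const _) (ae_of_all _ fun e => ?_)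
        · exact (tendsto_space_integral_rawKernel (ι n) (hν1 n) (hι n) (by simp) hfin (hk_meas n)
            (hclosed n) (hk_even n) (hk_le n) (hk_maj n) (hC n) (hδ n) (hpin n)).1.const_mul _
        · filter_upwards [hc] with n hn
          exact ae_of_all _ fun e => hn (ι n e) (hι1 n e) (hι n e)
        · have he1 : ‖((e : (ℝ ∙ ν)ᗮ) : EuclideanSpace ℝ (Fin (m + 2)))‖ = 1 :=
            norm_eq_of_mem_sphere e
          rw [hcurv _ (Submodule.mem_orthogonal_singleton_iff_inner_left.1 (e : (ℝ ∙ ν)ᗮ).2)]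
          -- For a fixed point of the sphere its images under the isometries are unit tangent
          -- vectors converging to it, so the directional limit applies.
          exact hK.tendsto_fanIntegral hclosed hpin_lim hν_lim
            (tendsto_hyperplaneIsometry hf.norm_eq_one hν_lim (e : (ℝ ∙ ν)ᗮ)) he1 hν1
            (fun n => hι1 n e) (fun n => hι n e)
      have h2 := (hS_inv.mul h1).const_mul (sphereArea m)⁻¹
      rw [mul_inv, mul_assoc, mul_left_comm]
      refine h2.congr fun n => ?_
      rw [hnorm n, integral_const_mul]
      ring
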